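/- Let $m,n\ge 1$ and $g=(g_0,\dots,g_{m-1})\in\mathbb C^m$ with $|g|:=\sum_i g_i\neq 0$; indices $i$ are read in $\mathbb Z/m$. Put $$c_i(u)=\sum_{r=0}^{i}u_r-\sum_{s=0}^{m-1}\tfrac{m-s}{m}u_s\quad(u\in\mathbb C^m,\ 0\le i\le m-1),\qquad c_i=c_i(g).$$ **The spaces.** Let $V=V_0\oplus\dots\oplus V_{m-1}$ with $V_i=\mathbb C^n$. Consider quadruples $(X,P,v,w)$ consisting of linear maps $X_i\colon V_i\to V_{i+1}$, $P_i\colon V_{i+1}\to V_i$, $v_i\colon\mathbb C^{d_i}\to V_i$, $w_i\colon V_i\to\mathbb C^{d_i}$ ($i\in\mathbb Z/m$), assembled into $X,P\in\operatorname{End}(V)$, $v\colon\bigoplus_i\mathbb C^{d_i}\to V$, $w\colon V\to\bigoplus_i\mathbb C^{d_i}$, that satisfy $[X,P]=vw-g\mathbf 1_V$, where $g\mathbf 1_V$ acts on $V_i$ as $g_i$. The group $\prod_i GL(V_i)$ acts by $(MXM^{-1},MPM^{-1},Mv,wM^{-1})$. The orbit space with the quotient topology is the Calogero–Moser space: the spinless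 one, $\mathcal C_n^m$, if $d_0=1$ and $d_i=0$ for $i\ne0$; the spin one, $s\mathcal C_n^m$, if $d_i=d$ for all $i$, for a fixed $d\geq 1$. Let $A(z)=\det(z-P)$, $C(z)=\operatorname{tr}(X\operatorname{adj}(z-P)vw)$ and $s=C/(|g|A')\in\mathbb C(z)$. Let $U$ be the set of the orbits that contain a quadruple with $P_0=\dots=P_{m-1}=\operatorname{diag}(\lambda_1,\dots,\lambda_n)$, where all $\lambda_j\neq0$ and $\lambda_j^m\ne\lambda_k^m$ for $j\neq k$; such $\lambda$ are called regular. **Coordinates, spinless case.** For regular $\lambda$ and $\phi\in\mathbb C^n$ let $\tilde P_i=\operatorname{diag}(\lambda)$, $\tilde v_0=(1,\dots,1)^{\top}$, $\tilde w_0=|g|(1,\dots,1)$ and $$(\tilde X_i)_{jj}=\phi_j+c_i\lambda_j^{-1},\qquad (\tilde X_i)_{jk}=-|g|\,\frac{\lambda_j^{m-i-1}\lambda_k^{i}}{\lambda_j^m-\lambda_k^m}\quad(j\ne k),$$ $$\{f,h\}=m\sum_{j}\Big(\frac{\partial f}{\partial\lambda_j}\frac{\partial h}{\partial\phi_j}-\frac{\partial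 f}{\partial\phi_j}\frac{\partial h}{\partial\lambda_j}\Big).$$ **Coordinates, spin case.** For regular $\lambda$, $\phi\in\mathbb C^n$, and matrices $\tilde v_i\in\mathbb C^{n\times d}$, $\tilde w_i\in\mathbb C^{d\times n}$ subject to $\sum_i[\tilde v_i\tilde w_i]_{jj}=|g|$ for all $j$, let $\tilde P_i=\operatorname{diag}(\lambda)$ and $$(\tilde X_i)_{jj}=\phi_j+\lambda_j^{-1}\Big(c_i-c_i\big(([\tilde v_r\tilde w_r]_{jj})_{r}\big)\Big),\qquad (\tilde X_i)_{jk}=-\sum_{h=0}^{m-1}[\tilde v_{i-h}\tilde w_{i-h}]_{jk}\frac{\lambda_j^{m-h-1}\lambda_k^h}{\lambda_j^m-\lambda_k^m}\quad(j\neq k),$$ $$\{f,h\}=\sum_{j}\Big[m\Big(\frac{\partial f}{\partial\lambda_j}\frac{\partial h}{\partial\phi_j}-\frac{\partial f}{\partial\phi_j}\frac{\partial h}{\partial\lambda_j}\Big)+\sum_{i,\alpha}\Big(\frac{\partial f}{\partial[\tilde w_i]_{\alpha j}}\frac{\partial h}{\partial[\tilde v_i]_{j\alpha}}-\frac{\partial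 f}{\partial[\tilde v_i]_{j\alpha}}\frac{\partial h}{\partial[\tilde w_i]_{\alpha j}}\Big)\Big].$$ As the coordinates are subject to the constraint, an identity for a bracket of functions of them means that it holds at each point of the constraint surface for all extensions of the functions, differentiable at that point, to the space of unconstrained $(\lambda,\phi,\tilde v,\tilde w)$. **Theorem.** In the spinless case and, for each $d$, in the spin case: 1. $s$ depends only on the orbit of $(X,P,v,w)$. 2. $U$ is open. If $g$ is regular, i.e. also $k|g|\ne g_h+\dots+g_{i-1}$ for all $k\in\mathbb Z$ and $1\le h<i\le m$, then $U$ is dense. 3. The quadruples $(\tilde X,\tilde P,\tilde v,\tilde w)$ above satisfy $[\tilde X,\tilde P]=\tilde v\tilde w-g\mathbf 1_V$, and $U$ is exactly the set of their orbits. 4. The functions $\theta_k=s(\lambda_k)$, $k=1,\dots,n$, of the coordinates are differentiable and conjugate to $\lambda_1,\dots,\lambda_n$: $\{\lambda_j,\theta_k\}=\delta_{jk}$ and $\{\theta_j,\theta_k\}=0$ for all $j,k$. In the spinless case moreover $\theta_k=\phi_k/m+f_k(\lambda)$ with differentiable functions $f_1,\dots,f_n$ of $\lambda$ that satisfy $\partial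 f_j/\partial\lambda_k=\partial f_k/\partial\lambda_j$ for all $j,k$. -/

import Mathlib

open scoped Topology

noncomputable section

namespace CyclicCM

/-- Linear data on the doubled cyclic quiver with `m` vertices, each carrying `ℂⁿ`, and with framing
spaces `ℂ^(d i)`: `X i : V_i → V_{i+1}`, `P i : V_{i+1} → V_i`, `v i : ℂ^(d i) → V_i`,
`w i : V_i → ℂ^(d i)`. -/
@[ext]
structure Quad (m n : ℕ) (d : ZMod m → ℕ) where
  X : ZMod m → Matrix (Fin n) (Fin n) ℂ
  P : ZMod m → Matrix (Fin n) (Fin n) ℂ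
  v : (i : ZMod m) → Matrix (Fin n) (Fin (d i)) ℂ
  w : (i : ZMod m) → Matrix (Fin (d i)) (Fin n) ℂ

/-- The framing of the spinless space: a one-dimensional framing at the vertex `0` only. -/
def spinlessFraming (m : ℕ) : ZMod m → ℕ := fun i => if i = 0 then 1 else 0

/-- The framing of the spin space: a `d`-dimensional framing at each vertex. -/
def spinFraming (m d : ℕ) : ZMod m → ℕ := fun _ => d

variable {m n : ℕ} {d : ZMod m → ℕ}

namespace Quad

/-- `X ∈ End(V)` for `V = ⨁ V_i`, with blocks `X i` at positions `(i+1, i)`. -/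
def bigX (q : Quad m n d) : Matrix (ZMod m × Fin n) (ZMod m × Fin n) ℂ :=
  Matrix.of fun a b => if a.1 = b.1 + 1 then q.X b.1 a.2 b.2 else 0

/-- `P ∈ End(V)`, with blocks `P i` at positions `(i, i+1)`. -/
def bigP (q : Quad m n d) : Matrix (ZMod m × Fin n) (ZMod m × Fin n) ℂ :=
  Matrix.of fun a b => if b.1 = a.1 + 1 then q.P a.1 a.2 b.2 else 0

/-- `v : ⨁ ℂ^(d i) → V`, block diagonal. -/
def bigV (q : Quad m n d) : Matrix (ZMod m × Fin n) (Σ i, Fin (d i)) ℂ :=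
  Matrix.of fun a b => if a.1 = b.1 then q.v b.1 a.2 b.2 else 0

/-- `w : V → ⨁ ℂ^(d i)`, block diagonal. -/
def bigW (q : Quad m n d) : Matrix (Σ i, Fin (d i)) (ZMod m × Fin n) ℂ :=
  Matrix.of fun a b => if b.1 = a.1 then q.w a.1 a.2 b.2 else 0

/-- The action of `∏ GL(V_i)`. -/
def act (M : ZMod m → GL (Fin n) ℂ) (q : Quad m n d) : Quad m n d where
  X i := (M (i + 1)).val * q.X i * (M i)⁻¹.val
  P i := (M i).val * q.P i * (M (i + 1))⁻¹.val
  v i := (M i).val * q.v i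
  w i := q.w i * (M i)⁻¹.val

theorem act_one (q : Quad m n d) : q.act 1 = q := by
  ext <;> simp [act]

theorem act_mul (M N : ZMod m → GL (Fin n) ℂ) (q : Quad m n d) :
    q.act (M * N) = (q.act N).act M := by
  ext <;> simp [act, mul_inv_rev, Matrix.mul_assoc]

instance : TopologicalSpace (Quad m n d) :=
  TopologicalSpace.induced (fun q => (q.X, q.P, q.v, q.w)) inferInstance

variable [NeZero m]

/-- `A(z) = det(z - P)`. -/
def polyA (q : Quad m n d) : Polynomial ℂ := q.bigP.charpoly

/-- `C(z) = tr(X adj(z - P) v w)`. -/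
def polyC (q : Quad m n d) : Polynomial ℂ :=
  Matrix.trace (q.bigX.map Polynomial.C * (Matrix.charmatrix q.bigP).adjugate *
    (q.bigV * q.bigW).map Polynomial.C)

/-- `s = C / (|g| A')`, a rational function of one variable. -/
def sklyanin (g : ZMod m → ℂ) (q : Quad m n d) : RatFunc ℂ :=
  algebraMap (Polynomial ℂ) (RatFunc ℂ) q.polyC /
    algebraMap (Polynomial ℂ) (RatFunc ℂ)
      (Polynomial.C (∑ i, g i) * Polynomial.derivative q.polyA)

end Quad

variable [NeZero m]

/-- The quadruples with `[X, P] = v w - g 1_V`. -/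
def levelSet (n : ℕ) (d : ZMod m → ℕ) (g : ZMod m → ℂ) : Set (Quad m n d) :=
  {q | q.bigX * q.bigP - q.bigP * q.bigX =
    q.bigV * q.bigW - Matrix.diagonal fun a : ZMod m × Fin n => g a.1}

/-- Two quadruples of the level set are equivalent if they lie in one orbit of `∏ GL(V_i)`. -/
def gaugeSetoid (n : ℕ) (d : ZMod m → ℕ) (g : ZMod m → ℂ) : Setoid (levelSet n d g) where
  r q q' := ∃ M : ZMod m → GL (Fin n) ℂ, q.1.act M = q'.1
  iseqv :=
    { refl := fun q => ⟨1, q.1.act_one⟩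
      symm := by
        rintro q q' ⟨M, hM⟩
        exact ⟨M⁻¹, by rw [← hM, ← Quad.act_mul, inv_mul_cancel, Quad.act_one]⟩
      trans := by
        rintro q q' q'' ⟨M, hM⟩ ⟨N, hN⟩
        exact ⟨N * M, by rw [Quad.act_mul, hM, hN]⟩ }

/-- The Calogero-Moser space: the orbit space of the level set, with the quotient topology. -/
abbrev CMSpace (n : ℕ) (d : ZMod m → ℕ) (g : ZMod m → ℂ) : Type :=
  Quotient (gaugeSetoid n d g)

/-- The class `[(X, P, v, w)]`. -/
def CMSpace.mk {g : ZMod m → ℂ} (q : levelSet n d g) : CMSpace n d g :=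
  Quotient.mk (gaugeSetoid n d g) q

/-- Nonzero `λ_1, …, λ_n` with pairwise distinct `m`-th powers. -/
def regularSpectrum (m n : ℕ) : Set (Fin n → ℂ) :=
  {l | (∀ j, l j ≠ 0) ∧ ∀ j k, j ≠ k → l j ^ m ≠ l k ^ m}

/-- The part of the space on which all `P_i` can be brought simultaneously to one diagonal form
`diag(λ_1, …, λ_n)` with a regular spectrum. -/
def diagLocus (n : ℕ) (d : ZMod m → ℕ) (g : ZMod m → ℂ) : Set (CMSpace n d g) :=
  {x | ∃ q : levelSet n d g, CMSpace.mk q = x ∧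
    ∃ l ∈ regularSpectrum m n, ∀ i, q.1.P i = Matrix.diagonal l}

/-- Regularity of the parameter `g = (g_0, …, g_{m-1})`. -/
def IsRegularParam (g : ZMod m → ℂ) : Prop :=
  ∑ i, g i ≠ 0 ∧ ∀ (k : ℤ) (h i : ℕ), 1 ≤ h → h < i → i ≤ m →
    (k : ℂ) * ∑ r, g r ≠ ∑ r ∈ Finset.Ico h i, g (r : ZMod m)

/-- `u ↦ (∑_{r=0}^{i} u_r - ∑_{s=0}^{m-1} ((m-s)/m) u_s)`; at `u = g` these are the constants `c_i`. -/
def cShift (u : ZMod m → ℂ) (i : ZMod m) : ℂ :=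
  ∑ r ∈ Finset.univ.filter (fun r : ZMod m => r.val ≤ i.val), u r -
    ∑ s : ZMod m, ((m : ℂ) - (s.val : ℂ)) / (m : ℂ) * u s

/-! ### The spinless case -/

/-- Coordinates `(λ, φ)`. -/
abbrev Coord (n : ℕ) : Type := (Fin n → ℂ) × (Fin n → ℂ)

/-- The quadruple with coordinates `(λ, φ)`: `P` is diagonal, `v_0 = (1, …, 1)ᵀ` and
`w_0 = |g| (1, …, 1)`; the framing spaces at the vertices other than `0` vanish. -/
def spinlessQuad (g : ZMod m → ℂ) (y : Coord n) : Quad m n (spinlessFraming m) where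
  P _ := Matrix.diagonal y.1
  X i := Matrix.of fun j k =>
    if j = k then y.2 j + cShift g i * (y.1 j)⁻¹
    else -(∑ r, g r) * y.1 j ^ (m - i.val - 1) * y.1 k ^ i.val * (y.1 j ^ m - y.1 k ^ m)⁻¹
  v _ := Matrix.of fun _ _ => 1
  w _ := Matrix.of fun _ _ => ∑ r, g r

/-- The coordinate domain of the spinless case. -/
def coordDomain (m n : ℕ) : Set (Coord n) := {y | y.1 ∈ regularSpectrum m n}

/-- `θ_k = s(λ_k)`. -/
def theta (g : ZMod m → ℂ) (k : Fin n) (y : Coord n) : ℂ :=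
  ((spinlessQuad g y).sklyanin g).eval (RingHom.id ℂ) (y.1 k)

/-- `∂f/∂λ_j`. -/
def dLam (f : Coord n → ℂ) (j : Fin n) (y : Coord n) : ℂ := fderiv ℂ f y (Pi.single j 1, 0)

/-- `∂f/∂φ_j`. -/
def dPhi (f : Coord n → ℂ) (j : Fin n) (y : Coord n) : ℂ := fderiv ℂ f y (0, Pi.single j 1)

/-- The Poisson bracket
`{f, h} = m ∑_j (∂f/∂λ_j ∂h/∂φ_j - ∂f/∂φ_j ∂h/∂λ_j)`. -/
def poisson (m : ℕ) (f h : Coord n → ℂ) (y : Coord n) : ℂ :=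
  (m : ℂ) * ∑ j, (dLam f j y * dPhi h j y - dPhi f j y * dLam h j y)

/-! ### The spin case -/

/-- Coordinates `(λ, φ, v, w)`, with `v i j α = [v_i]_{j,α}` and `w i α j = [w_i]_{α,j}`. -/
abbrev SpinCoord (m n d : ℕ) : Type :=
  (Fin n → ℂ) × (Fin n → ℂ) × (ZMod m → Fin n → Fin d → ℂ) × (ZMod m → Fin d → Fin n → ℂ)

/-- `[v_i w_i]_{j,k}`. -/
def spinVW {d : ℕ} (y : SpinCoord m n d) (i : ZMod m) (j k : Fin n) : ℂ :=
  ∑ α, y.2.2.1 i j α * y.2.2.2 i α k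

/-- The quadruple with coordinates `(λ, φ, v, w)`. -/
def spinQuad {d : ℕ} (g : ZMod m → ℂ) (y : SpinCoord m n d) : Quad m n (spinFraming m d) where
  P _ := Matrix.diagonal y.1
  X i := Matrix.of fun j k =>
    if j = k then
      y.2.1 j + (y.1 j)⁻¹ * (cShift g i - cShift (fun r => spinVW y r j j) i)
    else
      -∑ h ∈ Finset.range m, spinVW y (i - (h : ZMod m)) j k *
        (y.1 j ^ (m - h - 1) * y.1 k ^ h / (y.1 j ^ m - y.1 k ^ m))
  v i := Matrix.of (y.2.2.1 i)
  w i := Matrix.of (y.2.2.2 i)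

/-- The coordinate domain of the spin case: `λ` has a regular spectrum, and
`∑_i [v_i w_i]_{j,j} = |g|` for all `j`. -/
def spinDomain (n d : ℕ) (g : ZMod m → ℂ) : Set (SpinCoord m n d) :=
  {y | y.1 ∈ regularSpectrum m n ∧ ∀ j, ∑ i, spinVW y i j j = ∑ i, g i}

/-- `θ_k = s(λ_k)`. -/
def spinTheta {d : ℕ} (g : ZMod m → ℂ) (k : Fin n) (y : SpinCoord m n d) : ℂ :=
  ((spinQuad g y).sklyanin g).eval (RingHom.id ℂ) (y.1 k)

section SpinBracket

variable {d : ℕ}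

/-- `∂f/∂λ_j`. -/
def sdLam (f : SpinCoord m n d → ℂ) (j : Fin n) (y : SpinCoord m n d) : ℂ :=
  fderiv ℂ f y (Pi.single j 1, 0, 0, 0)

/-- `∂f/∂φ_j`. -/
def sdPhi (f : SpinCoord m n d → ℂ) (j : Fin n) (y : SpinCoord m n d) : ℂ :=
  fderiv ℂ f y (0, Pi.single j 1, 0, 0)

/-- `∂f/∂[v_i]_{j,α}`. -/
def sdV (f : SpinCoord m n d → ℂ) (i : ZMod m) (j : Fin n) (α : Fin d)
    (y : SpinCoord m n d) : ℂ :=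
  fderiv ℂ f y (0, 0, Pi.single i (Pi.single j (Pi.single α 1)), 0)

/-- `∂f/∂[w_i]_{α,j}`. -/
def sdW (f : SpinCoord m n d → ℂ) (i : ZMod m) (α : Fin d) (j : Fin n)
    (y : SpinCoord m n d) : ℂ :=
  fderiv ℂ f y (0, 0, 0, Pi.single i (Pi.single α (Pi.single j 1)))

/-- The Poisson bracket in the coordinates `(λ, φ, v, w)`. -/
def spinPoisson (f h : SpinCoord m n d → ℂ) (y : SpinCoord m n d) : ℂ :=
  ∑ j, ((m : ℂ) * (sdLam f j y * sdPhi h j y - sdPhi f j y * sdLam h j y) +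
    ∑ i, ∑ α, (sdW f i α j y * sdV h i j α y - sdV f i j α y * sdW h i α j y))

/-- `{f, h}(y) = c` for functions `f`, `h` on the constraint surface `spinDomain n d g`, on which
the coordinates are not independent: the coordinate bracket has the value `c` at `y`, whichever
extensions of `f` and `h` to the ambient coordinate space, differentiable at `y`, are used. -/
def SpinPoissonEq (g : ZMod m → ℂ) (f h : SpinCoord m n d → ℂ) (y : SpinCoord m n d)
    (c : ℂ) : Prop :=
  ∀ F H : SpinCoord m n d → ℂ, DifferentiableAt ℂ F y → DifferentiableAt ℂ H y →
    F =ᶠ[𝓝[spinDomain n d g] y] f → H =ᶠ[𝓝[spinDomain n d g] y] h →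
    spinPoisson F H y = c

end SpinBracket

end CyclicCM

end

open CyclicCM

set_option linter.unusedSectionVars false

/-! An orbit with invertible `P` is governed by its monodromy `P_0 ⋯ P_{m-1}`. If the monodromy is
invertible with simple spectrum, then `m`-th roots of its eigenvalues provide a gauge in which all
`P_i` are one and the same diagonal matrix (`exists_gauge_diagonal`). So `U` is cut out by an open
condition (`mk_mem_diagLocus_iff`). In this gauge the moment map equation decouples into one cyclic
recursion per matrix entry. The off-diagonal ones have a unique solution because `λ_j^m ≠ λ_k^m`.
The diagonal ones are solvable exactly if `∑_i [v_i w_i]_{jj} = |g|`, and leave one free constant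
`φ_j` (`mem_levelSet_iff_of_diagonal`). In the spinless case the remaining torus normalizes `v_0`.

The function `s` is invariant because the data in it are conjugated simultaneously. For diagonal
`P_i` a Fourier transform over `ℤ/m` diagonalizes `P`, and at the simple eigenvalue `λ_k` one gets
`θ_k = (m|g|)⁻¹ ∑_i (v_i w_i X_{i-1})_{kk}` (`sklyanin_eval`). In the spinless case this is `φ_k/m`
plus a function of `λ` with symmetric Jacobian. In the spin case it is, on the constraint surface,
`φ_k/m + (m|g|λ_k)⁻¹ H_k` with `H_k` a trigonometric Gaudin Hamiltonian in the `[v_i w_i]_{ab}`,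
which generate commuting copies of `gl_n`. The spin parts commute by the classical Yang-Baxter
equation (three particles, `rCoeff_yangBaxter`) and by the equality of the constraints of two
particles (`spinBra_two_body`); the contributions of `∂/∂λ` cancel by `mul_pairTermDeriv_symm`. Two
extensions of a function off the constraint surface have differentials that differ by multiples of
the differentials of the constraints. The constraints generate a torus action that fixes `λ_j` and
`θ_k`, so the brackets do not see the choice (`spinBra_add_moments`).

Density takes two steps inside an arbitrary open set. The first makes `P` invertible
(`exists_det_bigP_ne_zero`). For regular `g` the moment map is a submersion along the level set,
since a nonzero infinitesimal stabilizer would produce a finite chain of eigenvalues whose two ends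
force a sum of consecutive `g_i` to vanish (`eq_zero_of_commute`). Where the ranks of the powers of
`P` are maximal, every tangent variation of `P` is, on the generalized kernel of `P`, a commutator
with `P`, hence trace-orthogonal to the centralizer of `P` there. By Lagrange multipliers each
homogeneous element of degree `-1` of this centralizer is a commutator `[M, X]`, where `M` commutes
with `P`, `M v = 0` and `w M = 0`. A dimension count then gives `e v = 0` for the projection `e`
onto the generalized kernel, and the trace of `e` times the moment map equation yields `e = 0`,
because `|g| ≠ 0`.

In the second step all `P_i` but one are gauged to `1`. What remains is the one-vertex equation `[X,
P] = v w - |g|` with the monodromy in the role of `X`, and it has to be shown that `X` can be given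
a simple spectrum (`exists_separable_charpoly`). By induction on the size, an `X` with two
eigenvalues is split into blocks that are perturbed separately, the off-diagonal blocks of `P` being
recovered from Sylvester's equation. And `X` cannot keep a single eigenvalue on an open subset of
the level set: adding polynomials in `P` to `X` and applying rank one shears would force `X` to be
scalar, and a further shear destroys this. -/

namespace CyclicCM

/-! ### Block matrices graded by `ℤ/m` and the moment map equation vertex by vertex -/

/-- The endomorphism of `⨁ V_i` whose only blocks are `A i`, at the positions `(i, i + l)`. -/
def blk {m n : ℕ} (l : ZMod m) (A : ZMod m → Matrix (Fin n) (Fin n) ℂ) :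
    Matrix (ZMod m × Fin n) (ZMod m × Fin n) ℂ :=
  Matrix.of fun a b => if b.1 = a.1 + l then A a.1 a.2 b.2 else 0

section Blocks

variable {m n : ℕ} {d : ZMod m → ℕ}

theorem blk_apply (l : ZMod m) (A : ZMod m → Matrix (Fin n) (Fin n) ℂ) (a b : ZMod m × Fin n) :
    blk l A a b = if b.1 = a.1 + l then A a.1 a.2 b.2 else 0 := rfl

theorem blk_injective (l : ZMod m) :
    Function.Injective (blk l : (ZMod m → Matrix (Fin n) (Fin n) ℂ) → _) := by
  intro A B h
  ext i j k
  have := congrFun (congrFun h (i, j)) (i + l, k)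
  simpa [blk_apply] using this

theorem blk_add (l : ZMod m) (A B : ZMod m → Matrix (Fin n) (Fin n) ℂ) :
    blk l (A + B) = blk l A + blk l B := by
  ext a b; simp only [blk_apply, Matrix.add_apply, Pi.add_apply]; split_ifs <;> simp

theorem blk_sub (l : ZMod m) (A B : ZMod m → Matrix (Fin n) (Fin n) ℂ) :
    blk l (A - B) = blk l A - blk l B := by
  ext a b; simp only [blk_apply, Matrix.sub_apply, Pi.sub_apply]; split_ifs <;> simp

theorem blk_smul (l : ZMod m) (c : ℂ) (A : ZMod m → Matrix (Fin n) (Fin n) ℂ) :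
    blk l (c • A) = c • blk l A := by
  ext a b; simp only [blk_apply, Matrix.smul_apply, Pi.smul_apply]; split_ifs <;> simp

theorem blk_zero (l : ZMod m) : blk l (0 : ZMod m → Matrix (Fin n) (Fin n) ℂ) = 0 := by
  ext a b; simp [blk_apply]

theorem blk_one : blk (0 : ZMod m) (1 : ZMod m → Matrix (Fin n) (Fin n) ℂ) = 1 := by
  ext ⟨a, a'⟩ ⟨b, b'⟩
  simp only [blk_apply, Matrix.one_apply, Pi.one_apply, add_zero, Prod.mk.injEq]
  split_ifs <;> simp_all

theorem blk_mul [NeZero m] (l k : ZMod m) (A B : ZMod m → Matrix (Fin n) (Fin n) ℂ) :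
    blk l A * blk k B = blk (l + k) fun i => A i * B (i + l) := by
  ext ⟨a, a'⟩ ⟨b, b'⟩
  simp only [Matrix.mul_apply, blk_apply, Fintype.sum_prod_type, ite_mul, zero_mul, mul_ite,
    mul_zero]
  rw [Finset.sum_eq_single (a + l)]
  · simp only [if_true, ← add_assoc]
    split_ifs <;> simp
  · intro c _ hc
    simp [hc]
  · simp

theorem trace_blk_zero [NeZero m] (A : ZMod m → Matrix (Fin n) (Fin n) ℂ) :
    (blk 0 A).trace = ∑ i, (A i).trace := by
  simp [Matrix.trace, blk_apply, Fintype.sum_prod_type]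

theorem Quad.bigP_eq (q : Quad m n d) : q.bigP = blk 1 q.P := rfl

/-- `X i` is indexed by its source but sits in the row `i + 1`; indexing by rows causes the shifts
`i - 1` in all formulas below. -/
theorem Quad.bigX_eq (q : Quad m n d) : q.bigX = blk (-1) fun i => q.X (i - 1) := by
  ext ⟨a, a'⟩ ⟨b, b'⟩
  simp only [Quad.bigX, blk_apply, Matrix.of_apply]
  by_cases h : a = b + 1
  · subst h; simp
  · rw [if_neg h, if_neg]
    rintro rfl; simp at h

theorem Quad.bigV_mul_bigW [NeZero m] (q : Quad m n d) :
    q.bigV * q.bigW = blk 0 fun i => q.v i * q.w i := by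
  ext ⟨a, a'⟩ ⟨b, b'⟩
  simp only [Quad.bigV, Quad.bigW, blk_apply, Matrix.mul_apply, Matrix.of_apply,
    Fintype.sum_sigma, ite_mul, zero_mul, mul_ite, mul_zero, add_zero]
  rw [Finset.sum_eq_single a]
  · simp only [if_true]; split_ifs <;> simp
  · intro c _ hc; simp [hc.symm]
  · simp

theorem diagonal_eq_blk (g : ZMod m → ℂ) :
    (Matrix.diagonal fun a : ZMod m × Fin n => g a.1) =
      blk 0 fun i => g i • (1 : Matrix (Fin n) (Fin n) ℂ) := by
  ext ⟨a, a'⟩ ⟨b, b'⟩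
  simp only [blk_apply, Matrix.diagonal_apply, Matrix.smul_apply, Matrix.one_apply, add_zero,
    Prod.mk.injEq]
  split_ifs <;> simp_all

theorem mem_levelSet_iff [NeZero m] {g : ZMod m → ℂ} {q : Quad m n d} :
    q ∈ levelSet n d g ↔
      ∀ i, q.X (i - 1) * q.P (i - 1) - q.P i * q.X i = q.v i * q.w i - g i • 1 := by
  rw [levelSet, Set.mem_ofPred_eq, Quad.bigV_mul_bigW, diagonal_eq_blk, Quad.bigX_eq, Quad.bigP_eq,
    blk_mul, blk_mul, neg_add_cancel, add_neg_cancel, ← blk_sub, ← blk_sub,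
    (blk_injective 0).eq_iff, funext_iff]
  simp [sub_eq_add_neg]

theorem trace_mul_comm_blk [NeZero m] (M : ZMod m → GL (Fin n) ℂ) :
    blk 0 (fun i => (M i).val) * blk 0 (fun i => (M i)⁻¹.val) = 1 := by
  rw [blk_mul, ← blk_one, add_zero]
  congr 1; ext1 i
  simp

/-- The block diagonal element of `GL(⨁ V_i)` with blocks `M i`. -/
def bigM [NeZero m] (M : ZMod m → GL (Fin n) ℂ) : GL (ZMod m × Fin n) ℂ where
  val := blk 0 fun i => (M i).val
  inv := blk 0 fun i => (M i)⁻¹.val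
  val_inv := trace_mul_comm_blk M
  inv_val := by simpa using trace_mul_comm_blk M⁻¹

theorem Quad.bigX_act [NeZero m] (M : ZMod m → GL (Fin n) ℂ) (q : Quad m n d) :
    (q.act M).bigX = (bigM M).val * q.bigX * (bigM M)⁻¹.val := by
  change _ = blk (0 : ZMod m) _ * _ * blk (0 : ZMod m) _
  rw [Quad.bigX_eq, Quad.bigX_eq, blk_mul, blk_mul]
  simp [Quad.act, sub_eq_add_neg]

theorem Quad.bigP_act [NeZero m] (M : ZMod m → GL (Fin n) ℂ) (q : Quad m n d) :
    (q.act M).bigP = (bigM M).val * q.bigP * (bigM M)⁻¹.val := by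
  change _ = blk (0 : ZMod m) _ * _ * blk (0 : ZMod m) _
  rw [Quad.bigP_eq, Quad.bigP_eq, blk_mul, blk_mul]
  simp [Quad.act]

theorem Quad.bigVW_act [NeZero m] (M : ZMod m → GL (Fin n) ℂ) (q : Quad m n d) :
    (q.act M).bigV * (q.act M).bigW = (bigM M).val * (q.bigV * q.bigW) * (bigM M)⁻¹.val := by
  change _ = blk (0 : ZMod m) _ * _ * blk (0 : ZMod m) _
  rw [Quad.bigV_mul_bigW, Quad.bigV_mul_bigW]
  have h (K : ZMod m → Matrix (Fin n) (Fin n) ℂ) :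
      blk 0 (fun i => (M i).val) * blk 0 K * blk 0 (fun i => (M i)⁻¹.val) =
        blk 0 fun i => (M i).val * K i * (M i)⁻¹.val := by
    rw [blk_mul, blk_mul]; simp
  rw [h]
  simp [Quad.act, Matrix.mul_assoc]

end Blocks

/-! ### Invariance of `s` under conjugation -/

section Invariance

variable {ι : Type*} [Fintype ι] [DecidableEq ι]

theorem charmatrix_conj (G : GL ι ℂ) (A : Matrix ι ι ℂ) :
    Matrix.charmatrix (G.val * A * G⁻¹.val) =
      G.val.map Polynomial.C * Matrix.charmatrix A * G⁻¹.val.map Polynomial.C := by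
  have h : G.val.map Polynomial.C * G⁻¹.val.map (Polynomial.C : ℂ →+* _) = 1 := by
    rw [← Matrix.map_mul]; simp
  simp only [Matrix.charmatrix, mul_sub, sub_mul, RingHom.mapMatrix_apply, Matrix.map_mul]
  congr 1
  rw [← (Matrix.scalar_commute Polynomial.X (fun _ => Commute.all _ _) _).eq, Matrix.mul_assoc, h,
    Matrix.mul_one]

/-- Stated over a commutative ring so that it applies to characteristic matrices, whose entries are
polynomials. Here `adj G = det G • G'` and `adj G' = det G' • G`, and the two determinants multiply
to `1`. -/
theorem adjugate_conj {R : Type*} [CommRing R] (G G' A : Matrix ι ι R) (h : G * G' = 1) :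
    (G * A * G').adjugate = G * A.adjugate * G' := by
  have h1 : G.det * G'.det = 1 := by rw [← Matrix.det_mul, h, Matrix.det_one]
  have e1 : G.adjugate = G.det • G' := by
    have := Matrix.adjugate_mul G
    calc G.adjugate = G.adjugate * (G * G') := by rw [h, Matrix.mul_one]
      _ = _ := by rw [← Matrix.mul_assoc, this]; simp
  have e2 : G'.adjugate = G'.det • G := by
    have := Matrix.mul_adjugate G'
    calc G'.adjugate = (G * G') * G'.adjugate := by rw [h, Matrix.one_mul]
      _ = _ := by rw [Matrix.mul_assoc, this]; simp
  rw [Matrix.adjugate_mul_distrib, Matrix.adjugate_mul_distrib, e1, e2]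
  simp only [Matrix.smul_mul, Matrix.mul_smul, smul_smul]
  rw [h1, one_smul, Matrix.mul_assoc]

end Invariance

section Sklyanin

variable {m n : ℕ} {d : ZMod m → ℕ} [NeZero m]

theorem Quad.polyA_act (M : ZMod m → GL (Fin n) ℂ) (q : Quad m n d) :
    (q.act M).polyA = q.polyA := by
  rw [Quad.polyA, Quad.bigP_act, Quad.polyA, Matrix.charpoly_mul_comm, ← mul_assoc]
  simp

theorem Quad.polyC_act (M : ZMod m → GL (Fin n) ℂ) (q : Quad m n d) :
    (q.act M).polyC = q.polyC := by
  set G := bigM (n := n) M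
  have h : G.val.map Polynomial.C * G⁻¹.val.map (Polynomial.C : ℂ →+* _) = 1 := by
    rw [← Matrix.map_mul]; simp
  have h' : G⁻¹.val.map Polynomial.C * G.val.map (Polynomial.C : ℂ →+* _) = 1 := by
    rw [← Matrix.map_mul]; simp
  rw [Quad.polyC, Quad.bigP_act, Quad.bigX_act, Quad.bigVW_act, charmatrix_conj,
    adjugate_conj _ _ _ h, Quad.polyC]
  set K := q.bigV * q.bigW
  simp only [Matrix.map_mul (f := Polynomial.C)]
  generalize G.val.map Polynomial.C = g at *
  generalize G⁻¹.val.map Polynomial.C = g' at *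
  rw [show ∀ x y z, g * x * g' * (g * y * g') * (g * z * g') = g * (x * y * z) * g' by
    intro x y z
    calc _ = g * x * (g' * g) * y * (g' * g) * z * g' := by simp only [Matrix.mul_assoc]
      _ = _ := by rw [h']; simp only [Matrix.mul_one, Matrix.mul_assoc]]
  rw [Matrix.trace_mul_comm, ← Matrix.mul_assoc, h', Matrix.one_mul]

theorem exists_sklyanin_lift (g : ZMod m → ℂ) :
    ∃ s : CMSpace n d g → RatFunc ℂ, ∀ q : levelSet n d g, s (CMSpace.mk q) = q.1.sklyanin g := by
  refine ⟨Quotient.lift (fun q => q.1.sklyanin g) ?_, fun q => rfl⟩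
  rintro q q' ⟨M, hM⟩
  simp only [Quad.sklyanin, ← hM, Quad.polyA_act, Quad.polyC_act]

end Sklyanin

/-! ### Coprime and separable characteristic polynomials as open conditions; diagonalization -/

section LinearAlgebra

variable {ι κ : Type*} [Fintype ι] [DecidableEq ι] [Fintype κ] [DecidableEq κ]

theorem exists_eigenvector_of_charpoly_eval_eq_zero {A : Matrix ι ι ℂ} {μ : ℂ}
    (h : A.charpoly.eval μ = 0) : ∃ u : ι → ℂ, u ≠ 0 ∧ A.mulVec u = μ • u := by
  rw [Matrix.eval_charpoly] at h
  obtain ⟨u, hu, h⟩ := Matrix.exists_mulVec_eq_zero_iff.2 h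
  refine ⟨u, hu, ?_⟩
  rw [Matrix.sub_mulVec, sub_eq_zero] at h
  rw [← h]
  ext i
  simp [Matrix.scalar_apply, Matrix.mulVec_diagonal]

theorem aeval_mulVec_of_eigenvector {A : Matrix ι ι ℂ} {μ : ℂ} {u : ι → ℂ}
    (h : A.mulVec u = μ • u) (p : Polynomial ℂ) :
    (Polynomial.aeval A p).mulVec u = p.eval μ • u := by
  have hk : ∀ k : ℕ, (A ^ k).mulVec u = μ ^ k • u := by
    intro k
    induction k with
    | zero => simp
    | succ k ih => rw [pow_succ', ← Matrix.mulVec_mulVec, ih, Matrix.mulVec_smul, h, smul_smul,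
        pow_succ]
  induction p using Polynomial.induction_on' with
  | add p q hp hq => simp [Matrix.add_mulVec, hp, hq, add_smul]
  | monomial k a =>
    rw [Polynomial.aeval_monomial, Polynomial.eval_monomial, ← Matrix.mulVec_mulVec, hk,
      Matrix.mulVec_smul, Algebra.algebraMap_eq_smul_one, Matrix.smul_mulVec, Matrix.one_mulVec,
      smul_smul, mul_comm]

/-- On an eigenvector of `B` the matrix `p(B)` acts by the value of `p`, so a common root makes
`p(B)` singular. The purpose is to express coprimality as the nonvanishing of a function that is
continuous in the matrices. -/
theorem isCoprime_charpoly_iff (p : Polynomial ℂ) (B : Matrix ι ι ℂ) :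
    IsCoprime B.charpoly p ↔ (Polynomial.aeval B p).det ≠ 0 := by
  constructor
  · rintro ⟨a, b, hab⟩
    have := congrArg (Polynomial.aeval B) hab
    rw [map_add, map_mul, map_mul, Matrix.aeval_self_charpoly, mul_zero, zero_add, map_one] at this
    have h2 := congrArg Matrix.det this
    rw [Matrix.det_mul, Matrix.det_one] at h2
    intro h0
    rw [h0, mul_zero] at h2
    exact zero_ne_one h2
  · intro h
    rw [Polynomial.isCoprime_iff_aeval_ne_zero_of_isAlgClosed ℂ ℂ]
    intro a
    by_contra! hc
    rw [Polynomial.coe_aeval_eq_eval] at hc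
    obtain ⟨u, hu, h1⟩ := exists_eigenvector_of_charpoly_eval_eq_zero hc.1
    have h2 := aeval_mulVec_of_eigenvector h1 p
    rw [hc.2, zero_smul] at h2
    exact h (Matrix.exists_mulVec_eq_zero_iff.1 ⟨u, hu, h2⟩)

theorem continuous_charpoly_coeff (i : ℕ) :
    Continuous fun A : Matrix ι ι ℂ => A.charpoly.coeff i := by
  have h : (fun A : Matrix ι ι ℂ => A.charpoly.coeff i) = fun A =>
      MvPolynomial.eval (fun p : ι × ι => A p.1 p.2) ((Matrix.charpoly.univ ℂ ι).coeff i) := by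
    ext A
    exact (Matrix.charpoly.univ_coeff_eval₂Hom ι (RingHom.id ℂ) (fun p : ι × ι => A p.1 p.2) i).symm
  rw [h]
  exact (MvPolynomial.continuous_eval _).comp (by fun_prop)

theorem isOpen_isCoprime_charpoly :
    IsOpen {A : Matrix ι ι ℂ × Matrix κ κ ℂ | IsCoprime A.1.charpoly A.2.charpoly} := by
  have h : {A : Matrix ι ι ℂ × Matrix κ κ ℂ | IsCoprime A.1.charpoly A.2.charpoly} =
      {A | (∑ i ∈ Finset.range (Fintype.card κ + 1), A.2.charpoly.coeff i • A.1 ^ i).det ≠ 0} := by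
    ext A
    rw [Set.mem_ofPred_eq, isCoprime_charpoly_iff, Polynomial.aeval_eq_sum_range,
      Matrix.charpoly_natDegree_eq_dim]
    rfl
  rw [h]
  refine isOpen_ne.preimage (Continuous.matrix_det ?_)
  refine continuous_finsetSum _ fun i _ => ?_
  exact ((continuous_charpoly_coeff i).comp continuous_snd).smul (continuous_fst.pow i)

theorem isOpen_charpoly_separable : IsOpen {A : Matrix ι ι ℂ | A.charpoly.Separable} := by
  have h : {A : Matrix ι ι ℂ | A.charpoly.Separable} =
      {A | (∑ i ∈ Finset.range (Fintype.card ι + 1),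
        (A.charpoly.coeff (i + 1) * (i + 1)) • A ^ i).det ≠ 0} := by
    ext A
    rw [Set.mem_ofPred_eq, Polynomial.separable_def, isCoprime_charpoly_iff,
      Polynomial.aeval_eq_sum_range' (n := Fintype.card ι + 1)]
    · simp only [Polynomial.coeff_derivative]; rfl
    · refine lt_of_le_of_lt (Polynomial.natDegree_derivative_le _) ?_
      rw [Matrix.charpoly_natDegree_eq_dim]; omega
  rw [h]
  refine isOpen_ne.preimage (Continuous.matrix_det ?_)
  refine continuous_finsetSum _ fun i _ => ?_
  exact ((continuous_charpoly_coeff (i + 1)).mul continuous_const).smul (continuous_id.pow i)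

theorem exists_diagonalization {n : ℕ} {A : Matrix (Fin n) (Fin n) ℂ} (h : A.charpoly.Separable) :
    ∃ (G : GL (Fin n) ℂ) (μ : Fin n → ℂ), Function.Injective μ ∧
      A * G.val = G.val * Matrix.diagonal μ := by
  classical
  have hcard : A.charpoly.roots.toFinset.card = n := by
    rw [Multiset.toFinset_card_of_nodup (Polynomial.nodup_roots h),
      IsAlgClosed.card_roots_eq_natDegree, Matrix.charpoly_natDegree_eq_dim, Fintype.card_fin]
  let e := (Finset.equivFinOfCardEq hcard).symm
  let μ : Fin n → ℂ := fun j => (e j).1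
  have hμ : Function.Injective μ := Subtype.val_injective.comp e.injective
  have hroot : ∀ j, A.charpoly.eval (μ j) = 0 := fun j => by
    have := (e j).2
    rw [Multiset.mem_toFinset, Polynomial.mem_roots (Matrix.charpoly_monic A).ne_zero] at this
    exact this
  choose u hu0 hu using fun j => exists_eigenvector_of_charpoly_eval_eq_zero (hroot j)
  have hli : LinearIndependent ℂ u :=
    Module.End.eigenvectors_linearIndependent' (Matrix.toLin' A) μ hμ u fun j =>
      ⟨Module.End.mem_eigenspace_iff.2 (by rw [Matrix.toLin'_apply]; exact hu j), hu0 j⟩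
  let U : Matrix (Fin n) (Fin n) ℂ := (Matrix.of u).transpose
  have hU : IsUnit U := Matrix.linearIndependent_cols_iff_isUnit.1 hli
  refine ⟨hU.unit, μ, hμ, ?_⟩
  change A * U = U * Matrix.diagonal μ
  ext i j
  rw [Matrix.mul_diagonal]
  have := congrFun (hu j) i
  rw [Matrix.mulVec, dotProduct] at this
  rw [Matrix.mul_apply]
  exact this.trans (mul_comm _ _)

end LinearAlgebra

/-! ### The monodromy and the openness of the diagonal locus -/

section Monodromy

variable {m n : ℕ} {d : ZMod m → ℕ}

/-- `P_0 P_1 ⋯ P_{k-1}`. -/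
def pathP (P : ZMod m → Matrix (Fin n) (Fin n) ℂ) : ℕ → Matrix (Fin n) (Fin n) ℂ
  | 0 => 1
  | k + 1 => pathP P k * P k

/-- The monodromy `P_0 P_1 ⋯ P_{m-1}` around the cycle. -/
def monodromy (P : ZMod m → Matrix (Fin n) (Fin n) ℂ) : Matrix (Fin n) (Fin n) ℂ := pathP P m

theorem pathP_act (M : ZMod m → GL (Fin n) ℂ) (q : Quad m n d) (k : ℕ) :
    pathP (q.act M).P k = (M 0).val * pathP q.P k * (M (k : ZMod m))⁻¹.val := by
  induction k with
  | zero => simp [pathP]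
  | succ k ih =>
    rw [pathP, ih, pathP]
    simp [Quad.act, Matrix.mul_assoc]

theorem monodromy_act (M : ZMod m → GL (Fin n) ℂ) (q : Quad m n d) :
    monodromy (q.act M).P = (M 0).val * monodromy q.P * (M 0)⁻¹.val := by
  simp [monodromy, pathP_act]

theorem det_pathP (P : ZMod m → Matrix (Fin n) (Fin n) ℂ) (k : ℕ) :
    (pathP P k).det = ∏ j ∈ Finset.range k, (P (j : ZMod m)).det := by
  induction k with
  | zero => simp [pathP]
  | succ k ih => rw [pathP, Matrix.det_mul, ih, Finset.prod_range_succ]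

theorem det_pathP_ne_zero {P : ZMod m → Matrix (Fin n) (Fin n) ℂ} (h : (monodromy P).det ≠ 0)
    {k : ℕ} (hk : k ≤ m) : (pathP P k).det ≠ 0 := by
  rw [monodromy, det_pathP, Finset.prod_ne_zero_iff] at h
  rw [det_pathP, Finset.prod_ne_zero_iff]
  intro j hj
  exact h j (Finset.range_mono hk hj)

theorem pathP_diagonal {P : ZMod m → Matrix (Fin n) (Fin n) ℂ} {l : Fin n → ℂ}
    (h : ∀ i, P i = Matrix.diagonal l) (k : ℕ) : pathP P k = Matrix.diagonal (l ^ k) := by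
  induction k with
  | zero => simp [pathP]
  | succ k ih => rw [pathP, ih, h, Matrix.diagonal_mul_diagonal, pow_succ]; rfl

theorem natCast_val_add_one [NeZero m] (i : ZMod m) : ((i.val + 1 : ℕ) : ZMod m) = i + 1 := by
  simp

theorem val_add_one_cases [NeZero m] (i : ZMod m) :
    (i + 1).val = i.val + 1 ∨ (i + 1).val = 0 ∧ i.val + 1 = m := by
  rcases Nat.lt_or_ge (i.val + 1) m with h | h
  · left
    rw [← natCast_val_add_one, ZMod.val_cast_of_lt h]
  · right
    have : i.val + 1 = m := le_antisymm (ZMod.val_lt i) h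
    refine ⟨?_, this⟩
    rw [← natCast_val_add_one, this]; simp

/-- The condition on the monodromy that characterizes the diagonal locus. -/
def regularMonodromy (n : ℕ) : Set (Matrix (Fin n) (Fin n) ℂ) :=
  {A | A.det ≠ 0 ∧ A.charpoly.Separable}

theorem isOpen_regularMonodromy : IsOpen (regularMonodromy n) :=
  (isOpen_ne.preimage (continuous_id.matrix_det)).inter isOpen_charpoly_separable

/-- If the columns of `G` are eigenvectors of the monodromy with eigenvalues `l_j^m`, then `N_k =
diag(l)^{-k} G⁻¹ P_0 ⋯ P_{k-1}` satisfies `diag(l) N_{k+1} = N_k P_k`, which is the required gauge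
transformation as soon as `N` is periodic. -/
theorem exists_gauge_diagonal [NeZero m] {q : Quad m n d}
    (h : monodromy q.P ∈ regularMonodromy n) :
    ∃ M : ZMod m → GL (Fin n) ℂ, ∃ l ∈ regularSpectrum m n,
      ∀ i, (q.act M).P i = Matrix.diagonal l := by
  obtain ⟨G, μ, hμ, hG⟩ := exists_diagonalization h.2
  choose l hl using fun j => IsAlgClosed.exists_pow_nat_eq (μ j) (NeZero.pos m)
  have hG' : G⁻¹.val * monodromy q.P = Matrix.diagonal μ * G⁻¹.val := by
    calc G⁻¹.val * monodromy q.P = G⁻¹.val * (monodromy q.P * G.val) * G⁻¹.val := by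
          simp [Matrix.mul_assoc]
      _ = _ := by rw [hG, ← Matrix.mul_assoc]; simp
  have hμ0 : ∀ j, μ j ≠ 0 := by
    have h1 := congrArg Matrix.det hG
    rw [Matrix.det_mul, Matrix.det_mul, mul_comm, Matrix.det_diagonal] at h1
    have h2 : (G.val.det : ℂ) ≠ 0 := Matrix.GeneralLinearGroup.det_ne_zero G
    have h3 := mul_left_cancel₀ h2 h1
    have h4 := h.1
    rw [h3, Finset.prod_ne_zero_iff] at h4
    exact fun j => h4 j (Finset.mem_univ j)
  have hl0 : ∀ j, l j ≠ 0 := fun j h0 => hμ0 j (by rw [← hl, h0, zero_pow (NeZero.ne m)])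
  let N : ℕ → Matrix (Fin n) (Fin n) ℂ := fun k =>
    Matrix.diagonal (fun j => (l j)⁻¹ ^ k) * G⁻¹.val * pathP q.P k
  have hN : ∀ k, Matrix.diagonal l * N (k + 1) = N k * q.P k := by
    intro k
    simp only [N, pathP, ← Matrix.mul_assoc, Matrix.diagonal_mul_diagonal]
    congr 4
    ext j
    rw [pow_succ', ← mul_assoc, mul_inv_cancel₀ (hl0 j), one_mul]
  -- Here `l_j^m = μ_j` enters: it closes the gauge transformation around the cycle.
  have hNm : N m = N 0 := by
    simp only [N]
    rw [Matrix.mul_assoc, ← monodromy, hG', ← Matrix.mul_assoc, Matrix.diagonal_mul_diagonal]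
    have : (fun i => (l i)⁻¹ ^ m * μ i) = 1 := by
      ext j
      rw [← hl j, inv_pow, inv_mul_cancel₀ (pow_ne_zero _ (hl0 j))]; rfl
    rw [this]
    simp [pathP]
  have hNval : ∀ i : ZMod m, N (i + 1).val = N (i.val + 1) := by
    intro i
    rcases val_add_one_cases i with h1 | ⟨h1, h2⟩
    · rw [h1]
    · rw [h1, h2, hNm]
  have hdet : ∀ i : ZMod m, (N i.val).det ≠ 0 := by
    intro i
    simp only [N]
    rw [Matrix.det_mul, Matrix.det_mul, Matrix.det_diagonal]
    refine mul_ne_zero (mul_ne_zero ?_ (Matrix.GeneralLinearGroup.det_ne_zero _))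
      (det_pathP_ne_zero h.1 (ZMod.val_lt i).le)
    exact Finset.prod_ne_zero_iff.2 fun j _ => pow_ne_zero _ (inv_ne_zero (hl0 j))
  refine ⟨fun i => Matrix.GeneralLinearGroup.mkOfDetNeZero (N i.val) (hdet i), l, ⟨hl0, ?_⟩, ?_⟩
  · intro j k hjk
    rw [hl, hl]
    exact hμ.ne hjk
  · intro i
    simp only [Quad.act]
    have h1 : (Matrix.GeneralLinearGroup.mkOfDetNeZero (N i.val) (hdet i)).val * q.P i =
        Matrix.diagonal l *
          (Matrix.GeneralLinearGroup.mkOfDetNeZero (N (i + 1).val) (hdet (i + 1))).val := by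
      change N i.val * q.P i = Matrix.diagonal l * N (i + 1).val
      rw [hNval, hN]
      simp
    rw [h1, Matrix.mul_assoc, Units.mul_inv, Matrix.mul_one]

theorem monodromy_mem_regularMonodromy [NeZero m] {P : ZMod m → Matrix (Fin n) (Fin n) ℂ}
    {l : Fin n → ℂ} (hl : l ∈ regularSpectrum m n) (h : ∀ i, P i = Matrix.diagonal l) :
    monodromy P ∈ regularMonodromy n := by
  rw [monodromy, pathP_diagonal h]
  constructor
  · rw [Matrix.det_diagonal, Finset.prod_ne_zero_iff]
    exact fun j _ => pow_ne_zero _ (hl.1 j)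
  · rw [Matrix.charpoly_diagonal, Polynomial.separable_prod_X_sub_C_iff]
    intro j k hjk
    by_contra hne
    exact hl.2 j k hne hjk

theorem regularMonodromy_conj (G : GL (Fin n) ℂ) (A : Matrix (Fin n) (Fin n) ℂ) :
    G.val * A * G⁻¹.val ∈ regularMonodromy n ↔ A ∈ regularMonodromy n := by
  have h1 : (G.val * A * G⁻¹.val).charpoly = A.charpoly := by
    rw [Matrix.charpoly_mul_comm, ← mul_assoc]; simp
  have h2 : (G.val * A * G⁻¹.val).det = A.det := by
    rw [Matrix.det_mul_comm, ← mul_assoc]; simp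
  simp only [regularMonodromy, Set.mem_ofPred_eq, h1, h2]

theorem act_mem_levelSet [NeZero m] {g : ZMod m → ℂ} {q : Quad m n d} (hq : q ∈ levelSet n d g)
    (M : ZMod m → GL (Fin n) ℂ) : q.act M ∈ levelSet n d g := by
  rw [mem_levelSet_iff] at hq ⊢
  intro i
  have := congrArg (fun A => (M i).val * A * (M i)⁻¹.val) (hq i)
  simp only [mul_sub, sub_mul, Matrix.mul_smul, Matrix.smul_mul, Matrix.mul_one] at this
  simp only [Quad.act, sub_add_cancel]
  rw [← Units.val_mul (M i), mul_inv_cancel, Units.val_one] at this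
  rw [← Matrix.mul_assoc _ (q.w i), Matrix.mul_assoc _ (q.v i), ← this]
  simp [Matrix.mul_assoc]

/-- Replaces the existence of a diagonal representative by a condition on any representative; it is
invariant because the gauge group conjugates the monodromy by its component at `0`. -/
theorem mk_mem_diagLocus_iff [NeZero m] {g : ZMod m → ℂ} (q : levelSet n d g) :
    CMSpace.mk q ∈ diagLocus n d g ↔ monodromy q.1.P ∈ regularMonodromy n := by
  constructor
  · rintro ⟨q', hq', l, hl, h⟩
    obtain ⟨M, hM⟩ : ∃ M : ZMod m → GL (Fin n) ℂ, q'.1.act M = q.1 := Quotient.exact hq'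
    rw [← hM, monodromy_act, regularMonodromy_conj]
    exact monodromy_mem_regularMonodromy hl h
  · intro h
    obtain ⟨M, l, hl, hM⟩ := exists_gauge_diagonal h
    refine ⟨⟨q.1.act M, act_mem_levelSet q.2 M⟩, ?_, l, hl, hM⟩
    refine Quotient.sound ?_
    exact ⟨M⁻¹, by rw [← Quad.act_mul, inv_mul_cancel, Quad.act_one]⟩

theorem Quad.continuous_toTuple :
    Continuous fun q : Quad m n d => (q.X, q.P, q.v, q.w) := continuous_induced_dom

theorem Quad.continuous_P : Continuous fun q : Quad m n d => q.P :=
  continuous_fst.comp (continuous_snd.comp Quad.continuous_toTuple)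

theorem continuous_pathP (k : ℕ) :
    Continuous fun P : ZMod m → Matrix (Fin n) (Fin n) ℂ => pathP P k := by
  induction k with
  | zero => exact continuous_const
  | succ k ih => exact ih.matrix_mul (continuous_apply _)

theorem isOpen_diagLocus [NeZero m] (d : ZMod m → ℕ) (g : ZMod m → ℂ) :
    IsOpen (diagLocus n d g) := by
  have hq : Topology.IsQuotientMap (CMSpace.mk : levelSet n d g → CMSpace n d g) :=
    isQuotientMap_quotient_mk'
  rw [← hq.isOpen_preimage]
  have : CMSpace.mk ⁻¹' diagLocus n d g =
      (fun q : levelSet n d g => monodromy q.1.P) ⁻¹' regularMonodromy n := by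
    ext q; exact mk_mem_diagLocus_iff q
  rw [this]
  exact isOpen_regularMonodromy.preimage
    ((continuous_pathP m).comp (Quad.continuous_P.comp continuous_subtype_val))

end Monodromy

/-! ### Cyclic first order recursions -/

section Recursion

variable {m : ℕ} [NeZero m]

/-- The weighted sum in `cShift` is independent of `i` and cancels. The partial sums differ by `u
i`, except across `0`, where the full sum drops back to `u 0`. -/
theorem cShift_sub_one (u : ZMod m → ℂ) (i : ZMod m) :
    cShift u (i - 1) - cShift u i = (if i = 0 then ∑ r, u r else 0) - u i := by
  simp only [cShift]
  rw [sub_sub_sub_cancel_right]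
  obtain ⟨j, rfl⟩ : ∃ j, i = j + 1 := ⟨i - 1, by ring⟩
  rw [add_sub_cancel_right]
  rcases val_add_one_cases j with h | ⟨h, h'⟩
  · have hne : j + 1 ≠ 0 := by
      intro h0; rw [h0, ZMod.val_zero] at h; omega
    have hf : Finset.univ.filter (fun r : ZMod m => r.val ≤ (j + 1).val) =
        insert (j + 1) (Finset.univ.filter (fun r : ZMod m => r.val ≤ j.val)) := by
      ext r
      simp only [Finset.mem_filter, Finset.mem_univ, true_and, Finset.mem_insert]
      rw [← (ZMod.val_injective m).eq_iff (a := r), h]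
      omega
    rw [hf, Finset.sum_insert (by simp [h]), if_neg hne]
    ring
  · have h0 : j + 1 = 0 := (ZMod.val_eq_zero _).1 h
    rw [if_pos h0, h0]
    have h1 : Finset.univ.filter (fun r : ZMod m => r.val ≤ j.val) = Finset.univ := by
      ext r
      have := ZMod.val_lt r
      simp only [Finset.mem_filter, Finset.mem_univ, true_and, iff_true]
      omega
    have h2 : Finset.univ.filter (fun r : ZMod m => r.val ≤ (0 : ZMod m).val) = {0} := by
      ext r
      simp
    rw [h1, h2, Finset.sum_singleton]

theorem eq_of_forall_sub_one_eq {α : Type*} {f : ZMod m → α} (h : ∀ i, f (i - 1) = f i)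
    (i : ZMod m) : f i = f 0 := by
  have : ∀ k : ℕ, f (k : ZMod m) = f 0 := by
    intro k
    induction k with
    | zero => simp
    | succ k ih => rw [← ih, ← h]; simp
  simpa using this i.val

/-- Summing over the cycle annihilates the left side and gives the solvability condition. Under it
`cShift` supplies a particular solution by `cShift_sub_one`, and the homogeneous solutions are
constant in `i`. -/
theorem cyclic_recursion_diag {l : ℂ} (hl : l ≠ 0) (g u x : ZMod m → ℂ) :
    (∀ i, x (i - 1) * l - l * x i = u i - g i) ↔
      ∑ i, u i = ∑ i, g i ∧ ∃ φ, ∀ i, x i = φ + l⁻¹ * (cShift g i - cShift u i) := by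
  constructor
  · intro h
    have hs : ∑ i, u i = ∑ i, g i := by
      have := Finset.sum_congr rfl fun i (_ : i ∈ Finset.univ) => h i
      rw [Finset.sum_sub_distrib, Finset.sum_sub_distrib, ← Finset.sum_mul, ← Finset.mul_sum,
        show ∑ i, x (i - 1) = ∑ i, x i from Equiv.sum_comp (Equiv.subRight (1 : ZMod m)) x] at this
      linear_combination -this
    refine ⟨hs, x 0 - l⁻¹ * (cShift g 0 - cShift u 0), fun i => ?_⟩
    have := eq_of_forall_sub_one_eq (f := fun i => x i - l⁻¹ * (cShift g i - cShift u i)) ?_ i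
    · linear_combination this
    · intro i
      have h1 := cShift_sub_one g i
      have h2 := cShift_sub_one u i
      rw [hs] at h2
      have h3 := h i
      apply mul_left_cancel₀ hl
      simp only [mul_sub]
      have h4 : l * l⁻¹ = 1 := mul_inv_cancel₀ hl
      linear_combination h3 + h2 - h1 + (cShift g i - cShift g (i - 1) - cShift u i +
        cShift u (i - 1)) * (h4)
  · rintro ⟨hs, φ, hx⟩ i
    have h1 := cShift_sub_one g i
    have h2 := cShift_sub_one u i
    rw [hs] at h2
    rw [hx, hx]
    have h4 : l * l⁻¹ = 1 := mul_inv_cancel₀ hl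
    linear_combination (cShift g (i - 1) - cShift g i + cShift u i - cShift u (i - 1)) * h4 + h1 - h2

/-- The formula solves the recursion because the sum telescopes between `a^m/(a^m - b^m)` and
`b^m/(a^m - b^m)`. It is the only solution: carrying a homogeneous solution once around the cycle
multiplies `a^m - b^m` into it and gives `0`. -/
theorem cyclic_recursion_offdiag {a b : ℂ} (hab : a ^ m ≠ b ^ m) (u x : ZMod m → ℂ) :
    (∀ i, x (i - 1) * b - a * x i = u i) ↔
      ∀ i, x i = -∑ h ∈ Finset.range m, u (i - (h : ZMod m)) *
        (a ^ (m - h - 1) * b ^ h / (a ^ m - b ^ m)) := by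
  have hD : a ^ m - b ^ m ≠ 0 := sub_ne_zero.2 hab
  have key : ∀ i : ZMod m,
      (-∑ h ∈ Finset.range m, u (i - 1 - (h : ZMod m)) *
        (a ^ (m - h - 1) * b ^ h / (a ^ m - b ^ m))) * b -
      a * (-∑ h ∈ Finset.range m, u (i - (h : ZMod m)) *
        (a ^ (m - h - 1) * b ^ h / (a ^ m - b ^ m))) = u i := by
    intro i
    let F : ℕ → ℂ := fun h => u (i - (h : ZMod m)) * (a ^ (m - h) * b ^ h / (a ^ m - b ^ m))
    have h1 : (∑ h ∈ Finset.range m, u (i - 1 - (h : ZMod m)) *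
        (a ^ (m - h - 1) * b ^ h / (a ^ m - b ^ m))) * b = ∑ h ∈ Finset.range m, F (h + 1) := by
      rw [Finset.sum_mul]
      refine Finset.sum_congr rfl fun h _ => ?_
      simp only [F]
      rw [show i - ((h + 1 : ℕ) : ZMod m) = i - 1 - (h : ZMod m) by push_cast; ring,
        show m - (h + 1) = m - h - 1 by omega]
      ring
    have h2 : a * (∑ h ∈ Finset.range m, u (i - (h : ZMod m)) *
        (a ^ (m - h - 1) * b ^ h / (a ^ m - b ^ m))) = ∑ h ∈ Finset.range m, F h := by
      rw [Finset.mul_sum]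
      refine Finset.sum_congr rfl fun h hh => ?_
      simp only [F]
      rw [show m - h = m - h - 1 + 1 by have := Finset.mem_range.1 hh; omega]
      simp only [Nat.add_sub_cancel]
      ring
    have h3 := Finset.sum_range_sub F m
    rw [Finset.sum_sub_distrib] at h3
    have h4 : F m = u i * (b ^ m / (a ^ m - b ^ m)) := by simp [F]
    have h5 : F 0 = u i * (a ^ m / (a ^ m - b ^ m)) := by simp [F]
    rw [h4, h5] at h3
    have h6 : a ^ m / (a ^ m - b ^ m) - b ^ m / (a ^ m - b ^ m) = 1 := by
      rw [← sub_div, div_self hD]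
    linear_combination -h1 + h2 - h3 + u i * h6
  constructor
  · intro h i
    set y : ZMod m → ℂ := fun i => x i - -∑ h ∈ Finset.range m, u (i - (h : ZMod m)) *
        (a ^ (m - h - 1) * b ^ h / (a ^ m - b ^ m)) with hy
    have hrec : ∀ i, y (i - 1) * b = a * y i := by
      intro i
      simp only [hy]
      linear_combination h i - key i
    have hpow : ∀ (t : ℕ) (i : ZMod m), y (i - t) * b ^ t = a ^ t * y i := by
      intro t
      induction t with
      | zero => simp
      | succ t ih =>
        intro i
        have h1 := ih (i - 1)
        have h2 := hrec i
        rw [show i - ((t + 1 : ℕ) : ZMod m) = i - 1 - t by push_cast; ring]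
        linear_combination b * h1 + a ^ t * h2
    have := hpow m i
    rw [CharP.cast_eq_zero, sub_zero] at this
    have h0 : y i = 0 := by
      have h1 : (a ^ m - b ^ m) * y i = 0 := by linear_combination -this
      exact (mul_eq_zero.1 h1).resolve_left hD
    exact sub_eq_zero.1 h0
  · intro h i
    rw [h, h]
    exact key i

end Recursion

/-! ### The level set over diagonal `P`: coordinates on `U` -/

section DiagonalForm

variable {m n : ℕ} [NeZero m] {d : ZMod m → ℕ}

/-- The solution `X` of the moment map equation for `P = diag(l)` and `u i = v i w i`, with free
diagonal parameter `φ`. -/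
noncomputable def diagX (g : ZMod m → ℂ) (l φ : Fin n → ℂ) (u : ZMod m → Matrix (Fin n) (Fin n) ℂ)
    (i : ZMod m) : Matrix (Fin n) (Fin n) ℂ :=
  Matrix.of fun j k =>
    if j = k then φ j + (l j)⁻¹ * (cShift g i - cShift (fun r => u r j j) i)
    else -∑ h ∈ Finset.range m, u (i - (h : ZMod m)) j k *
        (l j ^ (m - h - 1) * l k ^ h / (l j ^ m - l k ^ m))

/-- For diagonal `P` the entries of the moment map equation do not interact: for fixed `(j, k)` it
is one of the two cyclic recursions in `i`. -/
theorem mem_levelSet_iff_of_diagonal {g : ZMod m → ℂ} {q : Quad m n d} {l : Fin n → ℂ}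
    (hl : l ∈ regularSpectrum m n) (hP : ∀ i, q.P i = Matrix.diagonal l) :
    q ∈ levelSet n d g ↔ (∀ j, ∑ i, (q.v i * q.w i) j j = ∑ i, g i) ∧
      ∃ φ, q.X = diagX g l φ fun i => q.v i * q.w i := by
  rw [mem_levelSet_iff]
  have h1 : (∀ i, q.X (i - 1) * q.P (i - 1) - q.P i * q.X i = q.v i * q.w i - g i • 1) ↔
      ∀ j k i, q.X (i - 1) j k * l k - l j * q.X i j k =
        (q.v i * q.w i) j k - if j = k then g i else 0 := by
    simp only [hP, ← Matrix.ext_iff, Matrix.sub_apply, Matrix.mul_diagonal, Matrix.diagonal_mul,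
      Matrix.smul_apply, Matrix.one_apply, smul_eq_mul, mul_ite, mul_one, mul_zero]
    exact ⟨fun h j k i => h i j k, fun h i j k => h j k i⟩
  rw [h1]
  constructor
  · intro h
    have hd : ∀ j, ∑ i, (q.v i * q.w i) j j = ∑ i, g i ∧ ∃ φ, ∀ i, q.X i j j = φ + (l j)⁻¹ *
        (cShift g i - cShift (fun r => (q.v r * q.w r) j j) i) := fun j =>
      (cyclic_recursion_diag (hl.1 j) g (fun r => (q.v r * q.w r) j j) (fun i => q.X i j j)).1
        fun i => by simpa using h j j i
    choose φ hφ using fun j => (hd j).2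
    refine ⟨fun j => (hd j).1, φ, ?_⟩
    ext i j k
    rw [diagX, Matrix.of_apply]
    split_ifs with hjk
    · subst hjk; exact hφ j i
    · exact (cyclic_recursion_offdiag (hl.2 j k hjk) (fun i => (q.v i * q.w i) j k)
        (fun i => q.X i j k)).1 (fun i => by simpa [hjk] using h j k i) i
  · rintro ⟨hs, φ, hX⟩ j k
    by_cases hjk : j = k
    · subst hjk
      simp only [if_true]
      refine (cyclic_recursion_diag (hl.1 j) g (fun r => (q.v r * q.w r) j j)
        (fun i => q.X i j j)).2 ⟨hs j, φ j, fun i => ?_⟩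
      rw [hX, diagX, Matrix.of_apply, if_pos rfl]
    · simp only [hjk, if_false, sub_zero]
      refine (cyclic_recursion_offdiag (hl.2 j k hjk) (fun i => (q.v i * q.w i) j k)
        (fun i => q.X i j k)).2 fun i => ?_
      rw [hX, diagX, Matrix.of_apply, if_neg hjk]

end DiagonalForm

section Spin

variable {m n : ℕ} [NeZero m] {d : ℕ}

theorem spinQuad_X (g : ZMod m → ℂ) (y : SpinCoord m n d) :
    (spinQuad g y).X =
      diagX g y.1 y.2.1 fun i => (spinQuad g y).v i * (spinQuad g y).w i := rfl

theorem spinQuad_mem_levelSet {g : ZMod m → ℂ} {y : SpinCoord m n d} (hy : y ∈ spinDomain n d g) :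
    spinQuad g y ∈ levelSet n (spinFraming m d) g :=
  (mem_levelSet_iff_of_diagonal hy.1 fun _ => rfl).2 ⟨hy.2, y.2.1, spinQuad_X g y⟩

theorem mem_diagLocus_spin_iff (g : ZMod m → ℂ) (x : CMSpace n (spinFraming m d) g) :
    x ∈ diagLocus n (spinFraming m d) g ↔ ∃ y ∈ spinDomain n d g,
      ∃ q : levelSet n (spinFraming m d) g, q.1 = spinQuad g y ∧ CMSpace.mk q = x := by
  constructor
  · rintro ⟨q, hq, l, hl, hP⟩
    obtain ⟨hs, φ, hX⟩ := (mem_levelSet_iff_of_diagonal hl hP).1 q.2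
    refine ⟨(l, φ, q.1.v, q.1.w), ⟨hl, hs⟩, q, ?_, hq⟩
    refine Quad.ext hX (funext hP) rfl rfl
  · rintro ⟨y, hy, q, hq, hx⟩
    exact ⟨q, hx, y.1, hy.1, fun i => by rw [hq]; rfl⟩

end Spin

section Spinless

variable {m n : ℕ} [NeZero m]

theorem spinless_mul_apply (v : (i : ZMod m) → Matrix (Fin n) (Fin (spinlessFraming m i)) ℂ)
    (w : (i : ZMod m) → Matrix (Fin (spinlessFraming m i)) (Fin n) ℂ) (i : ZMod m) (j k : Fin n) :
    (v i * w i) j k =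
      if i = 0 then v 0 j ⟨0, by simp [spinlessFraming]⟩ * w 0 ⟨0, by simp [spinlessFraming]⟩ k
      else 0 := by
  rw [Matrix.mul_apply]
  split_ifs with h
  · subst h
    have : Subsingleton (Fin (spinlessFraming m (0 : ZMod m))) := by
      simp only [spinlessFraming, if_true]; infer_instance
    rw [Fintype.sum_subsingleton _ ⟨0, by simp [spinlessFraming]⟩]
  · have : IsEmpty (Fin (spinlessFraming m i)) := by
      simp only [spinlessFraming, h, if_false]; infer_instance
    simp

theorem spinlessQuad_mul_apply (g : ZMod m → ℂ) (y : Coord n) (i : ZMod m) (j k : Fin n) :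
    ((spinlessQuad g y).v i * (spinlessQuad g y).w i) j k = if i = 0 then ∑ r, g r else 0 := by
  rw [spinless_mul_apply]
  simp [spinlessQuad]

/-- The weight `(m - 0)/m` of the vertex `0` is `1`, which cancels the partial sum; this is why no
spin correction appears in the spinless diagonal entries. -/
theorem cShift_single (c : ℂ) (i : ZMod m) :
    cShift (fun r : ZMod m => if r = 0 then c else 0) i = 0 := by
  have hm : (m : ℂ) ≠ 0 := Nat.cast_ne_zero.2 (NeZero.ne m)
  simp [cShift, Finset.sum_ite_eq', hm]

theorem diagX_spinless {g : ZMod m → ℂ} {l : Fin n → ℂ} (φ : Fin n → ℂ)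
    {u : ZMod m → Matrix (Fin n) (Fin n) ℂ}
    (hu : ∀ i j k, u i j k = if i = 0 then ∑ r, g r else 0) :
    diagX g l φ u = (spinlessQuad g (l, φ)).X := by
  ext i j k
  simp only [diagX, spinlessQuad, Matrix.of_apply, hu]
  split_ifs with hjk
  · rw [cShift_single, sub_zero, mul_comm]
  · rw [Finset.sum_eq_single i.val]
    · simp only [ZMod.natCast_val, ZMod.cast_id', id, sub_self, if_true]
      ring
    · intro h hh hne
      rw [if_neg, zero_mul]
      intro h0
      apply hne
      rw [sub_eq_zero.1 h0, ZMod.val_cast_of_lt (Finset.mem_range.1 hh)]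
    · intro h; exact absurd (Finset.mem_range.2 (ZMod.val_lt i)) h

theorem spinlessQuad_X (g : ZMod m → ℂ) (y : Coord n) :
    (spinlessQuad g y).X =
      diagX g y.1 y.2 fun i => (spinlessQuad g y).v i * (spinlessQuad g y).w i :=
  (diagX_spinless y.2 (spinlessQuad_mul_apply g y)).symm

theorem spinlessQuad_mem_levelSet {g : ZMod m → ℂ} {y : Coord n} (hy : y ∈ coordDomain m n) :
    spinlessQuad g y ∈ levelSet n (spinlessFraming m) g := by
  refine (mem_levelSet_iff_of_diagonal (l := y.1) hy fun _ => rfl).2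
    ⟨fun j => ?_, y.2, spinlessQuad_X g y⟩
  simp [spinlessQuad_mul_apply]

/-- The constraint reads `v_j w_j = |g| ≠ 0`. So `diag(v_0)⁻¹`, used at every vertex, is a gauge
transformation; it commutes with the diagonal `P_i`, makes all entries of `v_0` equal to `1`, and
then those of `w_0` equal to `|g|`. -/
theorem mem_diagLocus_spinless_iff {g : ZMod m → ℂ} (hg : ∑ i, g i ≠ 0)
    (x : CMSpace n (spinlessFraming m) g) :
    x ∈ diagLocus n (spinlessFraming m) g ↔ ∃ y ∈ coordDomain m n,
      ∃ q : levelSet n (spinlessFraming m) g, q.1 = spinlessQuad g y ∧ CMSpace.mk q = x := by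
  constructor
  · rintro ⟨q, hq, l, hl, hP⟩
    have hz : 0 < spinlessFraming m (0 : ZMod m) := by simp [spinlessFraming]
    have hvw : ∀ j, q.1.v 0 j ⟨0, hz⟩ * q.1.w 0 ⟨0, hz⟩ j = ∑ i, g i := by
      intro j
      rw [← ((mem_levelSet_iff_of_diagonal hl hP).1 q.2).1 j]
      simp only [spinless_mul_apply, Finset.sum_ite_eq', Finset.mem_univ, if_true]
    have hv : ∀ j, q.1.v 0 j ⟨0, hz⟩ ≠ 0 := fun j h0 => hg (by rw [← hvw j, h0, zero_mul])
    let D : Matrix (Fin n) (Fin n) ℂ := Matrix.diagonal fun j => (q.1.v 0 j ⟨0, hz⟩)⁻¹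
    let D' : Matrix (Fin n) (Fin n) ℂ := Matrix.diagonal fun j => q.1.v 0 j ⟨0, hz⟩
    have hDD : D * D' = 1 := by
      simp only [D, D', Matrix.diagonal_mul_diagonal, inv_mul_cancel₀ (hv _), Matrix.diagonal_one]
    let M : ZMod m → GL (Fin n) ℂ := fun _ => ⟨D, D', hDD, mul_eq_one_comm.1 hDD⟩
    let q' : levelSet n (spinlessFraming m) g := ⟨q.1.act M, act_mem_levelSet q.2 M⟩
    have hP' : ∀ i, q'.1.P i = Matrix.diagonal l := by
      intro i
      change D * q.1.P i * D' = _
      rw [hP, Matrix.diagonal_mul_diagonal, Matrix.diagonal_mul_diagonal]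
      congr 1; ext j
      rw [mul_comm, ← mul_assoc, mul_inv_cancel₀ (hv j), one_mul]
    obtain ⟨hs, φ, hX⟩ := (mem_levelSet_iff_of_diagonal hl hP').1 q'.2
    -- All framing indices live at the vertex `0`. The transport along `0 = i` allows `v` and `w`,
    -- as dependent families, to be compared at this one index.
    have hfr : ∀ (i : ZMod m) (α : Fin (spinlessFraming m i)), ∃ h : (0 : ZMod m) = i,
        α = h ▸ (⟨0, hz⟩ : Fin (spinlessFraming m (0 : ZMod m))) := by
      intro i α
      have h : 0 = i := by
        by_contra h
        have := α.2
        simp [spinlessFraming, Ne.symm h] at this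
      subst h
      have : Subsingleton (Fin (spinlessFraming m (0 : ZMod m))) := by
        simp only [spinlessFraming, if_true]; infer_instance
      exact ⟨rfl, Subsingleton.elim _ _⟩
    have hv' : q'.1.v = (spinlessQuad g (l, φ)).v := by
      ext i j α
      obtain ⟨rfl, rfl⟩ := hfr i α
      change (D * q.1.v 0) j ⟨0, hz⟩ = 1
      rw [Matrix.diagonal_mul, inv_mul_cancel₀ (hv j)]
    have hw' : q'.1.w = (spinlessQuad g (l, φ)).w := by
      ext i α j
      obtain ⟨rfl, rfl⟩ := hfr i α
      change (q.1.w 0 * D') ⟨0, hz⟩ j = ∑ r, g r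
      rw [Matrix.mul_diagonal, mul_comm, hvw]
    refine ⟨(l, φ), hl, q', ?_, ?_⟩
    · refine Quad.ext ?_ (funext hP') hv' hw'
      rw [hX, hv', hw', diagX_spinless φ (spinlessQuad_mul_apply g (l, φ))]
    · rw [← hq]
      exact Quotient.sound ⟨M⁻¹, by rw [← Quad.act_mul, inv_mul_cancel, Quad.act_one]⟩
  · rintro ⟨y, hy, q, hq, hx⟩
    exact ⟨q, hx, y.1, hy, fun i => by rw [hq]; rfl⟩

end Spinless

/-- `RatFunc.eval` uses the reduced fraction. Its denominator divides `q`, so it does not vanish at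
`a` and the value of the quotient is a genuine one. -/
theorem ratFunc_eval_div {p q : Polynomial ℂ} {a : ℂ} (hq : q.eval a ≠ 0) :
    (algebraMap (Polynomial ℂ) (RatFunc ℂ) p / algebraMap (Polynomial ℂ) (RatFunc ℂ) q).eval
      (RingHom.id ℂ) a = p.eval a / q.eval a := by
  have hq0 : q ≠ 0 := by rintro rfl; simp at hq
  set x := algebraMap (Polynomial ℂ) (RatFunc ℂ) p / algebraMap (Polynomial ℂ) (RatFunc ℂ) q with hx
  obtain ⟨r, hr⟩ : x.denom ∣ q := RatFunc.denom_div_dvd p q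
  have hd : x.denom.eval a ≠ 0 := by
    intro h0; apply hq; rw [hr, Polynomial.eval_mul, h0, zero_mul]
  have h1 : x.num * q = p * x.denom := by
    apply RatFunc.algebraMap_injective ℂ
    have h2 := RatFunc.num_div_denom x
    have h3 : algebraMap (Polynomial ℂ) (RatFunc ℂ) q ≠ 0 := RatFunc.algebraMap_ne_zero hq0
    have h4 : algebraMap (Polynomial ℂ) (RatFunc ℂ) x.denom ≠ 0 :=
      RatFunc.algebraMap_ne_zero x.denom_ne_zero
    rw [map_mul, map_mul, ← div_eq_div_iff h4 h3, h2]
  rw [RatFunc.eval, Polynomial.eval₂_id, Polynomial.eval₂_id, div_eq_div_iff hd hq,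
    ← Polynomial.eval_mul, h1, Polynomial.eval_mul]

/-! ### The value of `s` at an eigenvalue -/

section DistinctEigenvalues

variable {ι : Type*} [Fintype ι] [DecidableEq ι]

theorem charpoly_of_eigenbasis {A G G' : Matrix ι ι ℂ} {μ : ι → ℂ} (hG : G * G' = 1)
    (hA : A * G = G * Matrix.diagonal μ) :
    A.charpoly = ∏ t, (Polynomial.X - Polynomial.C (μ t)) := by
  have h : A = G * Matrix.diagonal μ * G' := by
    rw [← hA, Matrix.mul_assoc, hG, Matrix.mul_one]
  rw [h, Matrix.charpoly_mul_comm, ← mul_assoc, mul_eq_one_comm.1 hG, one_mul,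
    Matrix.charpoly_diagonal]

theorem derivative_charpoly_eval_of_eigenbasis {A G G' : Matrix ι ι ℂ} {μ : ι → ℂ}
    (hG : G * G' = 1) (hA : A * G = G * Matrix.diagonal μ) (s : ι) :
    A.charpoly.derivative.eval (μ s) = ∏ t ∈ Finset.univ.erase s, (μ s - μ t) := by
  rw [charpoly_of_eigenbasis hG hA, ← Finset.mul_prod_erase _ _ (Finset.mem_univ s),
    Polynomial.derivative_mul]
  simp [Polynomial.eval_prod]

/-- In the eigenbasis the matrix is `diag(μ_s - μ_t)`, with a zero at `t = s`. So every cofactor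
except the one at `s` vanishes, and that one is the derivative of the characteristic polynomial. -/
theorem adjugate_of_eigenbasis {A G G' : Matrix ι ι ℂ} {μ : ι → ℂ}
    (hG : G * G' = 1) (hA : A * G = G * Matrix.diagonal μ) (s : ι) :
    (Matrix.scalar ι (μ s) - A).adjugate = A.charpoly.derivative.eval (μ s) •
      Matrix.vecMulVec (fun i => G i s) (fun i => G' s i) := by
  have h : Matrix.scalar ι (μ s) - A = G * Matrix.diagonal (fun t => μ s - μ t) * G' := by
    have h1 : (Matrix.diagonal fun t => μ s - μ t) = Matrix.scalar ι (μ s) - Matrix.diagonal μ := by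
      rw [Matrix.scalar_apply, Matrix.diagonal_sub]
    rw [h1, mul_sub, sub_mul, ← hA, Matrix.mul_assoc A, hG, Matrix.mul_one,
      ← (Matrix.scalar_commute (μ s) (fun _ => Commute.all _ _) G).eq, Matrix.mul_assoc, hG,
      Matrix.mul_one]
  rw [h, adjugate_conj _ _ _ hG, Matrix.adjugate_diagonal]
  have h2 : (fun i => ∏ j ∈ Finset.univ.erase i, (μ s - μ j)) =
      Pi.single s (A.charpoly.derivative.eval (μ s)) := by
    ext i
    by_cases hi : i = s
    · subst hi
      rw [Pi.single_eq_same, derivative_charpoly_eval_of_eigenbasis hG hA]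
    · rw [Pi.single_eq_of_ne hi]
      exact Finset.prod_eq_zero (Finset.mem_erase.2 ⟨Ne.symm hi, Finset.mem_univ s⟩) (sub_self _)
  rw [h2]
  ext i j
  rw [Matrix.smul_apply, Matrix.vecMulVec_apply, Matrix.mul_apply]
  simp only [Matrix.mul_diagonal, smul_eq_mul]
  rw [Finset.sum_eq_single s]
  · rw [Pi.single_eq_same]; ring
  · intro t _ ht
    simp [ht]
  · simp

end DistinctEigenvalues

section Theta

variable {m n : ℕ} [NeZero m] {d : ZMod m → ℕ}

/-- The eigenvectors of the cyclic matrix with all blocks `diag(l)`. -/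
noncomputable def fourierBasis (m n : ℕ) [NeZero m] :
    Matrix (ZMod m × Fin n) (ZMod m × Fin n) ℂ :=
  Matrix.of fun p q => if p.2 = q.2 then ZMod.stdAddChar (p.1 * q.1) else 0

/-- The inverse of `fourierBasis`. -/
noncomputable def fourierBasisInv (m n : ℕ) [NeZero m] :
    Matrix (ZMod m × Fin n) (ZMod m × Fin n) ℂ :=
  Matrix.of fun p q => if p.2 = q.2 then (m : ℂ)⁻¹ * ZMod.stdAddChar (-(p.1 * q.1)) else 0

theorem fourierBasis_mul_inv : fourierBasis m n * fourierBasisInv m n = 1 := by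
  have hm : (m : ℂ) ≠ 0 := Nat.cast_ne_zero.2 (NeZero.ne m)
  ext ⟨i, a⟩ ⟨j, b⟩
  simp only [fourierBasis, fourierBasisInv, Matrix.mul_apply, Matrix.of_apply,
    Fintype.sum_prod_type, ite_mul, zero_mul, mul_ite, mul_zero, Matrix.one_apply, Prod.mk.injEq]
  by_cases hab : a = b
  · subst hab
    simp only [and_true, Finset.sum_ite_eq', Finset.mem_univ, if_true]
    have h := AddChar.sum_mulShift (i - j) (ZMod.isPrimitive_stdAddChar m)
    rw [ZMod.card] at h
    have h2 : ∀ s : ZMod m, (ZMod.stdAddChar (i * s) : ℂ) * ((m : ℂ)⁻¹ *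
        ZMod.stdAddChar (-(s * j))) = (m : ℂ)⁻¹ * ZMod.stdAddChar (s * (i - j)) := by
      intro s
      rw [mul_left_comm, ← AddChar.map_add_eq_mul]
      congr 2; ring
    simp only [h2]
    rw [← Finset.mul_sum, h]
    simp only [sub_eq_zero]
    split_ifs <;> simp [hm]
  · simp [hab]

theorem blk_mul_fourierBasis {P : ZMod m → Matrix (Fin n) (Fin n) ℂ} {l : Fin n → ℂ}
    (hP : ∀ i, P i = Matrix.diagonal l) :
    blk 1 P * fourierBasis m n =
      fourierBasis m n * Matrix.diagonal fun t => ZMod.stdAddChar t.1 * l t.2 := by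
  ext ⟨i, a⟩ ⟨s, b⟩
  rw [Matrix.mul_diagonal]
  simp only [fourierBasis, Matrix.mul_apply, Matrix.of_apply, Fintype.sum_prod_type, blk_apply, hP,
    ite_mul, zero_mul, mul_ite, mul_zero]
  rw [Finset.sum_eq_single (i + 1)]
  · simp only [if_true]
    rw [Finset.sum_eq_single a]
    · rw [Matrix.diagonal_apply_eq]
      split_ifs with h
      · subst h
        rw [add_mul, one_mul, AddChar.map_add_eq_mul]; ring
      · rfl
    · intro c _ hc
      simp [Matrix.diagonal_apply_ne' _ hc]
    · simp
  · intro c _ hc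
    simp [hc]
  · simp

/-- The eigenvalue `λ_k` belongs to the trivial character, whose eigenvector is constant along the
cycle. The adjugate contributes `A'(λ_k)` times the spectral projection, `A'(λ_k)` cancels in `s`,
and the constant eigenvector turns the trace into an average over the vertices. -/
theorem sklyanin_eval {g : ZMod m → ℂ} (hg : ∑ i, g i ≠ 0) {q : Quad m n d} {l : Fin n → ℂ}
    (hl : l ∈ regularSpectrum m n) (hP : ∀ i, q.P i = Matrix.diagonal l) (k : Fin n) :
    (q.sklyanin g).eval (RingHom.id ℂ) (l k) =
      ((m : ℂ) * ∑ i, g i)⁻¹ * ∑ i, (q.v i * q.w i * q.X (i - 1)) k k := by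
  set μ : ZMod m × Fin n → ℂ := fun t => ZMod.stdAddChar t.1 * l t.2 with hμ
  have hA : blk 1 q.P * fourierBasis m n = fourierBasis m n * Matrix.diagonal μ :=
    blk_mul_fourierBasis hP
  have hμ0 : μ (0, k) = l k := by simp [hμ]
  have hder := derivative_charpoly_eval_of_eigenbasis fourierBasis_mul_inv hA (0, k)
  have hadj := adjugate_of_eigenbasis fourierBasis_mul_inv hA (0, k)
  rw [hμ0, ← Quad.bigP_eq] at hder hadj
  set c := q.bigP.charpoly.derivative.eval (l k) with hc
  -- The eigenvalue `λ_k` is simple: `ζ λ_a = λ_k` with `ζ^m = 1` forces `a = k` by the distinct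
  -- `m`-th powers, and then `ζ = 1` as `λ_k ≠ 0`.
  have hc0 : c ≠ 0 := by
    rw [hder, Finset.prod_ne_zero_iff]
    rintro ⟨s, a⟩ hs
    rw [Finset.mem_erase] at hs
    intro h0
    have h1 : l k = ZMod.stdAddChar s * l a := sub_eq_zero.1 h0
    have h2 : (ZMod.stdAddChar s : ℂ) ^ m = 1 := by
      rw [← AddChar.map_nsmul_eq_pow, nsmul_eq_mul, CharP.cast_eq_zero, zero_mul,
        AddChar.map_zero_eq_one]
    have h3 : l k ^ m = l a ^ m := by rw [h1, mul_pow, h2, one_mul]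
    have h4 : k = a := by
      by_contra hne; exact hl.2 k a hne h3
    subst h4
    have h5 : (ZMod.stdAddChar s : ℂ) = 1 := by
      have : (ZMod.stdAddChar s : ℂ) * l k = 1 * l k := by rw [← h1, one_mul]
      exact mul_right_cancel₀ (hl.1 k) this
    have h6 : s = 0 := ZMod.injective_stdAddChar (by rw [h5, AddChar.map_zero_eq_one])
    exact hs.1 (by rw [h6])
  have hC : q.polyC.eval (l k) = c * ((m : ℂ)⁻¹ * ∑ i, (q.v i * q.w i * q.X (i - 1)) k k) := by
    have h1 : q.polyC.eval (l k) = (q.bigX * (Matrix.scalar _ (l k) - q.bigP).adjugate *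
        (q.bigV * q.bigW)).trace := by
      rw [Quad.polyC]
      change Polynomial.evalRingHom (l k) _ = _
      rw [AddMonoidHom.map_trace]
      congr 1
      rw [← RingHom.mapMatrix_apply]
      rw [map_mul, map_mul, RingHom.map_adjugate]
      congr 1
      · congr 1
        · ext i j; simp
        · congr 1
          ext i j
          simp only [Matrix.charmatrix, RingHom.mapMatrix_apply, Matrix.map_apply,
            Matrix.sub_apply, Matrix.scalar_apply, Matrix.diagonal_apply]
          split_ifs <;> simp
      · ext i j; exact Polynomial.eval_C
    rw [h1, hadj, Matrix.mul_smul, Matrix.smul_mul, Matrix.trace_smul, smul_eq_mul]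
    congr 1
    rw [Matrix.trace_mul_comm, ← Matrix.mul_assoc, Quad.bigV_mul_bigW, Quad.bigX_eq, blk_mul,
      Matrix.mul_vecMulVec, Matrix.trace_vecMulVec]
    simp only [dotProduct, Matrix.mulVec, fourierBasis, fourierBasisInv, Matrix.of_apply,
      Fintype.sum_prod_type, blk_apply, mul_zero, AddChar.map_zero_eq_one, zero_mul, neg_zero,
      mul_one, mul_ite, Finset.sum_ite_eq, Finset.sum_ite_eq', Finset.mem_univ, if_true,
      zero_add, sub_eq_add_neg, add_zero, Finset.mul_sum]
    refine Finset.sum_congr rfl fun i _ => mul_comm _ _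
  rw [Quad.sklyanin, ratFunc_eval_div, Polynomial.eval_mul, Polynomial.eval_C, Quad.polyA, ← hc, hC]
  · have hm : (m : ℂ) ≠ 0 := Nat.cast_ne_zero.2 (NeZero.ne m)
    field_simp
  · rw [Polynomial.eval_mul, Polynomial.eval_C, Quad.polyA, ← hc]
    exact mul_ne_zero hg hc0

end Theta

/-! ### Canonical conjugacy in the spinless case -/

section SpinlessBracket

variable {m n : ℕ} [NeZero m]

theorem isOpen_regularSpectrum (m n : ℕ) : IsOpen (regularSpectrum m n) := by
  have h : regularSpectrum m n = (⋂ j, {l | l j ≠ 0}) ∩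
      ⋂ j, ⋂ k, ⋂ (_ : j ≠ k), {l | l j ^ m ≠ l k ^ m} := by
    ext l
    simp [regularSpectrum]
  rw [h]
  refine (isOpen_iInter_of_finite fun j => ?_).inter
    (isOpen_iInter_of_finite fun j => isOpen_iInter_of_finite fun k =>
      isOpen_iInter_of_finite fun _ => ?_)
  · exact isOpen_ne_fun (by fun_prop) (by fun_prop)
  · exact isOpen_ne_fun (by fun_prop) (by fun_prop)

/-- The part of `θ_k` that depends on the `λ_j` only. -/
noncomputable def thetaPot (g : ZMod m → ℂ) (k : Fin n) (l : Fin n → ℂ) : ℂ :=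
  (m : ℂ)⁻¹ * (cShift g (-1) * (l k)⁻¹ -
    (∑ r, g r) * ∑ a ∈ Finset.univ.erase k, l k ^ (m - 1) * (l a ^ m - l k ^ m)⁻¹)

theorem val_neg_one : (-1 : ZMod m).val = m - 1 := by
  rcases val_add_one_cases (-1 : ZMod m) with h | ⟨_, h⟩
  · rw [neg_add_cancel, ZMod.val_zero] at h; omega
  · omega

/-- Only `v_0 w_0` is nonzero, so only the column `k` of `X_{-1} = X_{m-1}` enters; for this index
the exponent `m - i - 1` of `λ_j` is `0`. -/
theorem theta_eq {g : ZMod m → ℂ} (hg : ∑ i, g i ≠ 0) (k : Fin n) {y : Coord n}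
    (hy : y ∈ coordDomain m n) : theta g k y = y.2 k / (m : ℂ) + thetaPot g k y.1 := by
  have hm : (m : ℂ) ≠ 0 := Nat.cast_ne_zero.2 (NeZero.ne m)
  rw [theta, sklyanin_eval hg (l := y.1) hy (fun _ => rfl)]
  have h1 : ∑ i, ((spinlessQuad g y).v i * (spinlessQuad g y).w i *
      (spinlessQuad g y).X (i - 1)) k k = (∑ r, g r) * ∑ a, (spinlessQuad g y).X (-1) a k := by
    simp only [Matrix.mul_apply (N := (spinlessQuad g y).X _), spinlessQuad_mul_apply, ite_mul,
      zero_mul]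
    rw [Finset.sum_comm, Finset.mul_sum]
    refine Finset.sum_congr rfl fun a _ => ?_
    simp
  rw [h1, ← Finset.add_sum_erase _ _ (Finset.mem_univ k)]
  have h2 : ∑ a ∈ Finset.univ.erase k, (spinlessQuad g y).X (-1) a k =
      -((∑ r, g r) * ∑ a ∈ Finset.univ.erase k,
        y.1 k ^ (m - 1) * (y.1 a ^ m - y.1 k ^ m)⁻¹) := by
    rw [Finset.mul_sum, ← Finset.sum_neg_distrib]
    refine Finset.sum_congr rfl fun a ha => ?_
    have : a ≠ k := (Finset.mem_erase.1 ha).1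
    simp only [spinlessQuad, Matrix.of_apply, this, if_false, val_neg_one]
    rw [show m - (m - 1) - 1 = 0 by omega, pow_zero]
    ring
  rw [h2]
  simp only [spinlessQuad, Matrix.of_apply, if_true, thetaPot]
  field_simp
  ring

theorem differentiableAt_thetaPot (g : ZMod m → ℂ) (k : Fin n) {l : Fin n → ℂ}
    (hl : l ∈ regularSpectrum m n) : DifferentiableAt ℂ (thetaPot g k) l := by
  unfold thetaPot
  refine DifferentiableAt.const_mul (DifferentiableAt.sub (DifferentiableAt.const_mul ?_ _)
    (DifferentiableAt.const_mul (DifferentiableAt.fun_sum fun a ha => ?_) _)) _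
  · exact DifferentiableAt.inv (by fun_prop) (hl.1 k)
  · refine DifferentiableAt.mul (by fun_prop) (DifferentiableAt.inv (by fun_prop) ?_)
    exact sub_ne_zero.2 (hl.2 a k (Finset.mem_erase.1 ha).1)

/-- Differentiating `(λ_k^m - λ_j^m)⁻¹` brings in the factor `λ_k^{m-1}` that complements the
`λ_j^{m-1}` already present. The result is visibly symmetric in `j` and `k`, which is all that is
needed for `{θ_j, θ_k} = 0`. -/
theorem fderiv_thetaPot (g : ZMod m → ℂ) {j k : Fin n} (hjk : j ≠ k) {l : Fin n → ℂ}
    (hl : l ∈ regularSpectrum m n) :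
    fderiv ℂ (thetaPot g j) l (Pi.single k 1) =
      (∑ r, g r) * (l j * l k) ^ (m - 1) / (l k ^ m - l j ^ m) ^ 2 := by
  rw [← (differentiableAt_thetaPot g j hl).lineDeriv_eq_fderiv]
  refine HasLineDerivAt.lineDeriv ?_
  have hm : (m : ℂ) ≠ 0 := Nat.cast_ne_zero.2 (NeZero.ne m)
  have hne : ∀ (t : ℂ) (a : Fin n), a ≠ k → (l + t • (Pi.single k 1 : Fin n → ℂ)) a = l a := by
    intro t a ha; simp [ha]
  have hk : ∀ t : ℂ, (l + t • (Pi.single k 1 : Fin n → ℂ)) k = l k + t := by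
    intro t; simp
  have hfun : (fun t : ℂ => thetaPot g j (l + t • (Pi.single k 1 : Fin n → ℂ))) = fun t =>
      (m : ℂ)⁻¹ * (cShift g (-1) * (l j)⁻¹ - (∑ r, g r) *
        (l j ^ (m - 1) * ((l k + t) ^ m - l j ^ m)⁻¹ +
        ∑ a ∈ (Finset.univ.erase j).erase k, l j ^ (m - 1) * (l a ^ m - l j ^ m)⁻¹)) := by
    ext t
    rw [thetaPot, hne t j hjk, ← Finset.add_sum_erase (Finset.univ.erase j) _
      (Finset.mem_erase.2 ⟨hjk.symm, Finset.mem_univ k⟩), hk]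
    congr 4
    refine Finset.sum_congr rfl fun a ha => ?_
    rw [hne t a (Finset.mem_erase.1 ha).1]
  rw [HasLineDerivAt, hfun]
  have hD : l k ^ m - l j ^ m ≠ 0 := sub_ne_zero.2 (hl.2 k j hjk.symm)
  have h1 : HasDerivAt (fun t : ℂ => (l k + t) ^ m - l j ^ m) (m * (l k) ^ (m - 1)) 0 := by
    have := (((hasDerivAt_id (0 : ℂ)).const_add (l k)).pow m).sub_const (l j ^ m)
    simpa using this
  have h2 := ((((h1.inv (by simpa using hD)).const_mul (l j ^ (m - 1))).add_const
    (∑ a ∈ (Finset.univ.erase j).erase k, l j ^ (m - 1) * (l a ^ m - l j ^ m)⁻¹)).const_mul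
    (∑ r, g r)).const_sub (cShift g (-1) * (l j)⁻¹) |>.const_mul (m : ℂ)⁻¹
  have h3 : (∑ r, g r) * (l j * l k) ^ (m - 1) / (l k ^ m - l j ^ m) ^ 2 = (m : ℂ)⁻¹ * -((∑ r, g r) *
      (l j ^ (m - 1) * (-(m * l k ^ (m - 1)) / ((l k + 0) ^ m - l j ^ m) ^ 2))) := by
    simp only [add_zero, mul_pow]
    field_simp
  rw [h3]
  exact h2

theorem fderiv_thetaPot_symm (g : ZMod m → ℂ) (j k : Fin n) {l : Fin n → ℂ}
    (hl : l ∈ regularSpectrum m n) :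
    fderiv ℂ (thetaPot g j) l (Pi.single k 1) = fderiv ℂ (thetaPot g k) l (Pi.single j 1) := by
  by_cases hjk : j = k
  · rw [hjk]
  · rw [fderiv_thetaPot g hjk hl, fderiv_thetaPot g (Ne.symm hjk) hl, mul_comm (l j),
      ← neg_sub (l k ^ m), neg_sq]

theorem hasFDerivAt_theta {g : ZMod m → ℂ} (hg : ∑ i, g i ≠ 0) (k : Fin n) {y : Coord n}
    (hy : y ∈ coordDomain m n) :
    HasFDerivAt (theta g k) ((m : ℂ)⁻¹ • (ContinuousLinearMap.proj k ∘L
      ContinuousLinearMap.snd ℂ (Fin n → ℂ) (Fin n → ℂ)) +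
      fderiv ℂ (thetaPot g k) y.1 ∘L ContinuousLinearMap.fst ℂ (Fin n → ℂ) (Fin n → ℂ)) y := by
  have h1 : HasFDerivAt (fun y : Coord n => y.2 k / (m : ℂ) + thetaPot g k y.1) ((m : ℂ)⁻¹ •
      (ContinuousLinearMap.proj k ∘L ContinuousLinearMap.snd ℂ (Fin n → ℂ) (Fin n → ℂ)) +
      fderiv ℂ (thetaPot g k) y.1 ∘L ContinuousLinearMap.fst ℂ (Fin n → ℂ) (Fin n → ℂ)) y := by
    refine HasFDerivAt.add ?_ ?_
    · simp only [div_eq_inv_mul]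
      exact (ContinuousLinearMap.hasFDerivAt (ContinuousLinearMap.proj k ∘L
        ContinuousLinearMap.snd ℂ (Fin n → ℂ) (Fin n → ℂ))).const_mul ((m : ℂ)⁻¹)
    · exact ((differentiableAt_thetaPot g k hy).hasFDerivAt).comp y hasFDerivAt_fst
  refine h1.congr_of_eventuallyEq ?_
  have hopen : IsOpen (coordDomain m n) := (isOpen_regularSpectrum m n).preimage continuous_fst
  filter_upwards [hopen.mem_nhds hy] with z hz
  exact theta_eq hg k hz

theorem dPhi_theta {g : ZMod m → ℂ} (hg : ∑ i, g i ≠ 0) (k j : Fin n) {y : Coord n}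
    (hy : y ∈ coordDomain m n) : dPhi (theta g k) j y = if j = k then (m : ℂ)⁻¹ else 0 := by
  rw [dPhi, (hasFDerivAt_theta hg k hy).fderiv]
  simp [Pi.single_apply, eq_comm]

theorem dLam_theta {g : ZMod m → ℂ} (hg : ∑ i, g i ≠ 0) (k j : Fin n) {y : Coord n}
    (hy : y ∈ coordDomain m n) :
    dLam (theta g k) j y = fderiv ℂ (thetaPot g k) y.1 (Pi.single j 1) := by
  rw [dLam, (hasFDerivAt_theta hg k hy).fderiv]
  simp

theorem poisson_lambda_theta {g : ZMod m → ℂ} (hg : ∑ i, g i ≠ 0) (j k : Fin n) {y : Coord n}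
    (hy : y ∈ coordDomain m n) :
    poisson m (fun y' : Coord n => y'.1 j) (theta g k) y = if j = k then 1 else 0 := by
  have hm : (m : ℂ) ≠ 0 := Nat.cast_ne_zero.2 (NeZero.ne m)
  have hd : fderiv ℂ (fun y' : Coord n => y'.1 j) y = ContinuousLinearMap.proj j ∘L
      ContinuousLinearMap.fst ℂ (Fin n → ℂ) (Fin n → ℂ) :=
    ContinuousLinearMap.fderiv ((ContinuousLinearMap.proj j : (Fin n → ℂ) →L[ℂ] ℂ) ∘L
      ContinuousLinearMap.fst ℂ (Fin n → ℂ) (Fin n → ℂ))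
  have h1 : ∀ i, dLam (fun y' : Coord n => y'.1 j) i y = if i = j then 1 else 0 := by
    intro i
    rw [dLam, hd]
    simp [Pi.single_apply, eq_comm]
  have h2 : ∀ i, dPhi (fun y' : Coord n => y'.1 j) i y = 0 := by
    intro i
    rw [dPhi, hd]
    simp
  simp only [poisson, h1, h2, dPhi_theta hg k _ hy, zero_mul, sub_zero, ite_mul, one_mul]
  simp [hm]

theorem poisson_theta_theta {g : ZMod m → ℂ} (hg : ∑ i, g i ≠ 0) (j k : Fin n) {y : Coord n}
    (hy : y ∈ coordDomain m n) : poisson m (theta g j) (theta g k) y = 0 := by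
  simp only [poisson, dPhi_theta hg _ _ hy, dLam_theta hg _ _ hy, mul_ite, mul_zero, ite_mul,
    zero_mul, Finset.sum_sub_distrib, Finset.sum_ite_eq', Finset.mem_univ, if_true]
  rw [fderiv_thetaPot_symm g j k hy]
  ring

end SpinlessBracket

/-! ### The `ℤ/m`-graded trigonometric `r`-matrix -/

section RMatrix

variable {m : ℕ} [NeZero m]

/-- The representative of `c` in `{1, …, m}`. -/
def posRep (c : ZMod m) : ℕ := (c - 1).val + 1

theorem posRep_pos (c : ZMod m) : 1 ≤ posRep c := by simp [posRep]

theorem posRep_le (c : ZMod m) : posRep c ≤ m := ZMod.val_lt (c - 1)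

theorem cast_posRep (c : ZMod m) : ((posRep c : ℕ) : ZMod m) = c := by simp [posRep]

theorem posRep_eq {c : ZMod m} {r : ℕ} (h1 : 1 ≤ r) (h2 : r ≤ m) (h : (r : ZMod m) = c) :
    posRep c = r := by
  obtain ⟨s, rfl⟩ : ∃ s, r = s + 1 := ⟨r - 1, by omega⟩
  rw [posRep, ← h]
  push_cast
  rw [add_sub_cancel_right, ZMod.val_cast_of_lt (by omega)]

/-- Addition of representatives without and with a carry; the two cases give two different forms of
the Yang-Baxter computation. -/
theorem posRep_add_cases (c e : ZMod m) :
    posRep (c + e) = posRep c + posRep e ∧ posRep c + posRep e ≤ m ∨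
      posRep (c + e) + m = posRep c + posRep e := by
  have hc := posRep_pos c
  have hc' := posRep_le c
  have he := posRep_pos e
  have he' := posRep_le e
  rcases Nat.lt_or_ge m (posRep c + posRep e) with h | h
  · right
    rw [posRep_eq (r := posRep c + posRep e - m) (by omega) (by omega)]
    · omega
    · rw [Nat.cast_sub (by omega)]
      push_cast
      rw [cast_posRep, cast_posRep, CharP.cast_eq_zero, sub_zero]
  · left
    refine ⟨posRep_eq (by omega) h ?_, h⟩
    push_cast
    rw [cast_posRep, cast_posRep]

theorem posRep_zero : posRep (0 : ZMod m) = m := posRep_eq (NeZero.pos m) le_rfl (by simp)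

theorem posRep_neg {c : ZMod m} (hc : c ≠ 0) : posRep (-c) + posRep c = m := by
  have h1 := posRep_pos c
  have h2 := posRep_le c
  have h3 : posRep c ≠ m := by
    intro h; apply hc; rw [← cast_posRep c, h, CharP.cast_eq_zero]
  rw [posRep_eq (r := m - posRep c) (by omega) (by omega)]
  · omega
  · rw [Nat.cast_sub h2, cast_posRep, CharP.cast_eq_zero, zero_sub]

/-- The coefficients of the `ℤ/m`-graded trigonometric `r`-matrix. -/
noncomputable def rCoeff (c : ZMod m) (x y : ℂ) : ℂ :=
  x ^ (m - posRep c) * y ^ posRep c / (x ^ m - y ^ m)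

/-- After the common monomial is extracted, the three numerators are `y^m, z^m, x^m` if the
representatives add without carry, and `1, 1, 1` otherwise. Both identities are partial fractions in
the `m`-th powers. -/
theorem rCoeff_yangBaxter (c e : ZMod m) {x y z : ℂ} (hxy : x ^ m ≠ y ^ m) (hxz : x ^ m ≠ z ^ m)
    (hyz : y ^ m ≠ z ^ m) :
    rCoeff c y z * rCoeff (c + e) x y + rCoeff (c + e) x z * rCoeff e z y =
      rCoeff c x z * rCoeff e x y := by
  have h1 := sub_ne_zero.2 hxy
  have h2 := sub_ne_zero.2 hxz
  have h3 := sub_ne_zero.2 hyz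
  have h4 := sub_ne_zero.2 hyz.symm
  have hr := posRep_le c
  have hs := posRep_le e
  simp only [rCoeff]
  have hcomb : ∀ A B C K : ℂ, A = K * y ^ m → B = K * z ^ m → C = K * x ^ m →
      A / ((y ^ m - z ^ m) * (x ^ m - y ^ m)) + B / ((x ^ m - z ^ m) * (z ^ m - y ^ m)) =
        C / ((x ^ m - z ^ m) * (x ^ m - y ^ m)) := by
    intro A B C K hA hB hC
    rw [hA, hB, hC, div_add_div _ _ (mul_ne_zero h3 h1) (mul_ne_zero h2 h4),
      div_eq_div_iff (mul_ne_zero (mul_ne_zero h3 h1) (mul_ne_zero h2 h4)) (mul_ne_zero h2 h1)]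
    ring
  have hcomb' : ∀ A B C K : ℂ, A = K → B = K → C = K →
      A / ((y ^ m - z ^ m) * (x ^ m - y ^ m)) + B / ((x ^ m - z ^ m) * (z ^ m - y ^ m)) =
        C / ((x ^ m - z ^ m) * (x ^ m - y ^ m)) := by
    intro A B C K hA hB hC
    rw [hA, hB, hC, div_add_div _ _ (mul_ne_zero h3 h1) (mul_ne_zero h2 h4),
      div_eq_div_iff (mul_ne_zero (mul_ne_zero h3 h1) (mul_ne_zero h2 h4)) (mul_ne_zero h2 h1)]
    ring
  rw [div_mul_div_comm, div_mul_div_comm, div_mul_div_comm]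
  rcases posRep_add_cases c e with ⟨ht, hle⟩ | ht
  · rw [ht]
    generalize posRep c = r at *
    generalize posRep e = s at *
    obtain ⟨f, hf⟩ : ∃ f, m = r + s + f := ⟨m - (r + s), by omega⟩
    refine hcomb _ _ _ (x ^ f * y ^ s * z ^ r) ?_ ?_ ?_
    · rw [show m - r = s + f by omega, show m - (r + s) = f by omega, hf]; ring
    · rw [show m - s = r + f by omega, show m - (r + s) = f by omega, hf]; ring
    · rw [show m - r = s + f by omega, show m - s = r + f by omega, hf]; ring
  · generalize posRep c = r at *
    generalize posRep e = s at *
    generalize posRep (c + e) = t at *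
    refine hcomb' _ _ _ (x ^ (m - t) * y ^ s * z ^ r) ?_ ?_ ?_
    · rw [show s = (m - r) + t by omega]; ring
    · rw [show r = t + (m - s) by omega]; ring
    · rw [show m - t = (m - r) + (m - s) by omega]; ring

/-- Antisymmetry fails only in degree `0`, since the representative of `0` is `m` on both sides. The
defect `1` there is what the self-interaction has to compensate in `spinBra_two_body`. -/
theorem rCoeff_swap (c : ZMod m) {x y : ℂ} (hxy : x ^ m ≠ y ^ m) :
    rCoeff c x y = -rCoeff (-c) y x - if c = 0 then 1 else 0 := by
  have h1 := sub_ne_zero.2 hxy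
  have h2 := sub_ne_zero.2 hxy.symm
  simp only [rCoeff]
  rw [← neg_sub (x ^ m) (y ^ m), div_neg, neg_neg]
  split_ifs with hc
  · subst hc
    rw [neg_zero, posRep_zero, Nat.sub_self, pow_zero, pow_zero, one_mul, one_mul, eq_sub_iff_add_eq,
      ← div_self h1, ← add_div]
    congr 1; ring
  · have h := posRep_neg hc
    rw [sub_zero, show m - posRep c = posRep (-c) by omega,
      show m - posRep (-c) = posRep c by omega, mul_comm]

/-- `∂R_c/∂x`. -/
noncomputable def rCoeffDeriv (c : ZMod m) (x y : ℂ) : ℂ :=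
  ((m - posRep c : ℕ) * x ^ (m - posRep c - 1) * y ^ posRep c * (x ^ m - y ^ m) -
    x ^ (m - posRep c) * y ^ posRep c * (m * x ^ (m - 1))) / (x ^ m - y ^ m) ^ 2

theorem mul_rCoeffDeriv (c : ZMod m) (x y : ℂ) : x * rCoeffDeriv c x y =
    -(x ^ (m - posRep c) * y ^ posRep c *
      (posRep c * x ^ m + (m - posRep c : ℕ) * y ^ m)) / (x ^ m - y ^ m) ^ 2 := by
  rw [rCoeffDeriv, mul_div_assoc']
  congr 1
  have h1 : x ^ m = x * x ^ (m - 1) := by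
    rw [← pow_succ', Nat.sub_add_cancel (NeZero.pos m)]
  have h2 : ((m - posRep c : ℕ) : ℂ) * x ^ (m - posRep c) =
      (m - posRep c : ℕ) * (x * x ^ (m - posRep c - 1)) := by
    rcases Nat.eq_zero_or_pos (m - posRep c) with h | h
    · rw [h]; simp
    · rw [← pow_succ', Nat.sub_add_cancel h]
  have h3 : ((m - posRep c : ℕ) : ℂ) = m - posRep c := Nat.cast_sub (posRep_le c)
  calc _ = ((m - posRep c : ℕ) * (x * x ^ (m - posRep c - 1))) * y ^ posRep c * (x ^ m - y ^ m) -
      x ^ (m - posRep c) * y ^ posRep c * (m * (x * x ^ (m - 1))) := by ring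
    _ = _ := by rw [← h1, ← h2, h3]; ring

/-- The symmetry that makes the `λ`-derivatives of the pair interactions of two particles cancel in
`{θ_j, θ_k}`. -/
theorem mul_rCoeffDeriv_symm (c : ZMod m) (x y : ℂ) :
    x * rCoeffDeriv c x y = y * rCoeffDeriv (-c) y x := by
  rw [mul_rCoeffDeriv, mul_rCoeffDeriv, ← neg_sub (x ^ m), neg_sq]
  congr 2
  by_cases hc : c = 0
  · subst hc
    rw [neg_zero, posRep_zero]
    simp
    ring
  · have h := posRep_neg hc
    rw [show m - posRep c = posRep (-c) by omega, show m - posRep (-c) = posRep c by omega]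
    ring

theorem hasDerivAt_rCoeff_left (c : ZMod m) {x y : ℂ} (hxy : x ^ m ≠ y ^ m) :
    HasDerivAt (fun t => rCoeff c t y) (rCoeffDeriv c x y) x := by
  have h1 : HasDerivAt (fun t : ℂ => t ^ (m - posRep c) * y ^ posRep c)
      ((m - posRep c : ℕ) * x ^ (m - posRep c - 1) * y ^ posRep c) x :=
    (hasDerivAt_pow _ x).mul_const _
  have h2 : HasDerivAt (fun t : ℂ => t ^ m - y ^ m) (m * x ^ (m - 1)) x :=
    (hasDerivAt_pow _ x).sub_const _
  exact h1.div h2 (sub_ne_zero.2 hxy)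

/-- The matrix of the linear map `u ↦ cShift u`. -/
noncomputable def cCoeff (i r : ZMod m) : ℂ :=
  (if r.val ≤ i.val then 1 else 0) - ((m : ℂ) - r.val) / m

theorem cShift_eq_sum (u : ZMod m → ℂ) (i : ZMod m) : cShift u i = ∑ r, cCoeff i r * u r := by
  simp only [cShift, cCoeff, sub_mul, Finset.sum_sub_distrib, Finset.sum_filter, ite_mul, one_mul,
    zero_mul]

theorem ite_val_le_val_sub_one (i r : ZMod m) :
    (if r.val ≤ (i - 1).val then (1 : ℂ) else 0) =
      (if r.val < i.val then 1 else 0) + if i = 0 then 1 else 0 := by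
  obtain ⟨j, rfl⟩ : ∃ j, i = j + 1 := ⟨i - 1, by ring⟩
  rw [add_sub_cancel_right]
  rcases val_add_one_cases j with h | ⟨h, h'⟩
  · have hne : j + 1 ≠ 0 := by
      intro h0; rw [h0, ZMod.val_zero] at h; omega
    rw [if_neg hne, h, add_zero]
    simp only [Nat.lt_succ_iff]
  · have h0 : j + 1 = 0 := (ZMod.val_eq_zero _).1 h
    have := ZMod.val_lt r
    rw [if_pos h0, h, if_pos (by omega), if_neg (by omega), zero_add]

/-- Up to terms that depend on `i` alone or on `r` alone, the symmetrized matrix is minus the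
identity. Those terms become harmless once the total weights of two particles agree. -/
theorem cCoeff_symm (i r : ZMod m) : cCoeff (i - 1) r + cCoeff (r - 1) i =
    1 - (if r = i then 1 else 0) + (if i = 0 then 1 else 0) + (if r = 0 then 1 else 0) -
      ((m : ℂ) - r.val) / m - ((m : ℂ) - i.val) / m := by
  simp only [cCoeff, ite_val_le_val_sub_one]
  have h : (if r.val < i.val then (1 : ℂ) else 0) + (if i.val < r.val then 1 else 0) =
      1 - if r = i then 1 else 0 := by
    simp only [← (ZMod.val_injective m).eq_iff (a := r)]
    split_ifs <;> first | omega | norm_num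
  linear_combination h

end RMatrix

/-! ### The spin bracket as a bilinear form on differentials -/

section CotangentBracket

variable {m n d : ℕ} [NeZero m]

/-- The functional `dλ_j`. -/
noncomputable def covLam (m d : ℕ) (j : Fin n) : SpinCoord m n d →L[ℂ] ℂ :=
  ContinuousLinearMap.proj j ∘L ContinuousLinearMap.fst ℂ _ _

/-- The functional `dφ_j`. -/
noncomputable def covPhi (m d : ℕ) (j : Fin n) : SpinCoord m n d →L[ℂ] ℂ :=
  ContinuousLinearMap.proj j ∘L ContinuousLinearMap.fst ℂ _ _ ∘L ContinuousLinearMap.snd ℂ _ _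

/-- The functional `d[v_i]_{jα}`. -/
noncomputable def covV (i : ZMod m) (j : Fin n) (α : Fin d) : SpinCoord m n d →L[ℂ] ℂ :=
  ContinuousLinearMap.proj (R := ℂ) (φ := fun _ : Fin d => ℂ) α ∘L
    ContinuousLinearMap.proj (R := ℂ) (φ := fun _ : Fin n => Fin d → ℂ) j ∘L
    ContinuousLinearMap.proj (R := ℂ) (φ := fun _ : ZMod m => Fin n → Fin d → ℂ) i ∘L
    ContinuousLinearMap.fst ℂ _ _ ∘L ContinuousLinearMap.snd ℂ _ _ ∘L ContinuousLinearMap.snd ℂ _ _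

/-- The functional `d[w_i]_{αj}`. -/
noncomputable def covW (i : ZMod m) (α : Fin d) (j : Fin n) : SpinCoord m n d →L[ℂ] ℂ :=
  ContinuousLinearMap.proj (R := ℂ) (φ := fun _ : Fin n => ℂ) j ∘L
    ContinuousLinearMap.proj (R := ℂ) (φ := fun _ : Fin d => Fin n → ℂ) α ∘L
    ContinuousLinearMap.proj (R := ℂ) (φ := fun _ : ZMod m => Fin d → Fin n → ℂ) i ∘L
    ContinuousLinearMap.snd ℂ _ _ ∘L ContinuousLinearMap.snd ℂ _ _ ∘L ContinuousLinearMap.snd ℂ _ _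

/-- The functional `d[v_i w_i]_{ab}` at `y`. -/
noncomputable def covU (y : SpinCoord m n d) (i : ZMod m) (a b : Fin n) :
    SpinCoord m n d →L[ℂ] ℂ :=
  ∑ α, (y.2.2.1 i a α • covW i α b + y.2.2.2 i α b • covV i a α)

theorem hasStrictFDerivAt_spinVW (y : SpinCoord m n d) (i : ZMod m) (a b : Fin n) :
    HasStrictFDerivAt (fun y : SpinCoord m n d => spinVW y i a b) (covU y i a b) y := by
  have h := HasStrictFDerivAt.fun_sum (u := Finset.univ) fun (α : Fin d) _ =>
    ((covV i a α).hasStrictFDerivAt (x := y)).mul ((covW i α b).hasStrictFDerivAt (x := y))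
  exact h

/-- The alternating form `ℓ, ℓ' ↦ ℓ(e) ℓ'(f) - ℓ(f) ℓ'(e)`. -/
noncomputable def wedgeEval (e f : SpinCoord m n d) :
    (SpinCoord m n d →L[ℂ] ℂ) →ₗ[ℂ] (SpinCoord m n d →L[ℂ] ℂ) →ₗ[ℂ] ℂ :=
  LinearMap.mk₂ ℂ (fun a b => a e * b f - a f * b e)
    (by intros; simp only [add_apply]; ring)
    (by intros; simp only [smul_apply, smul_eq_mul]; ring)
    (by intros; simp only [add_apply]; ring)
    (by intros; simp only [smul_apply, smul_eq_mul]; ring)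

/-- The Poisson bivector of the coordinate space of the spin case. -/
noncomputable def spinBra :
    (SpinCoord m n d →L[ℂ] ℂ) →ₗ[ℂ] (SpinCoord m n d →L[ℂ] ℂ) →ₗ[ℂ] ℂ :=
  ∑ j, ((m : ℂ) • wedgeEval (Pi.single j 1, 0, 0, 0) (0, Pi.single j 1, 0, 0) +
    ∑ i, ∑ α, wedgeEval (0, 0, 0, Pi.single i (Pi.single α (Pi.single j 1)))
      (0, 0, Pi.single i (Pi.single j (Pi.single α 1)), 0))

theorem spinBra_apply (a b : SpinCoord m n d →L[ℂ] ℂ) : spinBra a b =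
    ∑ j, ((m : ℂ) * (a (Pi.single j 1, 0, 0, 0) * b (0, Pi.single j 1, 0, 0) -
      a (0, Pi.single j 1, 0, 0) * b (Pi.single j 1, 0, 0, 0)) +
    ∑ i, ∑ α, (a (0, 0, 0, Pi.single i (Pi.single α (Pi.single j 1))) *
      b (0, 0, Pi.single i (Pi.single j (Pi.single α 1)), 0) -
      a (0, 0, Pi.single i (Pi.single j (Pi.single α 1)), 0) *
      b (0, 0, 0, Pi.single i (Pi.single α (Pi.single j 1))))) := by
  simp [spinBra, wedgeEval, LinearMap.sum_apply]

theorem spinPoisson_eq (F H : SpinCoord m n d → ℂ) (y : SpinCoord m n d) :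
    spinPoisson F H y = spinBra (fderiv ℂ F y) (fderiv ℂ H y) := by
  rw [spinBra_apply]; rfl

theorem spinBra_swap (a b : SpinCoord m n d →L[ℂ] ℂ) : spinBra a b = -spinBra b a := by
  rw [spinBra_apply, spinBra_apply, ← Finset.sum_neg_distrib]
  refine Finset.sum_congr rfl fun j _ => ?_
  rw [neg_add, ← Finset.sum_neg_distrib]
  congr 1
  · ring
  · refine Finset.sum_congr rfl fun i _ => ?_
    rw [← Finset.sum_neg_distrib]
    exact Finset.sum_congr rfl fun α _ => by ring

theorem spinBra_covLam (j : Fin n) (b : SpinCoord m n d →L[ℂ] ℂ) :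
    spinBra (covLam m d j) b = m * b (0, Pi.single j 1, 0, 0) := by
  rw [spinBra_apply]
  simp [covLam, Pi.single_apply]

theorem spinBra_covPhi (j : Fin n) (b : SpinCoord m n d →L[ℂ] ℂ) :
    spinBra (covPhi m d j) b = -(m * b (Pi.single j 1, 0, 0, 0)) := by
  rw [spinBra_apply]
  simp [covPhi, Pi.single_apply]

theorem single_single_single_apply {A B C : Type*} [DecidableEq A] [DecidableEq B] [DecidableEq C]
    (a a' : A) (b b' : B) (c c' : C) :
    (Pi.single a (Pi.single b (Pi.single c (1 : ℂ)))  : A → B → C → ℂ) a' b' c' =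
      if a' = a then if b' = b then if c' = c then 1 else 0 else 0 else 0 := by
  by_cases ha : a' = a
  · subst ha
    by_cases hb : b' = b
    · subst hb; simp [Pi.single_apply]
    · simp [hb]
  · simp [ha]

theorem spinBra_covV (i : ZMod m) (j : Fin n) (α : Fin d) (b : SpinCoord m n d →L[ℂ] ℂ) :
    spinBra (covV i j α) b = -b (0, 0, 0, Pi.single i (Pi.single α (Pi.single j 1))) := by
  rw [spinBra_apply]
  have h : ∀ (i' : ZMod m) (j' : Fin n) (α' : Fin d), (covV i j α : SpinCoord m n d →L[ℂ] ℂ)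
      (0, 0, Pi.single i' (Pi.single j' (Pi.single α' 1)), 0) =
      if i = i' then if j = j' then if α = α' then 1 else 0 else 0 else 0 :=
    fun i' j' α' => single_single_single_apply i' i j' j α' α
  have h1 : ∀ x, (covV i j α : SpinCoord m n d →L[ℂ] ℂ) (x, 0, 0, 0) = 0 := fun x => rfl
  have h2 : ∀ x, (covV i j α : SpinCoord m n d →L[ℂ] ℂ) (0, x, 0, 0) = 0 := fun x => rfl
  have h3 : ∀ x, (covV i j α : SpinCoord m n d →L[ℂ] ℂ) (0, 0, 0, x) = 0 := fun x => rfl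
  simp only [h, h1, h2, h3, zero_mul, sub_zero, mul_zero, zero_sub, zero_add, ite_mul, one_mul,
    Finset.sum_neg_distrib]
  rw [Finset.sum_eq_single j, Finset.sum_eq_single i, Finset.sum_eq_single α]
  · simp
  · intro c _ hc; simp [hc.symm]
  · simp
  · intro c _ hc; simp [hc.symm]
  · simp
  · intro c _ hc; simp [hc.symm]
  · simp

theorem spinBra_covW (i : ZMod m) (α : Fin d) (j : Fin n) (b : SpinCoord m n d →L[ℂ] ℂ) :
    spinBra (covW i α j) b = b (0, 0, Pi.single i (Pi.single j (Pi.single α 1)), 0) := by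
  rw [spinBra_apply]
  have h : ∀ (i' : ZMod m) (j' : Fin n) (α' : Fin d), (covW i α j : SpinCoord m n d →L[ℂ] ℂ)
      (0, 0, 0, Pi.single i' (Pi.single α' (Pi.single j' 1))) =
      if i = i' then if α = α' then if j = j' then 1 else 0 else 0 else 0 :=
    fun i' j' α' => single_single_single_apply i' i α' α j' j
  have h1 : ∀ x, (covW i α j : SpinCoord m n d →L[ℂ] ℂ) (x, 0, 0, 0) = 0 := fun x => rfl
  have h2 : ∀ x, (covW i α j : SpinCoord m n d →L[ℂ] ℂ) (0, x, 0, 0) = 0 := fun x => rfl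
  have h3 : ∀ x, (covW i α j : SpinCoord m n d →L[ℂ] ℂ) (0, 0, x, 0) = 0 := fun x => rfl
  simp only [h, h1, h2, h3, zero_mul, sub_zero, mul_zero, zero_add, ite_mul, one_mul]
  rw [Finset.sum_eq_single j, Finset.sum_eq_single i, Finset.sum_eq_single α]
  · simp
  · intro c _ hc; simp [hc.symm]
  · simp
  · intro c _ hc; simp [hc.symm]
  · simp
  · intro c _ hc; simp [hc.symm]
  · simp

theorem covU_single_v (y : SpinCoord m n d) (i i' : ZMod m) (a b c : Fin n) (α : Fin d) :
    covU y i a b (0, 0, Pi.single i' (Pi.single c (Pi.single α 1)), 0) =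
      if i = i' then if a = c then y.2.2.2 i α b else 0 else 0 := by
  rw [covU, sum_apply]
  have h : ∀ β : Fin d, (y.2.2.1 i a β • covW i β b + y.2.2.2 i β b • covV i a β :
      SpinCoord m n d →L[ℂ] ℂ) (0, 0, Pi.single i' (Pi.single c (Pi.single α 1)), 0) =
      y.2.2.2 i β b * if i = i' then if a = c then if β = α then 1 else 0 else 0 else 0 := by
    intro β
    rw [← single_single_single_apply]
    change y.2.2.1 i a β * 0 + _ = _
    rw [mul_zero, zero_add]; rfl
  simp only [h]
  split_ifs <;> simp

theorem covU_single_w (y : SpinCoord m n d) (i i' : ZMod m) (a b c : Fin n) (α : Fin d) :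
    covU y i a b (0, 0, 0, Pi.single i' (Pi.single α (Pi.single c 1))) =
      if i = i' then if b = c then y.2.2.1 i a α else 0 else 0 := by
  rw [covU, sum_apply]
  have h : ∀ β : Fin d, (y.2.2.1 i a β • covW i β b + y.2.2.2 i β b • covV i a β :
      SpinCoord m n d →L[ℂ] ℂ) (0, 0, 0, Pi.single i' (Pi.single α (Pi.single c 1))) =
      y.2.2.1 i a β * if i = i' then if β = α then if b = c then 1 else 0 else 0 else 0 := by
    intro β
    rw [← single_single_single_apply]
    change _ + y.2.2.2 i β b * 0 = _
    rw [mul_zero, add_zero]; rfl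
  simp only [h]
  split_ifs <;> simp

/-- The relations of `gl_n`, one commuting copy for each vertex: the entries of `v_i w_i` are the
moment map of the action of `GL_n` on the pairs `(v_i, w_i)`. -/
theorem spinBra_covU_covU (y : SpinCoord m n d) (i i' : ZMod m) (a b c e : Fin n) :
    spinBra (covU y i a b) (covU y i' c e) = if i = i' then
      (if b = c then spinVW y i a e else 0) - (if a = e then spinVW y i c b else 0) else 0 := by
  have h : spinBra (covU y i a b) (covU y i' c e) =
      ∑ α, (y.2.2.1 i a α * (if i' = i then if c = b then y.2.2.2 i' α e else 0 else 0) -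
        y.2.2.2 i α b * (if i' = i then if e = a then y.2.2.1 i' c α else 0 else 0)) := by
    rw [covU, map_sum, LinearMap.sum_apply]
    refine Finset.sum_congr rfl fun α _ => ?_
    rw [map_add, map_smul, map_smul, LinearMap.add_apply, LinearMap.smul_apply,
      LinearMap.smul_apply, spinBra_covV, spinBra_covW, covU_single_v, covU_single_w, smul_eq_mul,
      smul_eq_mul]
    ring
  rw [h]
  by_cases hi : i' = i
  · subst hi
    simp only [if_true, Finset.sum_sub_distrib, eq_comm (a := c), eq_comm (a := e)]
    congr 1
    · split_ifs <;> simp [spinVW]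
    · split_ifs <;> simp [spinVW, mul_comm]
  · simp [hi, Ne.symm hi]

theorem spinBra_covPhi_covU (y : SpinCoord m n d) (j : Fin n) (i : ZMod m) (a b : Fin n) :
    spinBra (covPhi m d j) (covU y i a b) = 0 := by
  rw [spinBra_covPhi]
  simp [covU, covV, covW]

theorem spinBra_covLam_covU (y : SpinCoord m n d) (j : Fin n) (i : ZMod m) (a b : Fin n) :
    spinBra (covLam m d j) (covU y i a b) = 0 := by
  rw [spinBra_covLam]
  simp [covU, covV, covW]

theorem spinBra_covLam_covLam (j k : Fin n) :
    spinBra (covLam m d j) (covLam m d k) = 0 := by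
  rw [spinBra_covLam]; simp [covLam]

theorem spinBra_covPhi_covPhi (j k : Fin n) :
    spinBra (covPhi m d j) (covPhi m d k) = 0 := by
  rw [spinBra_covPhi]; simp [covPhi]

theorem spinBra_covLam_covPhi (j k : Fin n) :
    spinBra (covLam m d j) (covPhi m d k) = if j = k then (m : ℂ) else 0 := by
  rw [spinBra_covLam]; simp [covPhi, Pi.single_apply, eq_comm]

end CotangentBracket

theorem sum_trilinear {ι : Type*} [Fintype ι] (f h : ι → ι → ℂ) (A B C : ι → ℂ) :
    ∑ i, (∑ p, f p i * A p) * (∑ q, h i q * B q) * C i =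
      ∑ p, ∑ q, ∑ r, f p r * h r q * (A p * B q * C r) := by
  have h1 : ∀ i, (∑ p, f p i * A p) * (∑ q, h i q * B q) * C i =
      ∑ p, ∑ q, f p i * h i q * (A p * B q * C i) := by
    intro i
    rw [Finset.sum_mul_sum, Finset.sum_mul]
    refine Finset.sum_congr rfl fun p _ => ?_
    rw [Finset.sum_mul]
    exact Finset.sum_congr rfl fun q _ => by ring
  simp only [h1]
  rw [Finset.sum_comm]
  exact Finset.sum_congr rfl fun p _ => Finset.sum_comm

theorem sum_sum_sum_rotate {ι : Type*} [Fintype ι] (F : ι → ι → ι → ℂ) :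
    ∑ p, ∑ q, ∑ r, F p q r = ∑ r, ∑ q, ∑ p, F p q r := by
  have h1 : ∀ p, ∑ q, ∑ r, F p q r = ∑ r, ∑ q, F p q r := fun p => Finset.sum_comm
  simp only [h1]
  rw [Finset.sum_comm]
  exact Finset.sum_congr rfl fun r _ => Finset.sum_comm

/-! ### Commutation of the Gaudin Hamiltonians -/

section Gaudin

variable {m n d : ℕ} [NeZero m]

/-- `∑_i f_i d[v_i w_i]_{ab}`. -/
noncomputable def covSum (y : SpinCoord m n d) (f : ZMod m → ℂ) (a b : Fin n) :
    SpinCoord m n d →L[ℂ] ℂ := ∑ i, f i • covU y i a b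

theorem spinBra_covSum (y : SpinCoord m n d) (f h : ZMod m → ℂ) (a b c e : Fin n) :
    spinBra (covSum y f a b) (covSum y h c e) =
      (if b = c then ∑ i, f i * h i * spinVW y i a e else 0) -
        if a = e then ∑ i, f i * h i * spinVW y i c b else 0 := by
  have h1 : spinBra (covSum y f a b) (covSum y h c e) = ∑ i, f i * h i *
      ((if b = c then spinVW y i a e else 0) - (if a = e then spinVW y i c b else 0)) := by
    simp only [covSum, map_sum, LinearMap.sum_apply, map_smul, LinearMap.smul_apply,
      spinBra_covU_covU, smul_eq_mul]
    refine Finset.sum_congr rfl fun i _ => ?_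
    rw [Finset.sum_eq_single i]
    · rw [if_pos rfl]; ring
    · intro k _ hk; rw [if_neg hk]; simp
    · simp
  rw [h1]
  simp only [mul_sub, Finset.sum_sub_distrib]
  congr 1 <;> split_ifs <;> simp

theorem spinBra_covPhi_covSum (y : SpinCoord m n d) (j : Fin n) (f : ZMod m → ℂ) (a b : Fin n) :
    spinBra (covPhi m d j) (covSum y f a b) = 0 := by
  simp [covSum, map_sum, spinBra_covPhi_covU]

theorem spinBra_covLam_covSum (y : SpinCoord m n d) (j : Fin n) (f : ZMod m → ℂ) (a b : Fin n) :
    spinBra (covLam m d j) (covSum y f a b) = 0 := by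
  simp [covSum, map_sum, spinBra_covLam_covU]

/-- The pair interaction of the particles `k` and `a`. -/
noncomputable def pairTerm (k a : Fin n) (y : SpinCoord m n d) : ℂ :=
  ∑ i, ∑ i', rCoeff (i - i') (y.1 a) (y.1 k) * (spinVW y i k a * spinVW y i' a k)

/-- `∂(pairTerm k a)/∂[v_i w_i]_{ka}`. -/
noncomputable def pairCoeffL (y : SpinCoord m n d) (k a : Fin n) (i : ZMod m) : ℂ :=
  ∑ q, rCoeff (i - q) (y.1 a) (y.1 k) * spinVW y q a k

/-- `∂(pairTerm k a)/∂[v_i w_i]_{ak}`. -/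
noncomputable def pairCoeffR (y : SpinCoord m n d) (k a : Fin n) (i : ZMod m) : ℂ :=
  ∑ p, rCoeff (p - i) (y.1 a) (y.1 k) * spinVW y p k a

/-- The differential of `pairTerm k a` in the spin variables. -/
noncomputable def pairCov (y : SpinCoord m n d) (k a : Fin n) : SpinCoord m n d →L[ℂ] ℂ :=
  covSum y (pairCoeffL y k a) k a + covSum y (pairCoeffR y k a) a k

/-- The self-interaction of the particle `k`. -/
noncomputable def selfTerm (g : ZMod m → ℂ) (k : Fin n) (y : SpinCoord m n d) : ℂ :=
  ∑ i, spinVW y i k k * (cShift g (i - 1) - cShift (fun r => spinVW y r k k) (i - 1))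

/-- `∂(selfTerm k)/∂[v_i w_i]_{kk}`. -/
noncomputable def selfCoeff (g : ZMod m → ℂ) (y : SpinCoord m n d) (k : Fin n) (i : ZMod m) : ℂ :=
  cShift g (i - 1) - ∑ r, (cCoeff (i - 1) r + cCoeff (r - 1) i) * spinVW y r k k

/-- The spin part of `λ_k θ_k`, up to the factor `m|g|`. -/
noncomputable def gaudin (g : ZMod m → ℂ) (k : Fin n) (y : SpinCoord m n d) : ℂ :=
  selfTerm g k y - ∑ a ∈ Finset.univ.erase k, pairTerm k a y

/-- The differential of `gaudin g k` in the spin variables. -/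
noncomputable def gaudinCov (g : ZMod m → ℂ) (y : SpinCoord m n d) (k : Fin n) :
    SpinCoord m n d →L[ℂ] ℂ :=
  covSum y (selfCoeff g y k) k k - ∑ a ∈ Finset.univ.erase k, pairCov y k a

/-- All three sums are rewritten over the monomials `[v_p w_p]_{ja} [v_q w_q]_{ak} [v_r w_r]_{kj}`,
and their coefficients then satisfy the Yang-Baxter equation with degrees `p - r` and `r - q`. -/
theorem gaudin_triple_first {y : SpinCoord m n d} (hy : y.1 ∈ regularSpectrum m n) {j k a : Fin n}
    (hjk : j ≠ k) (hja : j ≠ a) (hka : k ≠ a) :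
    ∑ i, pairCoeffL y j k i * pairCoeffL y k a i * spinVW y i j a +
      ∑ i, pairCoeffR y j a i * pairCoeffR y k j i * spinVW y i a k =
      ∑ i, pairCoeffR y j a i * pairCoeffL y k a i * spinVW y i k j := by
  have e1 : ∑ i, pairCoeffL y j k i * pairCoeffL y k a i * spinVW y i j a =
      ∑ p, ∑ q, ∑ r, rCoeff (p - r) (y.1 k) (y.1 j) * rCoeff (p - q) (y.1 a) (y.1 k) *
        (spinVW y p j a * spinVW y q a k * spinVW y r k j) := by
    simp only [pairCoeffL]
    rw [sum_trilinear (fun r i => rCoeff (i - r) (y.1 k) (y.1 j))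
      (fun i q => rCoeff (i - q) (y.1 a) (y.1 k)), sum_sum_sum_rotate]
    refine Finset.sum_congr rfl fun p _ => Finset.sum_congr rfl fun q _ =>
      Finset.sum_congr rfl fun r _ => by ring
  have e2 : ∑ i, pairCoeffR y j a i * pairCoeffR y k j i * spinVW y i a k =
      ∑ p, ∑ q, ∑ r, rCoeff (p - q) (y.1 a) (y.1 j) * rCoeff (r - q) (y.1 j) (y.1 k) *
        (spinVW y p j a * spinVW y q a k * spinVW y r k j) := by
    simp only [pairCoeffR]
    rw [sum_trilinear (fun p i => rCoeff (p - i) (y.1 a) (y.1 j))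
      (fun i r => rCoeff (r - i) (y.1 j) (y.1 k))]
    refine Finset.sum_congr rfl fun p _ => ?_
    rw [Finset.sum_comm]
    refine Finset.sum_congr rfl fun q _ => Finset.sum_congr rfl fun r _ => by ring
  have e3 : ∑ i, pairCoeffR y j a i * pairCoeffL y k a i * spinVW y i k j =
      ∑ p, ∑ q, ∑ r, rCoeff (p - r) (y.1 a) (y.1 j) * rCoeff (r - q) (y.1 a) (y.1 k) *
        (spinVW y p j a * spinVW y q a k * spinVW y r k j) := by
    simp only [pairCoeffR, pairCoeffL]
    rw [sum_trilinear (fun p i => rCoeff (p - i) (y.1 a) (y.1 j))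
      (fun i q => rCoeff (i - q) (y.1 a) (y.1 k))]
  rw [e1, e2, e3, ← Finset.sum_add_distrib]
  refine Finset.sum_congr rfl fun p _ => ?_
  rw [← Finset.sum_add_distrib]
  refine Finset.sum_congr rfl fun q _ => ?_
  rw [← Finset.sum_add_distrib]
  refine Finset.sum_congr rfl fun r _ => ?_
  have h := rCoeff_yangBaxter (p - r) (r - q) (hy.2 a k hka.symm) (hy.2 a j hja.symm)
    (hy.2 k j hjk.symm)
  rw [sub_add_sub_cancel] at h
  rw [← add_mul, h]

theorem gaudin_triple_second {y : SpinCoord m n d} (hy : y.1 ∈ regularSpectrum m n) {j k a : Fin n}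
    (hjk : j ≠ k) (hja : j ≠ a) (hka : k ≠ a) :
    ∑ i, pairCoeffR y j k i * pairCoeffR y k a i * spinVW y i a j +
      ∑ i, pairCoeffL y j a i * pairCoeffL y k j i * spinVW y i k a =
      ∑ i, pairCoeffL y j a i * pairCoeffR y k a i * spinVW y i j k := by
  have h := gaudin_triple_first hy hjk.symm hka hja
  simp only [mul_comm (pairCoeffL y j a _), mul_comm (pairCoeffR y j k _)]
  rw [add_comm]
  exact h

/-- The cubic terms come in the two cyclic orders of the particles `j, k, a`; `gaudin_triple_first`
and `gaudin_triple_second` treat one order each. -/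
theorem spinBra_pairCov_triple {y : SpinCoord m n d} (hy : y.1 ∈ regularSpectrum m n)
    {j k a : Fin n} (hjk : j ≠ k) (hja : j ≠ a) (hka : k ≠ a) :
    spinBra (pairCov y j k) (pairCov y k a) + spinBra (pairCov y j a) (pairCov y k j) +
      spinBra (pairCov y j a) (pairCov y k a) = 0 := by
  have h1 := gaudin_triple_first hy hjk hja hka
  have h2 := gaudin_triple_second hy hjk hja hka
  simp only [pairCov, map_add, LinearMap.add_apply, spinBra_covSum, hjk, hja, hka,
    hja.symm, hka.symm, if_true, if_false]
  linear_combination h1 - h2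

theorem spinBra_pairCov_disjoint (y : SpinCoord m n d) {j k a b : Fin n} (hjk : j ≠ k)
    (hjb : j ≠ b) (hak : a ≠ k) (hab : a ≠ b) : spinBra (pairCov y j a) (pairCov y k b) = 0 := by
  simp only [pairCov, map_add, LinearMap.add_apply, spinBra_covSum, hjk, hjb, hak, hab, if_false,
    sub_zero, add_zero]

theorem spinBra_self_pairCov_disjoint (y : SpinCoord m n d) (f : ZMod m → ℂ) {j k a : Fin n}
    (hjk : j ≠ k) (hja : j ≠ a) : spinBra (covSum y f j j) (pairCov y k a) = 0 := by
  simp only [pairCov, map_add, spinBra_covSum, hjk, hja, if_false, sub_zero, add_zero]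

theorem spinBra_self_self (y : SpinCoord m n d) (f h : ZMod m → ℂ) (j k : Fin n) :
    spinBra (covSum y f j j) (covSum y h k k) = 0 := by
  rw [spinBra_covSum]
  by_cases hjk : j = k
  · subst hjk; simp
  · simp [hjk]

/-- Both sides are the pair interaction itself, which is linear in the entries `jk` and in the
entries `kj`. It expresses invariance under the diagonal torus. -/
theorem pairCoeff_balance (y : SpinCoord m n d) (j k : Fin n) :
    ∑ i, pairCoeffL y j k i * spinVW y i j k = ∑ i, pairCoeffR y j k i * spinVW y i k j := by
  simp only [pairCoeffL, pairCoeffR, Finset.sum_mul]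
  rw [Finset.sum_comm]
  refine Finset.sum_congr rfl fun i _ => Finset.sum_congr rfl fun q _ => by ring

theorem pairCoeffL_swap {y : SpinCoord m n d} (hy : y.1 ∈ regularSpectrum m n) {j k : Fin n}
    (hjk : j ≠ k) (i : ZMod m) :
    pairCoeffL y k j i = -pairCoeffR y j k i - spinVW y i j k := by
  simp only [pairCoeffL, pairCoeffR]
  have h : ∀ q, rCoeff (i - q) (y.1 j) (y.1 k) * spinVW y q j k =
      -(rCoeff (q - i) (y.1 k) (y.1 j) * spinVW y q j k) - if i = q then spinVW y q j k else 0 := by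
    intro q
    rw [rCoeff_swap _ (hy.2 j k hjk), neg_sub]
    simp only [sub_eq_zero]
    split_ifs <;> ring
  simp only [h, Finset.sum_sub_distrib, Finset.sum_neg_distrib, Finset.sum_ite_eq, Finset.mem_univ,
    if_true]

theorem pairCoeffR_swap {y : SpinCoord m n d} (hy : y.1 ∈ regularSpectrum m n) {j k : Fin n}
    (hjk : j ≠ k) (i : ZMod m) :
    pairCoeffR y k j i = -pairCoeffL y j k i - spinVW y i k j := by
  simp only [pairCoeffL, pairCoeffR]
  have h : ∀ q, rCoeff (q - i) (y.1 j) (y.1 k) * spinVW y q k j =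
      -(rCoeff (i - q) (y.1 k) (y.1 j) * spinVW y q k j) - if q = i then spinVW y q k j else 0 := by
    intro q
    rw [rCoeff_swap _ (hy.2 j k hjk), neg_sub]
    simp only [sub_eq_zero]
    split_ifs <;> ring
  simp only [h, Finset.sum_sub_distrib, Finset.sum_neg_distrib, Finset.sum_ite_eq', Finset.mem_univ,
    if_true]

/-- By `cCoeff_symm` the gradient of the self-interaction at `i` is `[v_i w_i]_{xx}`, plus terms
depending on `i` only through `g` and the total weight, plus a constant. Equal total weights remove
the middle terms from the difference. -/
theorem selfCoeff_sub (g : ZMod m → ℂ) (y : SpinCoord m n d) {j k : Fin n}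
    (hN : ∑ i, spinVW y i j j = ∑ i, spinVW y i k k) :
    ∃ K : ℂ, ∀ i, selfCoeff g y j i - selfCoeff g y k i - (spinVW y i j j - spinVW y i k k) = K := by
  have h : ∀ (x : Fin n) i, selfCoeff g y x i = cShift g (i - 1) + spinVW y i x x -
      spinVW y 0 x x + ∑ r, ((m : ℂ) - r.val) / m * spinVW y r x x -
      (1 + (if i = 0 then 1 else 0) - ((m : ℂ) - i.val) / m) * ∑ r, spinVW y r x x := by
    intro x i
    rw [selfCoeff]
    have h1 : ∀ r, (cCoeff (i - 1) r + cCoeff (r - 1) i) * spinVW y r x x =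
        (1 + (if i = 0 then 1 else 0) - ((m : ℂ) - i.val) / m) * spinVW y r x x -
        (if r = i then spinVW y r x x else 0) + (if r = 0 then spinVW y r x x else 0) -
        ((m : ℂ) - r.val) / m * spinVW y r x x := by
      intro r
      rw [cCoeff_symm]
      split_ifs <;> ring
    simp only [h1, Finset.sum_sub_distrib, Finset.sum_add_distrib, ← Finset.mul_sum,
      Finset.sum_ite_eq', Finset.mem_univ, if_true]
    ring
  refine ⟨-spinVW y 0 j j + ∑ r, ((m : ℂ) - r.val) / m * spinVW y r j j + spinVW y 0 k k -
    ∑ r, ((m : ℂ) - r.val) / m * spinVW y r k k, fun i => ?_⟩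
  rw [h, h, hN]
  ring

/-- By the swap formulas the bracket is the sum over `i` of the imbalance in `pairCoeff_balance`
times the difference from `selfCoeff_sub`. The second factor is independent of `i`, so the sum
vanishes. -/
theorem spinBra_two_body {g : ZMod m → ℂ} {y : SpinCoord m n d} (hy : y.1 ∈ regularSpectrum m n)
    {j k : Fin n} (hjk : j ≠ k) (hN : ∑ i, spinVW y i j j = ∑ i, spinVW y i k k) :
    spinBra (covSum y (selfCoeff g y j) j j - pairCov y j k)
      (covSum y (selfCoeff g y k) k k - pairCov y k j) = 0 := by
  obtain ⟨K, hK⟩ := selfCoeff_sub g y hN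
  have hb := pairCoeff_balance y j k
  rw [LinearMap.map_sub₂, map_sub, map_sub, spinBra_self_self]
  simp only [pairCov, map_add, LinearMap.add_apply, spinBra_covSum, hjk, hjk.symm, if_true,
    if_false]
  simp only [zero_sub, sub_zero, add_zero, zero_add]
  have e : ∑ i, (pairCoeffL y j k i * spinVW y i j k - pairCoeffR y j k i * spinVW y i k j) *
      (selfCoeff g y j i - selfCoeff g y k i - (spinVW y i j j - spinVW y i k k)) = 0 := by
    simp only [hK, ← Finset.sum_mul, Finset.sum_sub_distrib, hb, sub_self, zero_mul]
  rw [← e]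
  simp only [pairCoeffL_swap hy hjk, pairCoeffR_swap hy hjk]
  simp only [← Finset.sum_neg_distrib, ← Finset.sum_sub_distrib, ← Finset.sum_add_distrib]
  refine Finset.sum_congr rfl fun i _ => by ring

/-- Separating the mutual interaction of `j` and `k` leaves the two-body bracket, one Yang-Baxter
triple for each third particle, and brackets of disjoint pairs. -/
theorem spinBra_gaudinCov {g : ZMod m → ℂ} {y : SpinCoord m n d} (hy : y.1 ∈ regularSpectrum m n)
    {j k : Fin n} (hjk : j ≠ k) (hN : ∑ i, spinVW y i j j = ∑ i, spinVW y i k k) :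
    spinBra (gaudinCov g y j) (gaudinCov g y k) = 0 := by
  have hj : gaudinCov g y j = (covSum y (selfCoeff g y j) j j - pairCov y j k) -
      ∑ a ∈ (Finset.univ.erase j).erase k, pairCov y j a := by
    rw [gaudinCov, ← Finset.add_sum_erase _ _ (Finset.mem_erase.2 ⟨hjk.symm, Finset.mem_univ k⟩),
      sub_sub]
  have hk : gaudinCov g y k = (covSum y (selfCoeff g y k) k k - pairCov y k j) -
      ∑ a ∈ (Finset.univ.erase j).erase k, pairCov y k a := by
    rw [gaudinCov, ← Finset.add_sum_erase _ _ (Finset.mem_erase.2 ⟨hjk, Finset.mem_univ j⟩),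
      sub_sub, Finset.erase_right_comm]
  have hmem : ∀ {a}, a ∈ (Finset.univ.erase j).erase k → j ≠ a ∧ k ≠ a := by
    intro a ha
    simp only [Finset.mem_erase, Finset.mem_univ, and_true] at ha
    exact ⟨Ne.symm ha.2, Ne.symm ha.1⟩
  have hsub : ∀ A B C D : SpinCoord m n d →L[ℂ] ℂ, spinBra (A - B) (C - D) =
      spinBra A C - spinBra A D - (spinBra B C - spinBra B D) := by
    intro A B C D
    rw [LinearMap.map_sub₂, map_sub, map_sub]
  rw [hj, hk, hsub, spinBra_two_body hy hjk hN]
  have e1 : spinBra (covSum y (selfCoeff g y j) j j - pairCov y j k)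
      (∑ a ∈ (Finset.univ.erase j).erase k, pairCov y k a) =
      -∑ a ∈ (Finset.univ.erase j).erase k, spinBra (pairCov y j k) (pairCov y k a) := by
    rw [map_sum, ← Finset.sum_neg_distrib]
    refine Finset.sum_congr rfl fun a ha => ?_
    rw [LinearMap.map_sub₂, spinBra_self_pairCov_disjoint y _ hjk (hmem ha).1, zero_sub]
  have e2 : spinBra (∑ a ∈ (Finset.univ.erase j).erase k, pairCov y j a)
      (covSum y (selfCoeff g y k) k k - pairCov y k j) =
      -∑ a ∈ (Finset.univ.erase j).erase k, spinBra (pairCov y j a) (pairCov y k j) := by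
    rw [map_sum, LinearMap.sum_apply, ← Finset.sum_neg_distrib]
    refine Finset.sum_congr rfl fun a ha => ?_
    rw [map_sub, spinBra_swap, spinBra_self_pairCov_disjoint y _ hjk.symm (hmem ha).2, neg_zero,
      zero_sub]
  have e3 : spinBra (∑ a ∈ (Finset.univ.erase j).erase k, pairCov y j a)
      (∑ a ∈ (Finset.univ.erase j).erase k, pairCov y k a) =
      ∑ a ∈ (Finset.univ.erase j).erase k, spinBra (pairCov y j a) (pairCov y k a) := by
    rw [LinearMap.map_sum₂]
    refine Finset.sum_congr rfl fun a ha => ?_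
    rw [map_sum, Finset.sum_eq_single a]
    · intro b hb hba
      exact spinBra_pairCov_disjoint y hjk (hmem hb).1 (hmem ha).2.symm hba.symm
    · intro h; exact absurd ha h
  rw [e1, e2, e3]
  have e4 := Finset.sum_eq_zero fun a (ha : a ∈ (Finset.univ.erase j).erase k) =>
    spinBra_pairCov_triple hy hjk (hmem ha).1 (hmem ha).2
  rw [Finset.sum_add_distrib, Finset.sum_add_distrib] at e4
  linear_combination e4

/-- `∑_i [v_i w_i]_{ll}` generates the torus action on the particle `l`, and the pair interaction
has weight `0`. -/
theorem spinBra_moment_pairCov (y : SpinCoord m n d) (l k a : Fin n) :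
    spinBra (covSum y 1 l l) (pairCov y k a) = 0 := by
  have hb := pairCoeff_balance y k a
  simp only [pairCov, map_add, spinBra_covSum, Pi.one_apply, one_mul]
  by_cases hk : l = k
  · subst hk
    by_cases ha : l = a
    · subst ha; simp
    · simp only [ha, if_true, if_false]
      linear_combination hb
  · by_cases ha : l = a
    · subst ha
      simp only [hk, if_true, if_false]
      linear_combination -hb
    · simp [hk, ha]

theorem spinBra_moment_gaudinCov (g : ZMod m → ℂ) (y : SpinCoord m n d) (l k : Fin n) :
    spinBra (covSum y 1 l l) (gaudinCov g y k) = 0 := by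
  rw [gaudinCov, map_sub, map_sum, spinBra_self_self]
  simp [spinBra_moment_pairCov]

end Gaudin

/-- The implicit function parametrizes the fibre through `a` by the kernel of the differential, with
derivative the inclusion; the curve is the image of the line `t • δ`. -/
theorem exists_curve {E F : Type*} [NormedAddCommGroup E] [NormedSpace ℂ E] [CompleteSpace E]
    [NormedAddCommGroup F] [NormedSpace ℂ F] [FiniteDimensional ℂ F] {f : E → F} {f' : E →L[ℂ] F}
    {a δ : E} (hf : HasStrictFDerivAt f f' a) (hsurj : Function.Surjective f') (hδ : f' δ = 0) :
    ∃ γ : ℂ → E, γ 0 = a ∧ HasDerivAt γ δ 0 ∧ ∀ᶠ t in 𝓝 0, f (γ t) = f a := by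
  have hf' : (f' : E →ₗ[ℂ] F).range = ⊤ := LinearMap.range_eq_top.2 hsurj
  let δ' : (f' : E →ₗ[ℂ] F).ker := ⟨δ, hδ⟩
  have hlin : HasDerivAt (fun t : ℂ => t • δ') δ' 0 := by
    simpa using (hasDerivAt_id (0 : ℂ)).smul_const δ'
  have himp : HasFDerivAt (hf.implicitFunction f f' hf' (f a))
      (f' : E →ₗ[ℂ] F).ker.subtypeL ((0 : ℂ) • δ') := by
    rw [zero_smul]; exact (hf.to_implicitFunction hf').hasFDerivAt
  refine ⟨fun t => hf.implicitFunction f f' hf' (f a) (t • δ'), ?_, ?_, ?_⟩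
  · simp only [zero_smul, HasStrictFDerivAt.implicitFunction_apply_image]
  · exact himp.comp_hasDerivAt (0 : ℂ) hlin
  · have h := hf.map_implicitFunction_eq hf'
    have hc : Filter.Tendsto (fun t : ℂ => (f a, t • δ')) (𝓝 0) (𝓝 (f a, 0)) := by
      have : Continuous fun t : ℂ => (f a, t • δ') := by fun_prop
      simpa using this.tendsto 0
    exact hc.eventually h

/-! ### Differentials of `θ_k` and brackets on the constraint surface -/

section SpinCalculus

variable {m n d : ℕ} [NeZero m]

theorem hasFDerivAt_rCoeff (c : ZMod m) {x y : ℂ} (hxy : x ^ m ≠ y ^ m) :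
    ∃ e : ℂ, HasFDerivAt (fun p : ℂ × ℂ => rCoeff c p.1 p.2)
      (rCoeffDeriv c x y • ContinuousLinearMap.fst ℂ ℂ ℂ + e • ContinuousLinearMap.snd ℂ ℂ ℂ)
      (x, y) := by
  have hd : DifferentiableAt ℂ (fun p : ℂ × ℂ => rCoeff c p.1 p.2) (x, y) := by
    simp only [rCoeff, div_eq_mul_inv]
    have h1 : DifferentiableAt ℂ (fun p : ℂ × ℂ => p.1 ^ (m - posRep c) * p.2 ^ posRep c) (x, y) := by
      fun_prop
    have h2 : DifferentiableAt ℂ (fun p : ℂ × ℂ => p.1 ^ m - p.2 ^ m) (x, y) := by fun_prop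
    exact h1.mul (h2.inv (sub_ne_zero.2 hxy))
  refine ⟨fderiv ℂ (fun p : ℂ × ℂ => rCoeff c p.1 p.2) (x, y) (0, 1), ?_⟩
  have h1 : HasDerivAt (fun t : ℂ => rCoeff c t y)
      (fderiv ℂ (fun p : ℂ × ℂ => rCoeff c p.1 p.2) (x, y) (1, 0)) x :=
    HasFDerivAt.comp_hasDerivAt (f := fun t : ℂ => (t, y)) x hd.hasFDerivAt
      ((hasDerivAt_id x).prodMk (hasDerivAt_const x y))
  have h2 := h1.unique (hasDerivAt_rCoeff_left c hxy)
  refine hd.hasFDerivAt.congr_fderiv ?_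
  rw [← h2]
  ext <;> simp

theorem hasFDerivAt_spinVW (y : SpinCoord m n d) (i : ZMod m) (a b : Fin n) :
    HasFDerivAt (fun y : SpinCoord m n d => spinVW y i a b) (covU y i a b) y :=
  (hasStrictFDerivAt_spinVW y i a b).hasFDerivAt

/-- `∂(pairTerm k a)/∂λ_a`. -/
noncomputable def pairTermDeriv (y : SpinCoord m n d) (k a : Fin n) : ℂ :=
  ∑ i, ∑ i', rCoeffDeriv (i - i') (y.1 a) (y.1 k) * (spinVW y i k a * spinVW y i' a k)

theorem mul_pairTermDeriv_symm (y : SpinCoord m n d) (k a : Fin n) :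
    y.1 a * pairTermDeriv y k a = y.1 k * pairTermDeriv y a k := by
  simp only [pairTermDeriv, Finset.mul_sum, ← mul_assoc, mul_rCoeffDeriv_symm _ (y.1 a), neg_sub]
  rw [Finset.sum_comm]
  exact Finset.sum_congr rfl fun i _ => Finset.sum_congr rfl fun i' _ => by ring

/-- The coefficient of `dλ_k` may stay unspecified: in `θ_k` it pairs only with `φ_k`, which is
absent from `θ_j` for `j ≠ k`. -/
theorem hasFDerivAt_pairTerm {y : SpinCoord m n d} {k a : Fin n} (h : y.1 a ^ m ≠ y.1 k ^ m) :
    ∃ e : ℂ, HasFDerivAt (pairTerm k a)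
      (pairCov y k a + (pairTermDeriv y k a • covLam m d a + e • covLam m d k)) y := by
  choose e he using fun c : ZMod m => hasFDerivAt_rCoeff c h
  have h1 : ∀ c : ZMod m, HasFDerivAt (fun y : SpinCoord m n d => rCoeff c (y.1 a) (y.1 k))
      (rCoeffDeriv c (y.1 a) (y.1 k) • covLam m d a + e c • covLam m d k) y := by
    intro c
    have := (he c).comp y
      (((covLam m d a).hasFDerivAt (x := y)).prodMk ((covLam m d k).hasFDerivAt (x := y)))
    exact this
  refine ⟨∑ i, ∑ i', e (i - i') * (spinVW y i k a * spinVW y i' a k), ?_⟩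
  have h2 := HasFDerivAt.fun_sum (u := Finset.univ) fun (i : ZMod m) _ =>
    HasFDerivAt.fun_sum (u := Finset.univ) fun (i' : ZMod m) _ =>
      (h1 (i - i')).mul ((hasFDerivAt_spinVW y i k a).mul (hasFDerivAt_spinVW y i' a k))
  refine HasFDerivAt.congr_fderiv h2 (ContinuousLinearMap.ext fun δ => ?_)
  simp only [pairCov, covSum, pairCoeffL, pairCoeffR, pairTermDeriv, add_apply, sum_apply,
    smul_apply, smul_eq_mul, Pi.mul_apply, mul_add, Finset.sum_add_distrib, Finset.sum_mul]
  rw [add_comm (∑ i, ∑ q, rCoeff (i - q) (y.1 a) (y.1 k) * spinVW y q a k * covU y i k a δ),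
    Finset.sum_comm (f := fun i p => rCoeff (p - i) (y.1 a) (y.1 k) * spinVW y p k a *
      covU y i a k δ)]
  congr 1
  · congr 1 <;> exact Finset.sum_congr rfl fun i _ => Finset.sum_congr rfl fun i' _ => by ring
  · congr 1 <;> exact Finset.sum_congr rfl fun i _ => Finset.sum_congr rfl fun i' _ => by ring

theorem hasFDerivAt_selfTerm (g : ZMod m → ℂ) (k : Fin n) (y : SpinCoord m n d) :
    HasFDerivAt (selfTerm g k) (covSum y (selfCoeff g y k) k k) y := by
  have h1 : selfTerm (d := d) g k = fun y => ∑ i, spinVW y i k k *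
      (cShift g (i - 1) - ∑ r, cCoeff (i - 1) r * spinVW y r k k) := by
    ext z
    simp only [selfTerm, cShift_eq_sum (fun r => spinVW z r k k)]
  rw [h1]
  have h2 := HasFDerivAt.fun_sum (u := Finset.univ) fun (i : ZMod m) _ =>
    (hasFDerivAt_spinVW y i k k).mul ((HasFDerivAt.fun_sum (u := Finset.univ)
      fun (r : ZMod m) _ => (hasFDerivAt_spinVW y r k k).const_mul (cCoeff (i - 1) r)).const_sub
      (cShift g (i - 1)))
  refine HasFDerivAt.congr_fderiv h2 (ContinuousLinearMap.ext fun δ => ?_)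
  simp only [covSum, selfCoeff, add_apply, sum_apply, smul_apply, neg_apply, smul_eq_mul, add_mul,
    sub_mul, Finset.sum_mul, Finset.mul_sum, mul_neg, Finset.sum_add_distrib,
    Finset.sum_sub_distrib, Finset.sum_neg_distrib]
  rw [Finset.sum_comm (f := fun i r => cCoeff (r - 1) i * spinVW y r k k * covU y i k k δ)]
  have e1 : ∀ r i, spinVW y r k k * (cCoeff (r - 1) i * covU y i k k δ) =
      cCoeff (r - 1) i * spinVW y r k k * covU y i k k δ := fun r i => by ring
  simp only [e1]
  ring

theorem hasFDerivAt_gaudin (g : ZMod m → ℂ) (k : Fin n) {y : SpinCoord m n d}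
    (hy : y.1 ∈ regularSpectrum m n) :
    ∃ e : ℂ, HasFDerivAt (gaudin g k) (gaudinCov g y k -
      ∑ a ∈ Finset.univ.erase k, pairTermDeriv y k a • covLam m d a + e • covLam m d k) y := by
  have h1 : ∀ a : Fin n, ∃ e : ℂ, a ≠ k → HasFDerivAt (pairTerm k a)
      (pairCov y k a + (pairTermDeriv y k a • covLam m d a + e • covLam m d k)) y := by
    intro a
    by_cases ha : a = k
    · exact ⟨0, fun h => absurd ha h⟩
    · obtain ⟨e, he⟩ := hasFDerivAt_pairTerm (hy.2 a k ha)
      exact ⟨e, fun _ => he⟩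
  choose e he using h1
  refine ⟨-∑ a ∈ Finset.univ.erase k, e a, ?_⟩
  have h2 := (hasFDerivAt_selfTerm g k y).sub (HasFDerivAt.fun_sum (u := Finset.univ.erase k)
    fun a ha => he a (Finset.mem_erase.1 ha).1)
  refine HasFDerivAt.congr_fderiv h2 (ContinuousLinearMap.ext fun δ => ?_)
  simp only [gaudinCov, add_apply, sub_apply, sum_apply, smul_apply, smul_eq_mul,
    Finset.sum_add_distrib, ← Finset.sum_mul]
  ring

/-- With `i' = i - 1 - h` the representative of `i - i'` in `{1, …, m}` is `h + 1`. This shift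
explains the range of `posRep` and the factor `y⁻¹`. -/
theorem sum_range_rCoeff {x y : ℂ} (hy : y ≠ 0) (f : ZMod m → ℂ) (i : ZMod m) :
    ∑ h ∈ Finset.range m, f (i - 1 - (h : ZMod m)) * (x ^ (m - h - 1) * y ^ h / (x ^ m - y ^ m)) =
      y⁻¹ * ∑ i', rCoeff (i - i') x y * f i' := by
  rw [Finset.mul_sum]
  refine Finset.sum_nbij' (fun h => i - 1 - (h : ZMod m)) (fun i' => (i - 1 - i').val) ?_ ?_ ?_ ?_ ?_
  · intro h _; exact Finset.mem_univ _
  · intro i' _; exact Finset.mem_range.2 (ZMod.val_lt _)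
  · intro h hh
    rw [sub_sub_cancel, ZMod.val_cast_of_lt (Finset.mem_range.1 hh)]
  · intro i' _
    simp
  · intro h hh
    rw [rCoeff, posRep_eq (r := h + 1) (by omega) (Finset.mem_range.1 hh) (by push_cast; ring),
      Nat.sub_sub, pow_succ]
    field_simp

theorem spinTheta_eq {g : ZMod m → ℂ} (hg : ∑ i, g i ≠ 0) (k : Fin n) {y : SpinCoord m n d}
    (hy : y.1 ∈ regularSpectrum m n) : spinTheta g k y = ((m : ℂ) * ∑ i, g i)⁻¹ *
      ((∑ i, spinVW y i k k) * y.2.1 k + (y.1 k)⁻¹ * gaudin g k y) := by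
  rw [spinTheta, sklyanin_eval hg hy (fun _ => rfl)]
  congr 1
  have h1 : ∀ i, ((spinQuad g y).v i * (spinQuad g y).w i * (spinQuad g y).X (i - 1)) k k =
      ∑ a, spinVW y i k a * (spinQuad g y).X (i - 1) a k := fun i => rfl
  simp only [h1]
  simp only [← Finset.add_sum_erase _ _ (Finset.mem_univ k), Finset.sum_add_distrib]
  have h2 : ∑ i, spinVW y i k k * (spinQuad g y).X (i - 1) k k =
      (∑ i, spinVW y i k k) * y.2.1 k + (y.1 k)⁻¹ * selfTerm g k y := by
    rw [selfTerm, Finset.mul_sum, Finset.sum_mul, ← Finset.sum_add_distrib]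
    refine Finset.sum_congr rfl fun i _ => ?_
    simp only [spinQuad, Matrix.of_apply, if_true]
    ring
  have h3 : ∑ i, ∑ a ∈ Finset.univ.erase k, spinVW y i k a * (spinQuad g y).X (i - 1) a k =
      -((y.1 k)⁻¹ * ∑ a ∈ Finset.univ.erase k, pairTerm k a y) := by
    rw [Finset.sum_comm, Finset.mul_sum, ← Finset.sum_neg_distrib]
    refine Finset.sum_congr rfl fun a ha => ?_
    rw [pairTerm, Finset.mul_sum, ← Finset.sum_neg_distrib]
    refine Finset.sum_congr rfl fun i _ => ?_
    simp only [spinQuad, Matrix.of_apply, (Finset.mem_erase.1 ha).1, if_false]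
    rw [sum_range_rCoeff (hy.1 k) (fun i => spinVW y i a k), mul_neg, Finset.mul_sum,
      Finset.mul_sum, Finset.mul_sum]
    congr 1
    exact Finset.sum_congr rfl fun i' _ => by ring
  rw [h2, h3, gaudin]
  ring

theorem isOpen_regular_spinCoord : IsOpen {y : SpinCoord m n d | y.1 ∈ regularSpectrum m n} :=
  (isOpen_regularSpectrum m n).preimage continuous_fst

theorem differentiableAt_spinTheta {g : ZMod m → ℂ} (hg : ∑ i, g i ≠ 0) (k : Fin n)
    {y : SpinCoord m n d} (hy : y.1 ∈ regularSpectrum m n) :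
    DifferentiableAt ℂ (spinTheta g k) y := by
  obtain ⟨e, he⟩ := hasFDerivAt_gaudin g k hy
  have h1 : DifferentiableAt ℂ (fun y : SpinCoord m n d => ((m : ℂ) * ∑ i, g i)⁻¹ *
      ((∑ i, spinVW y i k k) * y.2.1 k + (y.1 k)⁻¹ * gaudin g k y)) y := by
    refine DifferentiableAt.const_mul (DifferentiableAt.add (DifferentiableAt.mul
      (DifferentiableAt.fun_sum fun i _ => (hasFDerivAt_spinVW y i k k).differentiableAt)
      (by fun_prop)) (DifferentiableAt.mul (DifferentiableAt.inv (by fun_prop) (hy.1 k))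
      he.differentiableAt)) _
  refine h1.congr_of_eventuallyEq ?_
  filter_upwards [isOpen_regular_spinCoord.mem_nhds hy] with z hz
  exact spinTheta_eq hg k hz

/-- A differential at `y` of an extension of `θ_k` from the constraint surface. -/
theorem exists_thetaExtension {g : ZMod m → ℂ} (hg : ∑ i, g i ≠ 0) {y : SpinCoord m n d}
    (hy : y ∈ spinDomain n d g) : ∃ (c : ℂ) (E : Fin n → Fin n → ℂ),
      (∀ k a, a ≠ k → E k a = -(c * (y.1 k)⁻¹ * pairTermDeriv y k a)) ∧
      ∀ k, ∃ f : SpinCoord m n d → ℂ, (f =ᶠ[𝓝[spinDomain n d g] y] spinTheta g k) ∧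
        HasFDerivAt f ((m : ℂ)⁻¹ • covPhi m d k + ((c * (y.1 k)⁻¹) • gaudinCov g y k +
          ∑ a, E k a • covLam m d a)) y := by
  choose e he using fun k => hasFDerivAt_gaudin g k hy.1
  set c := ((m : ℂ) * ∑ i, g i)⁻¹ with hc
  refine ⟨c, fun k a => if a = k then
    c * ((y.1 k)⁻¹ * e k + gaudin g k y * (-(y.1 k ^ 2)⁻¹)) else
    -(c * (y.1 k)⁻¹ * pairTermDeriv y k a), fun k a ha => if_neg ha, fun k => ?_⟩
  -- The extension replaces `∑_i [v_i w_i]_{kk}` in `spinTheta_eq` by the constant `|g|`, so that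
  -- `φ_k` occurs with the coefficient `1/m`.
  refine ⟨fun z => (m : ℂ)⁻¹ * z.2.1 k + c * ((z.1 k)⁻¹ * gaudin g k z), ?_, ?_⟩
  · filter_upwards [self_mem_nhdsWithin] with z hz
    rw [spinTheta_eq hg k hz.1, hz.2 k, hc, mul_add]
    congr 1
    rw [mul_inv]
    field_simp
  · have hinv : HasFDerivAt (fun z : SpinCoord m n d => (z.1 k)⁻¹)
        ((-(y.1 k ^ 2)⁻¹) • covLam m d k) y :=
      (hasDerivAt_inv (hy.1.1 k)).comp_hasFDerivAt y (covLam m d k).hasFDerivAt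
    have h1 := (((covPhi m d k).hasFDerivAt (x := y)).const_mul (m : ℂ)⁻¹).add
      ((hinv.mul (he k)).const_mul c)
    refine HasFDerivAt.congr_fderiv h1 (ContinuousLinearMap.ext fun δ => ?_)
    simp only [add_apply, sub_apply, sum_apply, smul_apply, smul_eq_mul]
    rw [← Finset.add_sum_erase _ _ (Finset.mem_univ k), if_pos rfl]
    have h2 : ∑ a ∈ Finset.univ.erase k, (if a = k then
        c * ((y.1 k)⁻¹ * e k + gaudin g k y * (-(y.1 k ^ 2)⁻¹)) else
        -(c * (y.1 k)⁻¹ * pairTermDeriv y k a)) * covLam m d a δ =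
        -((c * (y.1 k)⁻¹) * ∑ a ∈ Finset.univ.erase k, pairTermDeriv y k a * covLam m d a δ) := by
      rw [Finset.mul_sum, ← Finset.sum_neg_distrib]
      refine Finset.sum_congr rfl fun a ha => ?_
      rw [if_neg (Finset.mem_erase.1 ha).1]
      ring
    rw [h2]
    ring

/-- Rescaling the row `j` of all `v_i` changes the `j`-th constraint at a rate proportional to its
value `|g| ≠ 0`, and no other constraint. -/
theorem surjective_moment {g : ZMod m → ℂ} (hg : ∑ i, g i ≠ 0) {y : SpinCoord m n d}
    (hy : y ∈ spinDomain n d g) :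
    Function.Surjective (ContinuousLinearMap.pi fun l => covSum y 1 l l) := by
  intro c
  refine ⟨(0, 0, fun i j α => c j * (∑ i, g i)⁻¹ * y.2.2.1 i j α, 0), ?_⟩
  ext l
  have h1 : ∀ i, covU y i l l (0, 0, fun i j α => c j * (∑ i, g i)⁻¹ * y.2.2.1 i j α, 0) =
      c l * (∑ i, g i)⁻¹ * spinVW y i l l := by
    intro i
    rw [covU, sum_apply, spinVW, Finset.mul_sum]
    refine Finset.sum_congr rfl fun α _ => ?_
    change y.2.2.1 i l α * 0 + y.2.2.2 i α l * (c l * (∑ i, g i)⁻¹ * y.2.2.1 i l α) = _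
    ring
  simp only [ContinuousLinearMap.pi_apply, covSum, sum_apply, Pi.one_apply, one_smul, h1,
    ← Finset.mul_sum, hy.2 l]
  field_simp

theorem hasStrictFDerivAt_moment (y : SpinCoord m n d) :
    HasStrictFDerivAt (fun z : SpinCoord m n d => fun l => ∑ i, spinVW z i l l)
      (ContinuousLinearMap.pi fun l => covSum y 1 l l) y := by
  refine hasStrictFDerivAt_pi.2 fun l => ?_
  have h := HasStrictFDerivAt.fun_sum (u := Finset.univ) fun (i : ZMod m) _ =>
    hasStrictFDerivAt_spinVW y i l l
  convert h using 1
  simp [covSum]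

/-- Lagrange multipliers: the two functions agree along every curve in the constraint surface, so
their differentials agree on the common kernel of the constraint differentials. -/
theorem fderiv_eq_of_eventuallyEq_spinDomain {g : ZMod m → ℂ} (hg : ∑ i, g i ≠ 0)
    {y : SpinCoord m n d} (hy : y ∈ spinDomain n d g) {F f : SpinCoord m n d → ℂ}
    {L : SpinCoord m n d →L[ℂ] ℂ} (hF : DifferentiableAt ℂ F y) (hf : HasFDerivAt f L y)
    (h : F =ᶠ[𝓝[spinDomain n d g] y] f) :
    ∃ b : Fin n → ℂ, fderiv ℂ F y = L + ∑ l, b l • covSum y 1 l l := by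
  have hker : ∀ δ, (∀ l, covSum y 1 l l δ = 0) → fderiv ℂ F y δ = L δ := by
    intro δ hδ
    obtain ⟨γ, h0, hγ, hlev⟩ := exists_curve (hasStrictFDerivAt_moment y) (surjective_moment hg hy)
      (δ := δ) (funext hδ)
    have hreg : ∀ᶠ t in 𝓝 (0 : ℂ), (γ t).1 ∈ regularSpectrum m n := by
      have hc := hγ.continuousAt
      exact hc.eventually_mem (by rw [h0]; exact isOpen_regular_spinCoord.mem_nhds hy.1)
    have htend : Filter.Tendsto γ (𝓝 0) (𝓝[spinDomain n d g] y) := by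
      refine tendsto_nhdsWithin_iff.2 ⟨h0 ▸ hγ.continuousAt.tendsto, ?_⟩
      filter_upwards [hreg, hlev] with t ht ht'
      exact ⟨ht, fun l => (congrFun ht' l).trans (hy.2 l)⟩
    have h1 : HasDerivAt (fun t => F (γ t)) (fderiv ℂ F y δ) 0 :=
      HasFDerivAt.comp_hasDerivAt (0 : ℂ) (by rw [h0]; exact hF.hasFDerivAt) hγ
    have h2 : HasDerivAt (fun t => f (γ t)) (L δ) 0 :=
      HasFDerivAt.comp_hasDerivAt (0 : ℂ) (by rw [h0]; exact hf) hγ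
    exact (h1.congr_of_eventuallyEq
      ((htend.eventually h).mono fun _ ht => ht.symm)).unique h2
  have hspan : ((fderiv ℂ F y - L : SpinCoord m n d →L[ℂ] ℂ) : SpinCoord m n d →ₗ[ℂ] ℂ) ∈
      Submodule.span ℂ (Set.range fun l => (covSum y 1 l l : SpinCoord m n d →ₗ[ℂ] ℂ)) := by
    refine mem_span_of_iInf_ker_le_ker fun δ hδ => ?_
    rw [Submodule.mem_iInf] at hδ
    exact sub_eq_zero.2 (hker δ hδ)
  obtain ⟨b, hb⟩ := (Submodule.mem_span_range_iff_exists_fun ℂ).1 hspan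
  refine ⟨b, ?_⟩
  rw [← sub_eq_iff_eq_add']
  refine ContinuousLinearMap.ext fun δ => ?_
  have := LinearMap.congr_fun hb δ
  simp only [LinearMap.sum_apply, LinearMap.smul_apply] at this
  rw [← ContinuousLinearMap.coe_coe, ← this]
  simp

/-- The constraints are in involution with each other and with `A` and `B`, so the multipliers drop
out. This makes the bracket independent of the extensions. -/
theorem spinBra_add_moments (y : SpinCoord m n d) {A B : SpinCoord m n d →L[ℂ] ℂ}
    (hA : ∀ l, spinBra (covSum y 1 l l) A = 0) (hB : ∀ l, spinBra (covSum y 1 l l) B = 0)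
    (a b : Fin n → ℂ) :
    spinBra (A + ∑ l, a l • covSum y 1 l l) (B + ∑ l, b l • covSum y 1 l l) = spinBra A B := by
  have hA' : ∀ l, spinBra A (covSum y 1 l l) = 0 := fun l => by rw [spinBra_swap, hA, neg_zero]
  rw [LinearMap.map_add₂, LinearMap.map_sum₂]
  simp only [map_add, map_sum, map_smul, LinearMap.smul_apply, hA', hB, spinBra_self_self,
    smul_zero, Finset.sum_const_zero, add_zero]

theorem spinBra_moment_covLam (y : SpinCoord m n d) (l j : Fin n) :
    spinBra (covSum y 1 l l) (covLam m d j) = 0 := by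
  rw [spinBra_swap, spinBra_covLam_covSum, neg_zero]

theorem spinBra_covLam_gaudinCov (g : ZMod m → ℂ) (y : SpinCoord m n d) (j k : Fin n) :
    spinBra (covLam m d j) (gaudinCov g y k) = 0 := by
  simp [gaudinCov, pairCov, spinBra_covLam_covSum]

theorem spinBra_covPhi_gaudinCov (g : ZMod m → ℂ) (y : SpinCoord m n d) (j k : Fin n) :
    spinBra (covPhi m d j) (gaudinCov g y k) = 0 := by
  simp [gaudinCov, pairCov, spinBra_covPhi_covSum]

theorem spinBra_moment_thetaCov (g : ZMod m → ℂ) (y : SpinCoord m n d) (l k : Fin n) (A B : ℂ)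
    (E : Fin n → ℂ) : spinBra (covSum y 1 l l)
      (A • covPhi m d k + (B • gaudinCov g y k + ∑ a, E a • covLam m d a)) = 0 := by
  have h : spinBra (covSum y 1 l l) (covPhi m d k) = 0 := by
    rw [spinBra_swap, spinBra_covPhi_covSum, neg_zero]
  simp [h, spinBra_moment_gaudinCov, spinBra_moment_covLam]

theorem spinBra_covLam_thetaCov (g : ZMod m → ℂ) (y : SpinCoord m n d) (l k : Fin n) (A B : ℂ)
    (E : Fin n → ℂ) : spinBra (covLam m d l)
      (A • covPhi m d k + (B • gaudinCov g y k + ∑ a, E a • covLam m d a)) =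
      A * if l = k then (m : ℂ) else 0 := by
  simp [spinBra_covLam_gaudinCov, spinBra_covLam_covLam, spinBra_covLam_covPhi]

/-- The Gaudin parts commute with each other and with the `λ` and `φ` directions. What is left is
each `dφ` against the other particle's `dλ`. -/
theorem spinBra_thetaCov {g : ZMod m → ℂ} {y : SpinCoord m n d} (hy : y ∈ spinDomain n d g)
    {j k : Fin n} (hjk : j ≠ k) (A B C : ℂ) (E E' : Fin n → ℂ) :
    spinBra (A • covPhi m d j + (B • gaudinCov g y j + ∑ a, E a • covLam m d a))
      (A • covPhi m d k + (C • gaudinCov g y k + ∑ a, E' a • covLam m d a)) =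
      A * m * (E k - E' j) := by
  have h1 : ∀ a, spinBra (gaudinCov g y j) (covLam m d a) = 0 := fun a => by
    rw [spinBra_swap, spinBra_covLam_gaudinCov, neg_zero]
  have h2 : spinBra (gaudinCov g y j) (covPhi m d k) = 0 := by
    rw [spinBra_swap, spinBra_covPhi_gaudinCov, neg_zero]
  have h3 : ∀ a, spinBra (covPhi m d j) (covLam m d a) = -if a = j then (m : ℂ) else 0 :=
    fun a => by rw [spinBra_swap, spinBra_covLam_covPhi]
  have h4 := spinBra_gaudinCov (g := g) hy.1 hjk ((hy.2 j).trans (hy.2 k).symm)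
  rw [LinearMap.map_add₂, LinearMap.map_add₂, LinearMap.map_smul₂, LinearMap.map_smul₂,
    LinearMap.map_sum₂]
  simp only [LinearMap.map_smul₂, spinBra_covLam_thetaCov]
  simp only [map_add, map_smul, map_sum, h1, h2, h3, h4, spinBra_covPhi_gaudinCov,
    spinBra_covPhi_covPhi, smul_eq_mul, mul_zero, add_zero, zero_add, Finset.sum_const_zero,
    mul_ite, mul_neg, Finset.sum_neg_distrib, Finset.sum_ite_eq', Finset.mem_univ, if_true]
  ring

theorem spinPoissonEq_lambda_theta {g : ZMod m → ℂ} (hg : ∑ i, g i ≠ 0) {y : SpinCoord m n d}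
    (hy : y ∈ spinDomain n d g) (j k : Fin n) :
    SpinPoissonEq g (fun y' : SpinCoord m n d => y'.1 j) (spinTheta g k) y
      (if j = k then 1 else 0) := by
  intro F H hF hH hFf hHh
  obtain ⟨c, E, _, hE⟩ := exists_thetaExtension hg hy
  obtain ⟨f, hf, hf'⟩ := hE k
  obtain ⟨a, ha⟩ := fderiv_eq_of_eventuallyEq_spinDomain hg hy hF
    ((covLam m d j).hasFDerivAt (x := y)) hFf
  obtain ⟨b, hb⟩ := fderiv_eq_of_eventuallyEq_spinDomain hg hy hH hf' (hHh.trans hf.symm)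
  have hm : (m : ℂ) ≠ 0 := Nat.cast_ne_zero.2 (NeZero.ne m)
  rw [spinPoisson_eq, ha, hb, spinBra_add_moments y (fun l => spinBra_moment_covLam y l j)
    (fun l => spinBra_moment_thetaCov g y l k _ _ _), spinBra_covLam_thetaCov]
  split_ifs <;> simp [hm]

theorem spinPoissonEq_theta_theta {g : ZMod m → ℂ} (hg : ∑ i, g i ≠ 0) {y : SpinCoord m n d}
    (hy : y ∈ spinDomain n d g) (j k : Fin n) :
    SpinPoissonEq g (spinTheta g j) (spinTheta g k) y 0 := by
  intro F H hF hH hFf hHh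
  obtain ⟨c, E, hcE, hE⟩ := exists_thetaExtension hg hy
  obtain ⟨f, hf, hf'⟩ := hE j
  obtain ⟨h, hh, hh'⟩ := hE k
  obtain ⟨a, ha⟩ := fderiv_eq_of_eventuallyEq_spinDomain hg hy hF hf' (hFf.trans hf.symm)
  obtain ⟨b, hb⟩ := fderiv_eq_of_eventuallyEq_spinDomain hg hy hH hh' (hHh.trans hh.symm)
  rw [spinPoisson_eq, ha, hb, spinBra_add_moments y
    (fun l => spinBra_moment_thetaCov g y l j _ _ _)
    (fun l => spinBra_moment_thetaCov g y l k _ _ _)]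
  by_cases hjk : j = k
  · subst hjk
    exact self_eq_neg.1 (spinBra_swap _ _)
  · rw [spinBra_thetaCov hy hjk, hcE j k (Ne.symm hjk), hcE k j hjk]
    have hs := mul_pairTermDeriv_symm y j k
    have h1 := hy.1.1 j
    have h2 := hy.1.1 k
    have h3 : (y.1 j)⁻¹ * pairTermDeriv y j k = (y.1 k)⁻¹ * pairTermDeriv y k j := by
      field_simp
      linear_combination hs
    linear_combination (-c * ((m : ℂ)⁻¹ * m)) * h3

end SpinCalculus

/-! ### Splitting a first order deformation on the generalized kernel -/

/-- A lift of a finitely generated `p`-power torsion module along a homomorphism exists if torsion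
elements lift to torsion elements of the same order. -/
theorem exists_lift_of_pure {R S E V : Type*} [CommRing R] [IsDomain R] [IsPrincipalIdealRing R]
    {p : R} (hp : Irreducible p) [AddCommGroup S] [Module R S] [Module.Finite R S]
    [AddCommGroup E] [Module R E] [AddCommGroup V] [Module R V]
    (hS : Module.IsTorsion' S (Submonoid.powers p)) (π : E →ₗ[R] V) (ι : S →ₗ[R] V)
    (h : ∀ (k : ℕ) (s : S), p ^ k • s = 0 → ∃ e : E, p ^ k • e = 0 ∧ π e = ι s) :
    ∃ σ : S →ₗ[R] E, ∀ s, π (σ s) = ι s := by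
  classical
  -- `S` is a direct sum of cyclic modules `R/(p^k)`. Each generator is lifted to an element killed
  -- by the same `p^k`, which defines a homomorphism.
  obtain ⟨d, k, ⟨φ⟩⟩ := Module.torsion_by_prime_power_decomposition hp hS
  have hgen : ∀ i : Fin d, p ^ k i • φ.symm (DirectSum.lof R (Fin d)
      (fun i => R ⧸ Submodule.span R {p ^ k i}) i (Submodule.Quotient.mk 1)) = 0 := by
    intro i
    rw [← map_smul, ← map_smul, ← Submodule.Quotient.mk_smul, smul_eq_mul, mul_one,
      (Submodule.Quotient.mk_eq_zero _).2 (Submodule.mem_span_singleton_self _), map_zero, map_zero]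
  choose e he0 he using fun i => h (k i) _ (hgen i)
  let F : (DirectSum (Fin d) fun i => R ⧸ Submodule.span R {p ^ k i}) →ₗ[R] E :=
    DirectSum.toModule R (Fin d) E fun i =>
      (Submodule.span R {p ^ k i}).liftQ (LinearMap.toSpanSingleton R E (e i)) (by
        rw [Submodule.span_singleton_le_iff_mem, LinearMap.mem_ker,
          LinearMap.toSpanSingleton_apply, he0])
  have hF : π ∘ₗ F = ι ∘ₗ φ.symm.toLinearMap := by
    refine DirectSum.linearMap_ext R fun i => ?_
    ext
    simp only [F, LinearMap.comp_apply, DirectSum.toModule_lof, LinearEquiv.coe_coe]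
    exact (congrArg π (one_smul R (e i))).trans (he i)
  refine ⟨F ∘ₗ φ.toLinearMap, fun s => ?_⟩
  have := LinearMap.congr_fun hF (φ s)
  simpa using this

section PowDeriv

/-- The derivative of `A ↦ A ^ k` at `P` in the direction `Y`. -/
def powDeriv {R : Type*} [Ring R] (P Y : R) : ℕ → R
  | 0 => 0
  | k + 1 => powDeriv P Y k * P + P ^ k * Y

variable {V : Type*} [AddCommGroup V] [Module ℂ V]

/-- The endomorphism `(w, z) ↦ (P w + Y z, P z)`. -/
def firstOrderExt (P Y : V →ₗ[ℂ] V) : (V × V) →ₗ[ℂ] (V × V) :=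
  ((P ∘ₗ LinearMap.fst ℂ V V) + (Y ∘ₗ LinearMap.snd ℂ V V)).prod (P ∘ₗ LinearMap.snd ℂ V V)

theorem firstOrderExt_apply (P Y : V →ₗ[ℂ] V) (x : V × V) :
    firstOrderExt P Y x = (P x.1 + Y x.2, P x.2) := rfl

theorem firstOrderExt_pow (P Y : V →ₗ[ℂ] V) (k : ℕ) (x : V × V) :
    (firstOrderExt P Y ^ k) x = ((P ^ k) x.1 + powDeriv P Y k x.2, (P ^ k) x.2) := by
  induction k generalizing x with
  | zero => simp [powDeriv]
  | succ k ih =>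
    rw [pow_succ, Module.End.mul_apply, ih, firstOrderExt_apply, pow_succ, Module.End.mul_apply]
    simp only [powDeriv, map_add, LinearMap.add_apply, Module.End.mul_apply, Prod.mk.injEq,
      and_true]
    abel

/-- `V × V` with `firstOrderExt P Y` is an extension of `ℂ[X]`-modules of `(V, P)` by itself. The
hypothesis says that torsion of each order up to `L` lifts with its order, so the extension splits
over the `X^L`-torsion; the first component of the section is `N`. -/
theorem exists_splitting [FiniteDimensional ℂ V] {P Y : V →ₗ[ℂ] V}
    {L : ℕ} (h : ∀ k ≤ L, ∀ z : V, (P ^ k) z = 0 → ∃ w, (P ^ k) w = powDeriv P Y k z) :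
    ∃ N : V →ₗ[ℂ] V, ∀ z, (P ^ L) z = 0 → P (N z) + Y z = N (P z) := by
  let S := Submodule.torsionBy (Polynomial ℂ) (Module.AEval' P) (Polynomial.X ^ L)
  let π : Module.AEval' (firstOrderExt P Y) →ₗ[Polynomial ℂ] Module.AEval' P :=
    LinearMap.ofAEval (firstOrderExt P Y)
      ((Module.AEval'.of P).toLinearMap ∘ₗ LinearMap.snd ℂ V V) (by
        intro x
        rw [LinearMap.comp_apply, LinearMap.comp_apply, LinearEquiv.coe_coe,
          Module.AEval'.X_smul_of]
        rfl)
  have hS : Module.IsTorsion' S (Submonoid.powers (Polynomial.X : Polynomial ℂ)) :=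
    (Submodule.isTorsion'_powers_iff _).2 fun x => ⟨L, Submodule.smul_torsionBy _ _⟩
  have hlift : ∀ k ≤ L, ∀ s : S, (Polynomial.X : Polynomial ℂ) ^ k • s = 0 →
      ∃ e : Module.AEval' (firstOrderExt P Y),
        (Polynomial.X : Polynomial ℂ) ^ k • e = 0 ∧ π e = S.subtype s := by
    intro k hk s hs
    obtain ⟨z, hz⟩ := (Module.AEval'.of P).surjective s.1
    have h0 : (P ^ k) z = 0 := by
      have h1 := congrArg Subtype.val hs
      rw [Submodule.coe_smul, ← hz, Module.AEval'.X_pow_smul_of] at h1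
      exact (Module.AEval'.of P).map_eq_zero_iff.1 h1
    obtain ⟨w, hw⟩ := h k hk z h0
    -- The sign makes `P^k (-w)` cancel the off-diagonal part of the `k`-th power.
    refine ⟨Module.AEval'.of _ (-w, z), ?_, hz⟩
    rw [Module.AEval'.X_pow_smul_of]
    have : (firstOrderExt P Y ^ k) • ((-w, z) : V × V) = 0 := by
      rw [Module.End.smul_def, firstOrderExt_pow]
      simp [hw, h0]
    rw [this, map_zero]
  obtain ⟨σ, hσ⟩ := exists_lift_of_pure Polynomial.irreducible_X hS π S.subtype (by
    intro k s hs
    rcases le_total k L with hk | hk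
    · exact hlift k hk s hs
    · obtain ⟨e, he, he'⟩ := hlift L le_rfl s (Submodule.smul_torsionBy _ _)
      refine ⟨e, ?_, he'⟩
      rw [← Nat.sub_add_cancel hk, pow_add, mul_smul, he, smul_zero])
  have hmem : ∀ z ∈ (P ^ L).ker, Module.AEval'.of P z ∈ S := by
    intro z hz
    rw [Submodule.mem_torsionBy_iff, Module.AEval'.X_pow_smul_of]
    exact (Module.AEval'.of P).map_eq_zero_iff.2 hz
  let N0 : (P ^ L).ker →ₗ[ℂ] V :=
    { toFun := fun z => ((Module.AEval'.of (firstOrderExt P Y)).symm (σ ⟨_, hmem z z.2⟩)).1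
      map_add' := by
        intro a b
        rw [← Prod.fst_add, ← map_add, ← map_add]; rfl
      map_smul' := by
        intro c a
        have : (⟨_, hmem _ (c • a).2⟩ : S) =
            Polynomial.C c • (⟨_, hmem _ a.2⟩ : S) := by
          apply Subtype.ext
          change Module.AEval'.of P (c • (a : V)) = Polynomial.C c • Module.AEval'.of P (a : V)
          rw [Module.AEval.C_smul, map_smul]
        rw [this, map_smul, Module.AEval.C_smul, map_smul]
        rfl }
  obtain ⟨N, hN⟩ := LinearMap.exists_extend N0
  have hN' : ∀ z (hz : (P ^ L) z = 0), (Module.AEval'.of (firstOrderExt P Y)).symm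
      (σ ⟨_, hmem z hz⟩) = (N z, z) := by
    intro z hz
    refine Prod.ext ?_ ?_
    · exact (LinearMap.congr_fun hN ⟨z, hz⟩).symm
    · exact hσ ⟨_, hmem z hz⟩
  refine ⟨N, fun z hz => ?_⟩
  have hz' : (P ^ L) (P z) = 0 := by
    rw [← Module.End.mul_apply, ← pow_succ, pow_succ', Module.End.mul_apply, hz, map_zero]
  have h1 : (⟨_, hmem _ hz'⟩ : S) = (Polynomial.X : Polynomial ℂ) • (⟨_, hmem _ hz⟩ : S) :=
    Subtype.ext (Module.AEval'.X_smul_of P z).symm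
  have h2 := hN' _ hz'
  rw [h1, map_smul, Module.AEval'.of_symm_X_smul, hN' z hz, firstOrderExt_apply] at h2
  exact congrArg Prod.fst h2

end PowDeriv

/-! ### Families of matrices of locally maximal rank -/

section ConstantRank

variable {ι κ μ : Type*} [Fintype ι] [Fintype κ] [Fintype μ]

theorem hasDerivAt_matrix_mul {A : ℂ → Matrix ι κ ℂ} {B : ℂ → Matrix κ μ ℂ} {A' : Matrix ι κ ℂ}
    {B' : Matrix κ μ ℂ} {x : ℂ} (hA : ∀ i j, HasDerivAt (fun t => A t i j) (A' i j) x)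
    (hB : ∀ i j, HasDerivAt (fun t => B t i j) (B' i j) x) (i : ι) (j : μ) :
    HasDerivAt (fun t => (A t * B t) i j) ((A' * B x + A x * B') i j) x := by
  simp only [Matrix.mul_apply, Matrix.add_apply, ← Finset.sum_add_distrib]
  exact HasDerivAt.fun_sum fun k _ => (hA i k).mul (hB k j)

theorem hasDerivAt_matrix_pow [DecidableEq ι] {A : ℂ → Matrix ι ι ℂ} {A' : Matrix ι ι ℂ} {x : ℂ}
    (hA : ∀ i j, HasDerivAt (fun t => A t i j) (A' i j) x) (k : ℕ) (i j : ι) :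
    HasDerivAt (fun t => (A t ^ k) i j) (powDeriv (A x) A' k i j) x := by
  induction k generalizing i j with
  | zero => simpa [powDeriv] using hasDerivAt_const x _
  | succ k ih =>
    simp only [pow_succ, powDeriv]
    exact hasDerivAt_matrix_mul ih hA i j

/-- At a point where the rank of a family of matrices is locally maximal, the derivative maps the
kernel into the image. -/
theorem exists_mulVec_eq_of_rank_le {A : ℂ → Matrix ι κ ℂ} {D : Matrix ι κ ℂ}
    (hA : ∀ i j, HasDerivAt (fun t => A t i j) (D i j) 0)
    (hr : ∀ᶠ t in 𝓝 0, (A t).rank ≤ (A 0).rank) {z : κ → ℂ} (hz : (A 0).mulVec z = 0) :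
    ∃ w, (A 0).mulVec w = D.mulVec z := by
  by_contra hcon
  have hd : ∀ (c : κ → ℂ) i, HasDerivAt (fun t => (A t).mulVec c i) (D.mulVec c i) 0 := by
    intro c i
    simp only [Matrix.mulVec, dotProduct]
    exact HasDerivAt.fun_sum fun k _ => (hA i k).mul_const _
  obtain ⟨r, hrk⟩ : ∃ r, r = (A 0).rank := ⟨_, rfl⟩
  have b : Module.Basis (Fin r) ℂ (A 0).mulVecLin.range :=
    Module.finBasisOfFinrankEq ℂ _ hrk.symm
  choose c hc using fun i => LinearMap.mem_range.1 (b i).2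
  -- If `D z` were outside the image, then `t⁻¹ A(t) z`, which tends to `D z`, together with the
  -- images under `A(t)` of lifts of a basis would be `r + 1` independent vectors in the image of
  -- `A(t)` for small `t ≠ 0`.
  let f : ℂ → Option (Fin r) → ι → ℂ := fun t o =>
    o.elim (t⁻¹ • (A t).mulVec z) fun i => (A t).mulVec (c i)
  let f0 : Option (Fin r) → ι → ℂ := fun o => o.elim (D.mulVec z) fun i => (A 0).mulVec (c i)
  have hli : LinearIndependent ℂ f0 := by
    have h1 : f0 ∘ some = fun i => (b i : ι → ℂ) := funext hc
    refine linearIndependent_option.2 ⟨?_, ?_⟩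
    · rw [h1]
      exact b.linearIndependent.map' (A 0).mulVecLin.range.subtype (Submodule.ker_subtype _)
    · rw [h1]
      intro hmem
      have hle : Submodule.span ℂ (Set.range fun i => (b i : ι → ℂ)) ≤
          (A 0).mulVecLin.range := by
        rw [Submodule.span_le]
        rintro _ ⟨i, rfl⟩
        exact (b i).2
      exact hcon (LinearMap.mem_range.1 (hle hmem))
  have htend : Filter.Tendsto f (𝓝[≠] 0) (𝓝 f0) := by
    refine tendsto_pi_nhds.2 fun o => ?_
    cases o with
    | none =>
      refine tendsto_pi_nhds.2 fun i => ?_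
      have h := (hd z i).tendsto_slope
      refine h.congr fun t => ?_
      simp [slope_def_field, f, hz, div_eq_inv_mul]
    | some j =>
      refine tendsto_pi_nhds.2 fun i => ?_
      exact (hd (c j) i).continuousAt.tendsto.mono_left nhdsWithin_le_nhds
  have hev : ∀ᶠ t in 𝓝[≠] (0 : ℂ), LinearIndependent ℂ (f t) :=
    htend.eventually_mem (isOpen_setOfPred_linearIndependent.mem_nhds hli)
  obtain ⟨t, ht, hrt⟩ := (hev.and (hr.filter_mono nhdsWithin_le_nhds)).exists
  have hmem : ∀ o, f t o ∈ (A t).mulVecLin.range := by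
    intro o
    cases o with
    | none => exact Submodule.smul_mem _ _ ⟨z, rfl⟩
    | some j => exact ⟨c j, rfl⟩
  have hli' : LinearIndependent ℂ fun o => (⟨f t o, hmem o⟩ : (A t).mulVecLin.range) :=
    LinearIndependent.of_comp (A t).mulVecLin.range.subtype ht
  have hcard := hli'.fintype_card_le_finrank
  rw [Fintype.card_option, Fintype.card_fin] at hcard
  have hcard' : r + 1 ≤ (A t).rank := hcard
  omega

theorem eventually_rank_le {A : ℂ → Matrix ι κ ℂ}
    (hA : ∀ i j, ContinuousAt (fun t => A t i j) 0) : ∀ᶠ t in 𝓝 0, (A 0).rank ≤ (A t).rank := by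
  obtain ⟨r, hrk⟩ : ∃ r, r = (A 0).rank := ⟨_, rfl⟩
  have b : Module.Basis (Fin r) ℂ (A 0).mulVecLin.range :=
    Module.finBasisOfFinrankEq ℂ _ hrk.symm
  choose c hc using fun i => LinearMap.mem_range.1 (b i).2
  let f : ℂ → Fin r → ι → ℂ := fun t i => (A t).mulVec (c i)
  have hli : LinearIndependent ℂ (f 0) := by
    have h1 : f 0 = fun i => (b i : ι → ℂ) := funext hc
    rw [h1]
    exact b.linearIndependent.map' (A 0).mulVecLin.range.subtype (Submodule.ker_subtype _)
  have htend : Filter.Tendsto f (𝓝 0) (𝓝 (f 0)) := by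
    refine tendsto_pi_nhds.2 fun i => tendsto_pi_nhds.2 fun a => ?_
    have : ContinuousAt (fun t => ∑ k, A t a k * c i k) 0 :=
      tendsto_finsetSum _ fun k _ => (hA a k).mul continuousAt_const
    exact this
  filter_upwards [htend.eventually_mem (isOpen_setOfPred_linearIndependent.mem_nhds hli)] with t ht
  have hli' : LinearIndependent ℂ fun i => (⟨f t i, c i, rfl⟩ : (A t).mulVecLin.range) :=
    LinearIndependent.of_comp (A t).mulVecLin.range.subtype ht
  have hcard := hli'.fintype_card_le_finrank
  rw [Fintype.card_fin] at hcard
  rw [← hrk]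
  exact hcard

theorem map_powDeriv {R S : Type*} [Ring R] [Ring S] (f : R →+* S) (P Y : R) (k : ℕ) :
    f (powDeriv P Y k) = powDeriv (f P) (f Y) k := by
  induction k with
  | zero => simp [powDeriv]
  | succ k ih => simp [powDeriv, ih]

/-- The rank condition feeds `exists_splitting`, so `Y e = (M P - P M) e` for some `M`. As `Z` and
`e` commute with `P`, the matrix `Z Y e` is a commutator with `P`. -/
theorem trace_mul_eq_zero_of_rank_pow_le [DecidableEq ι] {P : ℂ → Matrix ι ι ℂ} {Y : Matrix ι ι ℂ}
    (hP : ∀ i j, HasDerivAt (fun t => P t i j) (Y i j) 0)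
    {L : ℕ} (hr : ∀ k ≤ L, ∀ᶠ t in 𝓝 0, (P t ^ k).rank ≤ (P 0 ^ k).rank) {e Z : Matrix ι ι ℂ}
    (heL : P 0 ^ L * e = 0) (he : P 0 * e = e * P 0) (hZ : P 0 * Z = Z * P 0) :
    (Z * Y * e).trace = 0 := by
  obtain ⟨N, hN⟩ := exists_splitting (P := Matrix.toLin' (P 0)) (Y := Matrix.toLin' Y) (by
    intro k hk z hz
    rw [← Matrix.toLin'_pow, Matrix.toLin'_apply] at hz
    obtain ⟨w, hw⟩ := exists_mulVec_eq_of_rank_le (hasDerivAt_matrix_pow hP k) (hr k hk) hz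
    refine ⟨w, ?_⟩
    have h := map_powDeriv (Matrix.toLinAlgEquiv' : Matrix ι ι ℂ ≃ₐ[ℂ] _).toRingHom (P 0) Y k
    rw [← Matrix.toLin'_pow, Matrix.toLin'_apply, hw]
    exact LinearMap.congr_fun h z)
  set M := LinearMap.toMatrix' N with hM
  have hM' : N = Matrix.toLin' M := (Matrix.toLin'_toMatrix' N).symm
  have key : P 0 * M * e + Y * e = M * P 0 * e := by
    refine Matrix.toLin'.injective (LinearMap.ext fun z => ?_)
    have h := hN (e.mulVec z) (by
      rw [← Matrix.toLin'_pow, Matrix.toLin'_apply, Matrix.mulVec_mulVec, heL, Matrix.zero_mulVec])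
    rw [hM'] at h
    simpa [Matrix.toLin'_apply, Matrix.mulVec_mulVec, Matrix.add_mulVec, Matrix.mul_assoc] using h
  have h1 : Z * Y * e = Z * M * e * P 0 - P 0 * (Z * M * e) := by
    have : Y * e = M * P 0 * e - P 0 * M * e := by rw [← key]; abel
    rw [Matrix.mul_assoc, this, Matrix.mul_sub]
    congr 1
    · simp only [Matrix.mul_assoc, he]
    · simp only [← Matrix.mul_assoc, hZ]
  rw [h1, Matrix.trace_sub, Matrix.trace_mul_comm, sub_self]

end ConstantRank

/-! ### Sums of `g` over arcs of the cycle -/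

section CyclicSums

variable {m : ℕ} [NeZero m]

theorem sum_range_cyclic (g : ZMod m → ℂ) (c : ZMod m) :
    ∑ t ∈ Finset.range m, g (c + (t : ZMod m)) = ∑ i, g i := by
  refine Finset.sum_nbij' (fun t => c + (t : ZMod m)) (fun i => (i - c).val) ?_ ?_ ?_ ?_ ?_
  · intro t _; exact Finset.mem_univ _
  · intro i _; exact Finset.mem_range.2 (ZMod.val_lt _)
  · intro t ht
    rw [add_sub_cancel_left, ZMod.val_cast_of_lt (Finset.mem_range.1 ht)]
  · intro i _; simp
  · intro t _; rfl

theorem sum_range_mul_cyclic (g : ZMod m → ℂ) (c : ZMod m) (k : ℕ) :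
    ∑ t ∈ Finset.range (m * k), g (c + (t : ZMod m)) = k * ∑ i, g i := by
  induction k with
  | zero => simp
  | succ k ih =>
    rw [Nat.mul_succ, Finset.sum_range_add, ih]
    have : ∀ t : ℕ, g (c + ((m * k + t : ℕ) : ZMod m)) = g (c + (t : ZMod m)) := by
      intro t; push_cast; simp
    simp only [this, sum_range_cyclic]
    push_cast; ring

/-- An arc sum is a difference of partial sums `S`, and `S c` equals `⌊c/m⌋ |g|` plus `S` of the
remainder. A vanishing sum is thus one of the relations excluded by regularity, or a nonzero
multiple of `|g|`. -/
theorem sum_range_cyclic_ne_zero {g : ZMod m → ℂ} (hg : IsRegularParam g) (i : ZMod m) {L : ℕ}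
    (hL : 0 < L) : ∑ t ∈ Finset.range L, g (i + (t : ZMod m)) ≠ 0 := by
  intro h0
  set S : ℕ → ℂ := fun c => ∑ r ∈ Finset.range c, g (r : ZMod m) with hS
  set G := ∑ i, g i with hG
  have hSm : S m = G := by
    have := sum_range_cyclic g 0
    simpa using this
  have hIco : ∀ a b : ℕ, a ≤ b → ∑ r ∈ Finset.Ico a b, g (r : ZMod m) = S b - S a :=
    fun a b hab => Finset.sum_Ico_eq_sub _ hab
  have hdiv : ∀ c : ℕ, S c = (c / m : ℕ) * G + S (c % m) := by
    intro c
    conv_lhs => rw [← Nat.div_add_mod c m]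
    rw [hS]
    simp only
    rw [Finset.sum_range_add]
    congr 1
    · have := sum_range_mul_cyclic g 0 (c / m)
      simpa using this
    · refine Finset.sum_congr rfl fun t _ => ?_
      congr 1; push_cast; simp
  have hL' : S (i.val + L) = S i.val := by
    rw [hS]; simp only
    rw [Finset.sum_range_add, add_eq_left, ← h0]
    refine Finset.sum_congr rfl fun t _ => ?_
    congr 1; push_cast; simp
  have ha := ZMod.val_lt i
  set a := i.val with hadef
  have hr : (a + L) % m < m := Nat.mod_lt _ (NeZero.pos m)
  have hsum := Nat.div_add_mod (a + L) m
  rw [hdiv] at hL'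
  set k := (a + L) / m with hk
  set r := (a + L) % m with hrdef
  rcases lt_trichotomy r a with hlt | heq | hgt
  · rcases Nat.eq_zero_or_pos r with h | h
    · refine hg.2 (1 - k) a m (by omega) ha le_rfl ?_
      rw [hIco _ _ ha.le, hSm]
      have : S r = 0 := by rw [h]; simp [hS]
      push_cast
      linear_combination this - hL'
    · refine hg.2 k r a h hlt ha.le ?_
      rw [hIco _ _ hlt.le]
      push_cast
      linear_combination hL'
  · rw [heq, add_eq_right] at hL'
    rcases mul_eq_zero.1 hL' with h | h
    · have hk0 : k = 0 := by exact_mod_cast h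
      rw [hk0] at hsum
      omega
    · exact hg.1 h
  · rcases Nat.eq_zero_or_pos a with h | h
    · refine hg.2 (k + 1) r m (by omega) hr le_rfl ?_
      rw [hIco _ _ hr.le, hSm]
      have : S a = 0 := by rw [h]; simp [hS]
      push_cast
      linear_combination hL' + this
    · refine hg.2 (-k) a r h hgt hr.le ?_
      rw [hIco _ _ hgt.le]
      push_cast
      linear_combination -hL'

end CyclicSums

/-! ### Infinitesimal stabilizers vanish for regular `g` -/

section Rigidity

variable {m n : ℕ} [NeZero m] {d : ZMod m → ℕ}

/-- On the images of the `M_i`, which `X` and `P` preserve, `w` vanishes, so there `X_i P_i =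
P_{i+1} X_{i+1} - g_{i+1}`. Hence `X` and `P` move eigenvalues of `P_i X_i` up and down the cycle
with shifts by the `g_i`. A full turn shifts by `|g| ≠ 0`, so both motions must stop, and the two
stops produce a vanishing arc sum. -/
theorem eq_zero_of_commute {g : ZMod m → ℂ} (hg : IsRegularParam g) {q : Quad m n d}
    (hq : q ∈ levelSet n d g) {M : ZMod m → Matrix (Fin n) (Fin n) ℂ}
    (hX : ∀ i, M (i + 1) * q.X i = q.X i * M i) (hP : ∀ i, q.P i * M (i + 1) = M i * q.P i)
    (hw : ∀ i, q.w i * M i = 0) : M = 0 := by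
  rw [mem_levelSet_iff] at hq
  have hlev : ∀ i u, (q.w (i + 1)).mulVec u = 0 → (q.X i).mulVec ((q.P i).mulVec u) =
      (q.P (i + 1)).mulVec ((q.X (i + 1)).mulVec u) - g (i + 1) • u := by
    intro i u hu
    have h := congrArg (fun A => A.mulVec u) (hq (i + 1))
    simp only [add_sub_cancel_right, Matrix.sub_mulVec, ← Matrix.mulVec_mulVec, hu,
      Matrix.mulVec_zero, Matrix.smul_mulVec, Matrix.one_mulVec] at h
    rw [sub_eq_iff_eq_add.1 h]
    abel
  let E : ZMod m → ℂ → Prop := fun i x => ∃ z, (M i).mulVec z ≠ 0 ∧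
    (q.P i).mulVec ((q.X i).mulVec ((M i).mulVec z)) = x • (M i).mulVec z
  have hwz : ∀ i z, (q.w i).mulVec ((M i).mulVec z) = 0 := by
    intro i z; rw [Matrix.mulVec_mulVec, hw, Matrix.zero_mulVec]
  have hXz : ∀ i z, (q.X i).mulVec ((M i).mulVec z) = (M (i + 1)).mulVec ((q.X i).mulVec z) := by
    intro i z; rw [Matrix.mulVec_mulVec, Matrix.mulVec_mulVec, hX]
  have hPz : ∀ i z, (q.P i).mulVec ((M (i + 1)).mulVec z) = (M i).mulVec ((q.P i).mulVec z) := by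
    intro i z; rw [Matrix.mulVec_mulVec, Matrix.mulVec_mulVec, hP]
  have hup : ∀ i x, E i x → x = 0 ∨ E (i + 1) (x + g (i + 1)) := by
    rintro i x ⟨z, hz, hx⟩
    by_cases h : (q.X i).mulVec ((M i).mulVec z) = 0
    · left
      rw [h, Matrix.mulVec_zero] at hx
      exact (smul_eq_zero.1 hx.symm).resolve_right hz
    · right
      refine ⟨(q.X i).mulVec z, by rwa [← hXz], ?_⟩
      have h1 := hlev i ((M (i + 1)).mulVec ((q.X i).mulVec z)) (hwz _ _)
      rw [← hXz, hx, Matrix.mulVec_smul] at h1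
      rw [← hXz, add_smul, h1]
      abel
  have hdown : ∀ i x, E (i + 1) x → x = g (i + 1) ∨ E i (x - g (i + 1)) := by
    rintro i x ⟨z, hz, hx⟩
    have h1 := hlev i _ (hwz (i + 1) z)
    rw [hx, ← sub_smul] at h1
    by_cases h : (q.P i).mulVec ((M (i + 1)).mulVec z) = 0
    · left
      rw [h, Matrix.mulVec_zero] at h1
      exact sub_eq_zero.1 ((smul_eq_zero.1 h1.symm).resolve_right hz)
    · right
      refine ⟨(q.P i).mulVec z, by rwa [← hPz], ?_⟩
      rw [← hPz, h1, Matrix.mulVec_smul]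
  have hfin : ∀ i, {x | E i x}.Finite := by
    intro i
    refine (Module.End.finite_hasEigenvalue (Matrix.toLin' (q.P i * q.X i))).subset ?_
    rintro x ⟨z, hz, hx⟩
    refine Module.End.hasEigenvalue_of_hasEigenvector (x := (M i).mulVec z) ⟨?_, hz⟩
    rw [Module.End.mem_eigenspace_iff, Matrix.toLin'_apply, ← Matrix.mulVec_mulVec, hx]
  have hinf : ∀ (i : ZMod m) (x c : ℂ), c ≠ 0 → ¬ ∀ k : ℕ, E i (x + k * c) := by
    intro i x c hc h
    refine Set.infinite_of_injective_forall_mem (f := fun k : ℕ => x + k * c) ?_ h (hfin i)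
    intro k l hkl
    exact_mod_cast mul_right_cancel₀ hc (add_left_cancel hkl)
  have hupk : ∀ i x, E i x → ∃ k : ℕ, x + ∑ t ∈ Finset.range k, g (i + 1 + (t : ZMod m)) = 0 := by
    intro i x hE
    by_contra! hne
    have hk : ∀ k : ℕ, E (i + k) (x + ∑ t ∈ Finset.range k, g (i + 1 + (t : ZMod m))) := by
      intro k
      induction k with
      | zero => simpa using hE
      | succ k ih =>
        have := (hup _ _ ih).resolve_left (hne k)
        rw [Finset.sum_range_succ, Nat.cast_succ, ← add_assoc, ← add_assoc, add_right_comm i 1]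
        exact this
    refine hinf i x (∑ i, g i) hg.1 fun k => ?_
    have := hk (m * k)
    rw [sum_range_mul_cyclic] at this
    simpa using this
  have hdownk : ∀ i x, E i x → ∃ k : ℕ, x = ∑ t ∈ Finset.range (k + 1), g (i - (t : ZMod m)) := by
    intro i x hE
    by_contra! hne
    have hk : ∀ k : ℕ, E (i - k) (x - ∑ t ∈ Finset.range k, g (i - (t : ZMod m))) := by
      intro k
      induction k with
      | zero => simpa using hE
      | succ k ih =>
        have h1 : i - (k : ZMod m) = i - ((k + 1 : ℕ) : ZMod m) + 1 := by push_cast; ring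
        rw [h1] at ih
        have h2 := (hdown _ _ ih).resolve_left (by
          rw [← h1, sub_eq_iff_eq_add']
          have := hne k
          rwa [Finset.sum_range_succ] at this)
        rw [← h1] at h2
        rw [Finset.sum_range_succ, ← sub_sub]
        exact h2
    refine hinf i x (-∑ i, g i) (neg_ne_zero.2 hg.1) fun k => ?_
    have := hk (m * k)
    have h2 : ∑ t ∈ Finset.range (m * k), g (i - (t : ZMod m)) = k * ∑ i, g i := by
      have := sum_range_mul_cyclic (fun j => g (i - j)) 0 k
      simp only [zero_add] at this
      rw [this]
      congr 1
      exact Fintype.sum_equiv (Equiv.subLeft i) _ _ fun _ => rfl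
    rw [h2] at this
    simpa [sub_eq_add_neg] using this
  by_contra hM
  obtain ⟨i, hi⟩ := Function.ne_iff.1 hM
  have hE : ∃ x, E i x := by
    let U := (M i).mulVecLin.range
    have hU : ∀ u ∈ U, (Matrix.toLin' (q.P i * q.X i)) u ∈ U := by
      rintro _ ⟨z, rfl⟩
      refine ⟨(q.P i).mulVec ((q.X i).mulVec z), ?_⟩
      rw [Matrix.mulVecLin_apply, ← hPz, ← hXz, Matrix.toLin'_apply, ← Matrix.mulVec_mulVec,
        Matrix.mulVecLin_apply]
    have : Nontrivial U := by
      rw [Submodule.nontrivial_iff_ne_bot, Ne, LinearMap.range_eq_bot]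
      intro h
      apply hi
      ext a b
      have := congrFun (LinearMap.congr_fun h (Pi.single b 1)) a
      simpa using this
    obtain ⟨x, hx⟩ := Module.End.exists_eigenvalue ((Matrix.toLin' (q.P i * q.X i)).restrict hU)
    obtain ⟨⟨_, z, rfl⟩, hu, hu0⟩ := hx.exists_hasEigenvector
    refine ⟨x, z, fun h => hu0 (Subtype.ext h), ?_⟩
    have := congrArg Subtype.val (Module.End.mem_eigenspace_iff.1 hu)
    rw [Matrix.mulVec_mulVec]
    simpa [Matrix.mul_assoc] using this
  obtain ⟨x, hx⟩ := hE
  obtain ⟨k, hk⟩ := hupk i x hx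
  obtain ⟨l, hl⟩ := hdownk i x hx
  -- The downward arc has `l + 1` vertices, ending at `i`, and the upward arc has `k`, starting at
  -- `i + 1`. Together they form one arc of positive length with sum `x - x = 0`.
  refine sum_range_cyclic_ne_zero hg (i - (l : ZMod m)) (L := l + 1 + k) (by omega) ?_
  rw [Finset.sum_range_add, ← hk, hl, ← Finset.sum_range_reflect]
  congr 1
  · refine Finset.sum_congr rfl fun t ht => ?_
    have : t ≤ l := Nat.lt_succ_iff.1 (Finset.mem_range.1 ht)
    rw [Nat.add_sub_cancel, Nat.cast_sub this]
    congr 1; ring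
  · refine Finset.sum_congr rfl fun t _ => ?_
    congr 1; push_cast; ring

end Rigidity

/-! ### The moment map as a submersion -/

section MomentMap

variable {m n : ℕ} [NeZero m] {d : ZMod m → ℕ}

/-- The normed space of all quadruples. -/
abbrev QuadSpace (m n : ℕ) (d : ZMod m → ℕ) : Type :=
  (ZMod m → Fin n → Fin n → ℂ) × (ZMod m → Fin n → Fin n → ℂ) ×
    ((i : ZMod m) → Fin n → Fin (d i) → ℂ) × ((i : ZMod m) → Fin (d i) → Fin n → ℂ)

/-- The quadruple with the given components. -/
def QuadSpace.toQuad (p : QuadSpace m n d) : Quad m n d :=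
  ⟨fun i => Matrix.of (p.1 i), fun i => Matrix.of (p.2.1 i), fun i => Matrix.of (p.2.2.1 i),
    fun i => Matrix.of (p.2.2.2 i)⟩

theorem QuadSpace.continuous_toQuad : Continuous (QuadSpace.toQuad : QuadSpace m n d → _) :=
  continuous_induced_rng.2 continuous_id

/-- The left hand side minus the right hand side of the moment map equation. -/
def momentMap (g : ZMod m → ℂ) (p : QuadSpace m n d) : ZMod m → Fin n → Fin n → ℂ :=
  fun i => p.toQuad.X (i - 1) * p.toQuad.P (i - 1) - p.toQuad.P i * p.toQuad.X i -
    p.toQuad.v i * p.toQuad.w i + g i • 1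

theorem toQuad_mem_levelSet_iff {g : ZMod m → ℂ} {p : QuadSpace m n d} :
    p.toQuad ∈ levelSet n d g ↔ momentMap g p = 0 := by
  rw [mem_levelSet_iff, funext_iff]
  refine forall_congr' fun i => ?_
  rw [← sub_eq_zero, ← sub_add]
  rfl

theorem contDiff_momentMap (g : ZMod m → ℂ) :
    ContDiff ℂ 1 (momentMap g : QuadSpace m n d → ZMod m → Fin n → Fin n → ℂ) := by
  refine contDiff_pi.2 fun i => contDiff_pi.2 fun a => contDiff_pi.2 fun b => ?_
  have h : (fun p : QuadSpace m n d => momentMap g p i a b) = fun p =>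
      ∑ c, p.1 (i - 1) a c * p.2.1 (i - 1) c b - ∑ c, p.2.1 i a c * p.1 i c b -
      ∑ c, p.2.2.1 i a c * p.2.2.2 i c b + (g i • (1 : Matrix (Fin n) (Fin n) ℂ)) a b := by
    ext p; rfl
  rw [h]
  have hv : ContDiff ℂ 1 fun p : QuadSpace m n d => p.2.2.1 := by fun_prop
  have hw : ContDiff ℂ 1 fun p : QuadSpace m n d => p.2.2.2 := by fun_prop
  refine ContDiff.add (ContDiff.sub (ContDiff.sub ?_ ?_) ?_) contDiff_const
  · refine ContDiff.sum fun c _ => ContDiff.mul ?_ ?_ <;> fun_prop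
  · refine ContDiff.sum fun c _ => ContDiff.mul ?_ ?_ <;> fun_prop
  · exact ContDiff.sum fun c _ => ContDiff.mul
      (contDiff_pi.1 (contDiff_pi.1 (contDiff_pi.1 hv i) a) c)
      (contDiff_pi.1 (contDiff_pi.1 (contDiff_pi.1 hw i) c) b)

/-- The differential of the moment map at `p`. -/
def momentDeriv (p : QuadSpace m n d) :
    QuadSpace m n d →ₗ[ℂ] (ZMod m → Matrix (Fin n) (Fin n) ℂ) where
  toFun δ i := δ.toQuad.X (i - 1) * p.toQuad.P (i - 1) + p.toQuad.X (i - 1) * δ.toQuad.P (i - 1) -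
    (δ.toQuad.P i * p.toQuad.X i + p.toQuad.P i * δ.toQuad.X i) -
    (δ.toQuad.v i * p.toQuad.w i + p.toQuad.v i * δ.toQuad.w i)
  map_add' a b := by
    ext1 i
    have hX : ∀ i, (a + b).toQuad.X i = a.toQuad.X i + b.toQuad.X i := fun _ => rfl
    have hP : ∀ i, (a + b).toQuad.P i = a.toQuad.P i + b.toQuad.P i := fun _ => rfl
    have hv : ∀ i, (a + b).toQuad.v i = a.toQuad.v i + b.toQuad.v i := fun _ => rfl
    have hw : ∀ i, (a + b).toQuad.w i = a.toQuad.w i + b.toQuad.w i := fun _ => rfl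
    simp only [Pi.add_apply, hX, hP, hv, hw, Matrix.mul_add, Matrix.add_mul]
    abel
  map_smul' c a := by
    ext1 i
    have hX : ∀ i, (c • a).toQuad.X i = c • a.toQuad.X i := fun _ => rfl
    have hP : ∀ i, (c • a).toQuad.P i = c • a.toQuad.P i := fun _ => rfl
    have hv : ∀ i, (c • a).toQuad.v i = c • a.toQuad.v i := fun _ => rfl
    have hw : ∀ i, (c • a).toQuad.w i = c • a.toQuad.w i := fun _ => rfl
    simp only [Pi.smul_apply, hX, hP, hv, hw, Matrix.mul_smul, Matrix.smul_mul, RingHom.id_apply,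
      smul_sub, smul_add]

theorem momentDeriv_apply (p δ : QuadSpace m n d) (i : ZMod m) : momentDeriv p δ i =
    δ.toQuad.X (i - 1) * p.toQuad.P (i - 1) + p.toQuad.X (i - 1) * δ.toQuad.P (i - 1) -
      (δ.toQuad.P i * p.toQuad.X i + p.toQuad.P i * δ.toQuad.X i) -
      (δ.toQuad.v i * p.toQuad.w i + p.toQuad.v i * δ.toQuad.w i) := rfl

theorem momentMap_add_smul (g : ZMod m → ℂ) (p δ : QuadSpace m n d) (i : ZMod m) (a b : Fin n) :
    ∃ c : ℂ, ∀ t : ℂ, momentMap g (p + t • δ) i a b =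
      momentMap g p i a b + t * momentDeriv p δ i a b + t ^ 2 * c := by
  have hX : ∀ (t : ℂ) i, (p + t • δ).toQuad.X i = p.toQuad.X i + t • δ.toQuad.X i :=
    fun _ _ => rfl
  have hP : ∀ (t : ℂ) i, (p + t • δ).toQuad.P i = p.toQuad.P i + t • δ.toQuad.P i :=
    fun _ _ => rfl
  have hv : ∀ (t : ℂ) i, (p + t • δ).toQuad.v i = p.toQuad.v i + t • δ.toQuad.v i :=
    fun _ _ => rfl
  have hw : ∀ (t : ℂ) i, (p + t • δ).toQuad.w i = p.toQuad.w i + t • δ.toQuad.w i :=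
    fun _ _ => rfl
  have hm : ∀ p : QuadSpace m n d, momentMap g p i a b =
      (p.toQuad.X (i - 1) * p.toQuad.P (i - 1) - p.toQuad.P i * p.toQuad.X i -
        p.toQuad.v i * p.toQuad.w i + g i • 1 : Matrix (Fin n) (Fin n) ℂ) a b := fun _ => rfl
  refine ⟨(δ.toQuad.X (i - 1) * δ.toQuad.P (i - 1) - δ.toQuad.P i * δ.toQuad.X i -
    δ.toQuad.v i * δ.toQuad.w i) a b, fun t => ?_⟩
  simp only [hm, hX, hP, hv, hw, momentDeriv_apply, Matrix.mul_add, Matrix.add_mul,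
    Matrix.mul_smul, Matrix.smul_mul, Matrix.add_apply, Matrix.sub_apply, Matrix.smul_apply,
    smul_eq_mul]
  ring

theorem hasStrictFDerivAt_momentMap (g : ZMod m → ℂ) (p : QuadSpace m n d) :
    ∃ f' : QuadSpace m n d →L[ℂ] (ZMod m → Fin n → Fin n → ℂ),
      HasStrictFDerivAt (momentMap g) f' p ∧ ∀ δ i a b, f' δ i a b = momentDeriv p δ i a b := by
  have h := (contDiff_momentMap (n := n) (d := d) g).contDiffAt.hasStrictFDerivAt (x := p) one_ne_zero
  refine ⟨_, h, fun δ i a b => ?_⟩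
  obtain ⟨c, hc⟩ := momentMap_add_smul g p δ i a b
  have h1 : HasDerivAt (fun t : ℂ => momentMap g (p + t • δ)) (fderiv ℂ (momentMap g) p δ) 0 :=
    h.hasFDerivAt.hasLineDerivAt δ
  have h1' : HasDerivAt (fun t : ℂ => momentMap g (p + t • δ) i a b)
      (fderiv ℂ (momentMap g) p δ i a b) 0 :=
    hasDerivAt_pi.1 (hasDerivAt_pi.1 (hasDerivAt_pi.1 h1 i) a) b
  have h2 : HasDerivAt (fun t : ℂ => momentMap g (p + t • δ) i a b) (momentDeriv p δ i a b) 0 := by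
    simp only [hc]
    have e1 := ((hasDerivAt_id (0 : ℂ)).mul_const (momentDeriv p δ i a b)).const_add
      (momentMap g p i a b)
    have e2 := ((hasDerivAt_id (0 : ℂ)).fun_pow 2).mul_const c
    simpa using e1.fun_add e2
  exact h1'.unique h2

theorem exists_trace_repr (φ : (ZMod m → Matrix (Fin n) (Fin n) ℂ) →ₗ[ℂ] ℂ) :
    ∃ M : ZMod m → Matrix (Fin n) (Fin n) ℂ, ∀ A, φ A = ∑ i, (M i * A i).trace := by
  refine ⟨fun i => Matrix.of fun a b => φ (Pi.single i (Matrix.single b a 1)), fun A => ?_⟩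
  have hA : A = ∑ i, ∑ a, ∑ b, A i a b • (Pi.single i (Matrix.single a b (1 : ℂ)) :
      ZMod m → Matrix (Fin n) (Fin n) ℂ) := by
    ext j a b
    simp only [Finset.sum_apply, Pi.smul_apply, Matrix.sum_apply, Matrix.smul_apply]
    rw [Finset.sum_eq_single j, Finset.sum_eq_single a, Finset.sum_eq_single b]
    · simp
    · intro c _ hc; simp [hc]
    · simp
    · intro c _ hc; simp [hc]
    · simp
    · intro c _ hc; simp [Ne.symm hc]
    · simp
  conv_lhs => rw [hA]
  simp only [map_sum, map_smul, smul_eq_mul, Matrix.trace, Matrix.diag_apply, Matrix.mul_apply,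
    Matrix.of_apply]
  refine Finset.sum_congr rfl fun i _ => ?_
  rw [Finset.sum_comm]
  exact Finset.sum_congr rfl fun b _ => Finset.sum_congr rfl fun a _ => mul_comm _ _

theorem eq_of_sum_trace_eq {κ κ' : ZMod m → Type*} [∀ i, Fintype (κ i)] [∀ i, Fintype (κ' i)]
    {A B : (i : ZMod m) → Matrix (κ i) (κ' i) ℂ}
    (h : ∀ x : (i : ZMod m) → Matrix (κ' i) (κ i) ℂ,
      ∑ i, (A i * x i).trace = ∑ i, (B i * x i).trace) : A = B := by
  ext1 i
  refine Matrix.ext_iff_trace_mul_right.2 fun y => ?_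
  have := h (Pi.single i y)
  rw [Finset.sum_eq_single i, Finset.sum_eq_single i] at this
  · simpa using this
  · intro j _ hj; simp [hj]
  · simp
  · intro j _ hj; simp [hj]
  · simp

theorem sum_shift (f : ZMod m → ℂ) : ∑ i, f (i - 1) = ∑ i, f i :=
  Fintype.sum_equiv (Equiv.subRight 1) _ _ fun _ => rfl

/-- The equations on `M` that say that the functional `tr(M ·)` pulls back along the differential of
the moment map to `tr(Z ·)` on the component of `P`. -/
theorem conditions_of_sum_trace {p : QuadSpace m n d} {M Z : ZMod m → Matrix (Fin n) (Fin n) ℂ}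
    (h : ∀ δ : QuadSpace m n d, ∑ i, (M i * momentDeriv p δ i).trace =
      ∑ i, (Z i * δ.toQuad.P i).trace) :
    (∀ i, p.toQuad.P i * M (i + 1) = M i * p.toQuad.P i) ∧
      (∀ i, Z i = M (i + 1) * p.toQuad.X i - p.toQuad.X i * M i) ∧
      (∀ i, p.toQuad.w i * M i = 0) ∧ ∀ i, M i * p.toQuad.v i = 0 := by
  refine ⟨fun i => ?_, fun i => ?_, fun i => ?_, fun i => ?_⟩
  · refine congrFun (eq_of_sum_trace_eq (A := fun i => p.toQuad.P i * M (i + 1))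
      (B := fun i => M i * p.toQuad.P i) fun x => ?_) i
    have h1 := h (x, 0, 0, 0)
    have e : ∀ i, momentDeriv p (x, 0, 0, 0) i =
        x (i - 1) * p.toQuad.P (i - 1) - p.toQuad.P i * x i := by
      intro i
      have hX : ∀ i, (QuadSpace.toQuad ((x, 0, 0, 0) : QuadSpace m n d)).X i = x i := fun _ => rfl
      have hP : ∀ i, (QuadSpace.toQuad ((x, 0, 0, 0) : QuadSpace m n d)).P i = 0 := fun _ => rfl
      have hv : ∀ i, (QuadSpace.toQuad ((x, 0, 0, 0) : QuadSpace m n d)).v i = 0 := fun _ => rfl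
      have hw : ∀ i, (QuadSpace.toQuad ((x, 0, 0, 0) : QuadSpace m n d)).w i = 0 := fun _ => rfl
      simp [momentDeriv_apply, hX, hP, hv, hw]
    have e' : ∀ i, (QuadSpace.toQuad ((x, 0, 0, 0) : QuadSpace m n d)).P i = 0 := fun _ => rfl
    simp only [e, e', Matrix.mul_zero, Matrix.trace_zero, Finset.sum_const_zero, Matrix.mul_sub,
      Matrix.trace_sub, Finset.sum_sub_distrib] at h1
    rw [sub_eq_zero] at h1
    rw [← sum_shift]
    simp only [Matrix.mul_assoc, sub_add_cancel]
    rw [← h1]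
    exact Finset.sum_congr rfl fun i _ => by
      rw [Matrix.trace_mul_comm (p.toQuad.P (i - 1)), Matrix.mul_assoc]
  · refine congrFun (eq_of_sum_trace_eq (A := Z)
      (B := fun i => M (i + 1) * p.toQuad.X i - p.toQuad.X i * M i) fun x => ?_) i
    have h1 := h (0, x, 0, 0)
    have e : ∀ i, momentDeriv p (0, x, 0, 0) i =
        p.toQuad.X (i - 1) * x (i - 1) - x i * p.toQuad.X i := by
      intro i
      have hX : ∀ i, (QuadSpace.toQuad ((0, x, 0, 0) : QuadSpace m n d)).X i = 0 := fun _ => rfl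
      have hP : ∀ i, (QuadSpace.toQuad ((0, x, 0, 0) : QuadSpace m n d)).P i = x i := fun _ => rfl
      have hv : ∀ i, (QuadSpace.toQuad ((0, x, 0, 0) : QuadSpace m n d)).v i = 0 := fun _ => rfl
      have hw : ∀ i, (QuadSpace.toQuad ((0, x, 0, 0) : QuadSpace m n d)).w i = 0 := fun _ => rfl
      simp [momentDeriv_apply, hX, hP, hv, hw]
    have e' : ∀ i, (QuadSpace.toQuad ((0, x, 0, 0) : QuadSpace m n d)).P i = x i := fun _ => rfl
    simp only [e, e', Matrix.mul_sub, Matrix.trace_sub, Finset.sum_sub_distrib] at h1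
    rw [← h1]
    simp only [Matrix.sub_mul, Matrix.trace_sub, Finset.sum_sub_distrib]
    congr 1
    · rw [← sum_shift fun i => (M (i + 1) * p.toQuad.X i * x i).trace]
      simp only [Matrix.mul_assoc, sub_add_cancel]
    · exact Finset.sum_congr rfl fun i _ => by
        rw [Matrix.mul_assoc, Matrix.trace_mul_comm (p.toQuad.X i), Matrix.mul_assoc]
  · refine congrFun (eq_of_sum_trace_eq (A := fun i => p.toQuad.w i * M i)
      (B := fun i => 0) fun x => ?_) i
    have h1 := h (0, 0, x, 0)
    have e : ∀ i, momentDeriv p (0, 0, x, 0) i = -(x i * p.toQuad.w i) := by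
      intro i
      have hX : ∀ i, (QuadSpace.toQuad ((0, 0, x, 0) : QuadSpace m n d)).X i = 0 := fun _ => rfl
      have hP : ∀ i, (QuadSpace.toQuad ((0, 0, x, 0) : QuadSpace m n d)).P i = 0 := fun _ => rfl
      have hv : ∀ i, (QuadSpace.toQuad ((0, 0, x, 0) : QuadSpace m n d)).v i = x i := fun _ => rfl
      have hw : ∀ i, (QuadSpace.toQuad ((0, 0, x, 0) : QuadSpace m n d)).w i = 0 := fun _ => rfl
      simp [momentDeriv_apply, hX, hP, hv, hw]
    have e' : ∀ i, (QuadSpace.toQuad ((0, 0, x, 0) : QuadSpace m n d)).P i = 0 := fun _ => rfl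
    simp only [e, e', Matrix.mul_zero, Matrix.trace_zero, Finset.sum_const_zero, Matrix.mul_neg,
      Matrix.trace_neg, Finset.sum_neg_distrib, neg_eq_zero] at h1
    simp only [Matrix.zero_mul, Matrix.trace_zero, Finset.sum_const_zero]
    rw [← h1]
    exact Finset.sum_congr rfl fun i _ => by
      rw [Matrix.mul_assoc, Matrix.trace_mul_comm, Matrix.mul_assoc]
  · refine congrFun (eq_of_sum_trace_eq (A := fun i => M i * p.toQuad.v i)
      (B := fun i => 0) fun x => ?_) i
    have h1 := h (0, 0, 0, x)
    have e : ∀ i, momentDeriv p (0, 0, 0, x) i = -(p.toQuad.v i * x i) := by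
      intro i
      have hX : ∀ i, (QuadSpace.toQuad ((0, 0, 0, x) : QuadSpace m n d)).X i = 0 := fun _ => rfl
      have hP : ∀ i, (QuadSpace.toQuad ((0, 0, 0, x) : QuadSpace m n d)).P i = 0 := fun _ => rfl
      have hv : ∀ i, (QuadSpace.toQuad ((0, 0, 0, x) : QuadSpace m n d)).v i = 0 := fun _ => rfl
      have hw : ∀ i, (QuadSpace.toQuad ((0, 0, 0, x) : QuadSpace m n d)).w i = x i := fun _ => rfl
      simp [momentDeriv_apply, hX, hP, hv, hw]
    have e' : ∀ i, (QuadSpace.toQuad ((0, 0, 0, x) : QuadSpace m n d)).P i = 0 := fun _ => rfl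
    simp only [e, e', Matrix.mul_zero, Matrix.trace_zero, Finset.sum_const_zero, Matrix.mul_neg,
      Matrix.trace_neg, Finset.sum_neg_distrib, neg_eq_zero] at h1
    simp only [Matrix.zero_mul, Matrix.trace_zero, Finset.sum_const_zero, Matrix.mul_assoc]
    exact h1

/-- Under the trace pairing a functional that kills the range of the differential is an
infinitesimal stabilizer of the data, and `eq_zero_of_commute` applies. -/
theorem momentDeriv_surjective {g : ZMod m → ℂ} (hg : IsRegularParam g) {p : QuadSpace m n d}
    (hp : p.toQuad ∈ levelSet n d g) : Function.Surjective (momentDeriv p) := by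
  rw [← LinearMap.range_eq_top]
  by_contra hne
  obtain ⟨φ, hφ, hle⟩ := Submodule.exists_le_ker_of_lt_top _ (lt_top_iff_ne_top.2 hne)
  obtain ⟨M, hM⟩ := exists_trace_repr φ
  obtain ⟨h1, h2, h3, h4⟩ := conditions_of_sum_trace (p := p) (M := M) (Z := 0) (by
    intro δ
    rw [← hM]
    simpa using hle (LinearMap.mem_range_self _ δ))
  have hM0 : M = 0 := eq_zero_of_commute hg hp (fun i => sub_eq_zero.1 (h2 i).symm) h1 h3
  refine hφ (LinearMap.ext fun A => ?_)
  rw [hM, hM0]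
  simp

theorem exists_curve_levelSet {g : ZMod m → ℂ} (hg : IsRegularParam g) {p δ : QuadSpace m n d}
    (hp : p.toQuad ∈ levelSet n d g) (hδ : momentDeriv p δ = 0) :
    ∃ γ : ℂ → QuadSpace m n d, γ 0 = p ∧ HasDerivAt γ δ 0 ∧
      ∀ᶠ t in 𝓝 0, (γ t).toQuad ∈ levelSet n d g := by
  obtain ⟨f', hf', hfd⟩ := hasStrictFDerivAt_momentMap g p
  obtain ⟨γ, h0, hγ, hlev⟩ := exists_curve (δ := δ) hf' (by
    intro A
    obtain ⟨x, hx⟩ := momentDeriv_surjective hg hp A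
    refine ⟨x, ?_⟩
    ext i a b
    rw [hfd, hx]) (by
    ext i a b
    rw [hfd, hδ]
    rfl)
  refine ⟨γ, h0, hγ, hlev.mono fun t ht => ?_⟩
  rw [toQuad_mem_levelSet_iff, ht, ← toQuad_mem_levelSet_iff]
  exact hp

/-- A functional of the component of `P` that vanishes on the tangent space of the level set. -/
theorem exists_moment_multiplier {p : QuadSpace m n d} {Z : ZMod m → Matrix (Fin n) (Fin n) ℂ}
    (h : ∀ δ : QuadSpace m n d, momentDeriv p δ = 0 → ∑ i, (Z i * δ.toQuad.P i).trace = 0) :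
    ∃ M : ZMod m → Matrix (Fin n) (Fin n) ℂ,
      (∀ i, p.toQuad.P i * M (i + 1) = M i * p.toQuad.P i) ∧
      (∀ i, Z i = M (i + 1) * p.toQuad.X i - p.toQuad.X i * M i) ∧
      (∀ i, p.toQuad.w i * M i = 0) ∧ ∀ i, M i * p.toQuad.v i = 0 := by
  let f : QuadSpace m n d →ₗ[ℂ] ℂ :=
    { toFun := fun δ => ∑ i, (Z i * δ.toQuad.P i).trace
      map_add' := by
        intro a b
        have hP : ∀ i, (a + b).toQuad.P i = a.toQuad.P i + b.toQuad.P i := fun _ => rfl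
        simp only [hP, Matrix.mul_add, Matrix.trace_add, Finset.sum_add_distrib]
      map_smul' := by
        intro c a
        have hP : ∀ i, (c • a).toQuad.P i = c • a.toQuad.P i := fun _ => rfl
        simp only [hP, Matrix.mul_smul, Matrix.trace_smul, Finset.smul_sum, RingHom.id_apply] }
  -- A functional that vanishes on the kernel of a linear map factors through the map; the factor is
  -- the Lagrange multiplier `M`.
  have hf : f ∈ (momentDeriv p).dualMap.range := by
    rw [LinearMap.range_dualMap_eq_dualAnnihilator_ker, Submodule.mem_dualAnnihilator]
    exact h
  obtain ⟨φ, hφ⟩ := hf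
  obtain ⟨M, hM⟩ := exists_trace_repr φ
  refine ⟨M, conditions_of_sum_trace fun δ => ?_⟩
  rw [← hM]
  exact LinearMap.congr_fun hφ δ

end MomentMap

/-! ### The Fitting projection and its commutator with `X` -/

/-- The projection onto the generalized kernel of a matrix as a polynomial in the matrix. -/
theorem exists_fitting_polynomial {ι : Type*} [Fintype ι] [DecidableEq ι] (Q : Matrix ι ι ℂ) :
    ∃ f r : Polynomial ℂ, Q ^ Fintype.card ι * Polynomial.aeval Q f = 0 ∧
      Polynomial.aeval Q f * Polynomial.aeval Q f = Polynomial.aeval Q f ∧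
      Polynomial.aeval Q (Polynomial.derivative f) = 0 ∧
      Q * Polynomial.aeval Q r = 1 - Polynomial.aeval Q f := by
  open Polynomial in
  obtain ⟨p, hp, hdvd⟩ := exists_eq_pow_rootMultiplicity_mul_and_not_dvd Q.charpoly
    Q.charpoly_monic.ne_zero 0
  rw [C_0, sub_zero] at hp hdvd
  set a := rootMultiplicity 0 Q.charpoly with ha
  have ha' : a ≤ Fintype.card ι := by
    have h1 := Q.charpoly_natDegree_eq_dim
    have hp0 : p ≠ 0 := by rintro rfl; simp at hdvd
    rw [hp, natDegree_mul (pow_ne_zero _ X_ne_zero) hp0, natDegree_X_pow] at h1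
    omega
  have hcop : IsCoprime (X : ℂ[X]) p :=
    (irreducible_X.coprime_iff_not_dvd).2 hdvd
  have h0 : ∀ h : ℂ[X], Q.charpoly ∣ h → aeval Q h = 0 := fun h hh =>
    aeval_eq_zero_of_dvd_aeval_eq_zero hh Q.aeval_self_charpoly
  -- The characteristic polynomial is `X^a p`. One extra power of each factor is used so that `f = v
  -- p² = 1 - u X^{a+1}` has a derivative divisible by both `X^a` and `p`; thus `f'` kills `Q`.
  obtain ⟨u, v, huv⟩ : IsCoprime (X ^ (a + 1) : ℂ[X]) (p ^ 2) := hcop.pow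
  refine ⟨v * p ^ 2, u * X ^ a, ?_, ?_, ?_, ?_⟩
  · have h1 : aeval Q (X ^ Fintype.card ι * (v * p ^ 2)) = 0 := by
      refine h0 _ ?_
      rw [hp]
      obtain ⟨b, hb⟩ := Nat.exists_eq_add_of_le ha'
      rw [hb]
      exact ⟨X ^ b * v * p, by ring⟩
    simpa using h1
  · rw [← map_mul, ← sub_eq_zero, ← map_sub]
    refine h0 _ ?_
    rw [hp]
    refine ⟨-(u * v * X * p), ?_⟩
    have : v * p ^ 2 = 1 - u * X ^ (a + 1) := by rw [← huv]; ring
    calc v * p ^ 2 * (v * p ^ 2) - v * p ^ 2 = v * p ^ 2 * (v * p ^ 2 - 1) := by ring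
      _ = v * p ^ 2 * (1 - u * X ^ (a + 1) - 1) := by rw [this]
      _ = _ := by ring
  · refine h0 _ ?_
    rw [hp]
    refine IsCoprime.mul_dvd hcop.pow_left ?_ ?_
    · have : v * p ^ 2 = 1 - u * X ^ (a + 1) := by rw [← huv]; ring
      rw [this]
      simp only [derivative_sub, derivative_one, derivative_mul, derivative_X_pow,
        Nat.add_sub_cancel]
      exact ⟨-(derivative u * X + u * C ((a + 1 : ℕ) : ℂ)), by ring⟩
    · rw [derivative_mul, pow_two, derivative_mul]
      exact ⟨derivative v * p + 2 * v * derivative p, by ring⟩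
  · have : aeval Q (X * (u * X ^ a)) = aeval Q (1 - v * p ^ 2) := by
      congr 1
      rw [← huv]; ring
    simpa using this

section Telescoping

variable {m n : ℕ} [NeZero m]

theorem blk_pow_mul_diagonal (P : ZMod m → Matrix (Fin n) (Fin n) ℂ) (g : ZMod m → ℂ) (k : ℕ) :
    blk 1 P ^ k * Matrix.diagonal (fun x : ZMod m × Fin n => g x.1) =
      Matrix.diagonal (fun x : ZMod m × Fin n => g (x.1 + k)) * blk 1 P ^ k := by
  induction k generalizing g with
  | zero => simp
  | succ k ih =>
    have h1 : blk 1 P * Matrix.diagonal (fun x : ZMod m × Fin n => g x.1) =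
        Matrix.diagonal (fun x : ZMod m × Fin n => g (x.1 + 1)) * blk 1 P := by
      ext a b
      rw [Matrix.mul_diagonal, Matrix.diagonal_mul, blk_apply]
      split_ifs with h
      · rw [h, mul_comm]
      · simp
    rw [pow_succ, Matrix.mul_assoc, h1, ← Matrix.mul_assoc, ih (fun i => g (i + 1)),
      Matrix.mul_assoc]
    congr 2
    ext x
    rw [add_assoc]
    push_cast
    rfl

variable {P : ZMod m → Matrix (Fin n) (Fin n) ℂ} {g : ZMod m → ℂ}
  {M X U : Matrix (ZMod m × Fin n) (ZMod m × Fin n) ℂ}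

/-- The Leibniz rule. Since `M` commutes with `P` and kills `U`, each commutator `[P, X]`
contributes only the diagonal `g`, and moving powers of `P` past it shifts the index. -/
theorem mul_pow_commutator
    (hX : blk 1 P * X - X * blk 1 P = Matrix.diagonal (fun x : ZMod m × Fin n => g x.1) - U)
    (hM : M * blk 1 P = blk 1 P * M) (hU : M * U = 0) (k : ℕ) :
    M * (blk 1 P ^ (k + 1) * X - X * blk 1 P ^ (k + 1)) =
      M * Matrix.diagonal (fun x : ZMod m × Fin n => ∑ t ∈ Finset.range (k + 1), g (x.1 + t)) *
        blk 1 P ^ k := by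
  have hMk : ∀ k : ℕ, M * blk 1 P ^ k = blk 1 P ^ k * M := fun k => (Commute.pow_right hM k)
  have hstep : ∀ k : ℕ, M * blk 1 P ^ k * (blk 1 P * X - X * blk 1 P) =
      M * Matrix.diagonal (fun x : ZMod m × Fin n => g (x.1 + k)) * blk 1 P ^ k := by
    intro k
    rw [hX, Matrix.mul_sub, Matrix.mul_assoc M, blk_pow_mul_diagonal, hMk, Matrix.mul_assoc _ M, hU,
      Matrix.mul_zero, sub_zero, Matrix.mul_assoc]
  induction k with
  | zero =>
    have := hstep 0
    simpa using this
  | succ k ih =>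
    have h1 : M * (blk 1 P ^ (k + 1 + 1) * X - X * blk 1 P ^ (k + 1 + 1)) =
        M * blk 1 P ^ (k + 1) * (blk 1 P * X - X * blk 1 P) +
        M * (blk 1 P ^ (k + 1) * X - X * blk 1 P ^ (k + 1)) * blk 1 P := by
      rw [pow_succ _ (k + 1)]
      noncomm_ring
    rw [h1, hstep, ih]
    have h2 : Matrix.diagonal (fun x : ZMod m × Fin n => ∑ t ∈ Finset.range (k + 1 + 1), g (x.1 + t)) =
        Matrix.diagonal (fun x : ZMod m × Fin n => ∑ t ∈ Finset.range (k + 1), g (x.1 + t)) +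
        Matrix.diagonal (fun x : ZMod m × Fin n => g (x.1 + ((k + 1 : ℕ) : ZMod m))) := by
      rw [Matrix.diagonal_add]
      congr 1
      ext x
      rw [Finset.sum_range_succ]
    rw [h2, Matrix.mul_add, Matrix.add_mul, add_comm, pow_succ _ k]
    simp only [Matrix.mul_assoc]

/-- For exponents divisible by `m` the arc sums in `mul_pow_commutator` are multiples of `|g|`, so
`[·, X]` acts on polynomials in `P^m` like a derivation. -/
theorem mul_aeval_commutator
    (hX : blk 1 P * X - X * blk 1 P = Matrix.diagonal (fun x : ZMod m × Fin n => g x.1) - U)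
    (hM : M * blk 1 P = blk 1 P * M) (hU : M * U = 0) (f : Polynomial ℂ) :
    M * (Polynomial.aeval (blk 1 P ^ m) f * X - X * Polynomial.aeval (blk 1 P ^ m) f) =
      (∑ i, g i) • (M * Polynomial.aeval (blk 1 P ^ m) (Polynomial.derivative f) *
        blk 1 P ^ (m - 1)) := by
  have hpow : ∀ k : ℕ, M * ((blk 1 P ^ m) ^ k * X - X * (blk 1 P ^ m) ^ k) =
      ((∑ i, g i) * k) • (M * (blk 1 P ^ m) ^ (k - 1) * blk 1 P ^ (m - 1)) := by
    intro k
    rcases Nat.eq_zero_or_pos k with hk | hk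
    · subst hk; simp
    · have h1 := mul_pow_commutator hX hM hU (m * k - 1)
      have hmk : m * k - 1 + 1 = m * k :=
        Nat.sub_add_cancel (Nat.mul_pos (NeZero.pos m) hk)
      rw [hmk] at h1
      simp only [sum_range_mul_cyclic] at h1
      have h2 : Matrix.diagonal (fun _ : ZMod m × Fin n => (k : ℂ) * ∑ i, g i) =
          ((k : ℂ) * ∑ i, g i) • 1 := by
        rw [Matrix.smul_one_eq_diagonal]
      have h3 : m * k - 1 = m * (k - 1) + (m - 1) := by
        have := NeZero.pos m
        obtain ⟨k, rfl⟩ := Nat.exists_eq_succ_of_ne_zero hk.ne'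
        rw [Nat.succ_sub_one, Nat.mul_succ]
        omega
      rw [← pow_mul, h1, h2, Matrix.mul_smul, Matrix.mul_one, Matrix.smul_mul, mul_comm (k : ℂ), h3,
        pow_add, pow_mul, Matrix.mul_assoc]
  induction f using Polynomial.induction_on' with
  | add p q hp hq =>
    simp only [map_add, Matrix.add_mul, Matrix.mul_add, smul_add]
    rw [← hp, ← hq]
    noncomm_ring
  | monomial k c =>
    rw [Polynomial.derivative_monomial, Polynomial.aeval_monomial, Polynomial.aeval_monomial,
      ← Algebra.smul_def, ← Algebra.smul_def, Matrix.smul_mul, Matrix.mul_smul, ← smul_sub,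
      Matrix.mul_smul, hpow, Matrix.mul_smul, Matrix.smul_mul, smul_smul, smul_smul]
    congr 1
    ring

end Telescoping

/-! ### Homogeneous parts of the centralizer of `P` -/

section GradedCentralizer

variable {m n : ℕ} [NeZero m]

/-- The homogeneous endomorphisms that commute with `P`. -/
def gradedCentralizer (P : ZMod m → Matrix (Fin n) (Fin n) ℂ) (l : ZMod m) :
    Submodule ℂ (Matrix (ZMod m × Fin n) (ZMod m × Fin n) ℂ) where
  carrier := {B | (∃ A, B = blk l A) ∧ B * blk 1 P = blk 1 P * B}
  add_mem' := by
    rintro _ _ ⟨⟨A, rfl⟩, hA⟩ ⟨⟨B, rfl⟩, hB⟩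
    exact ⟨⟨A + B, (blk_add _ _ _).symm⟩, by rw [add_mul, mul_add, hA, hB]⟩
  zero_mem' := ⟨⟨0, (blk_zero _).symm⟩, by simp⟩
  smul_mem' := by
    rintro c _ ⟨⟨A, rfl⟩, hA⟩
    exact ⟨⟨c • A, (blk_smul _ _ _).symm⟩, by rw [Matrix.smul_mul, Matrix.mul_smul, hA]⟩

/-- The trace form on families of matrices. -/
def traceForm (m n : ℕ) [NeZero m] : LinearMap.BilinForm ℂ (ZMod m → Matrix (Fin n) (Fin n) ℂ) :=
  LinearMap.mk₂ ℂ (fun A B => ∑ i, (A i * B i).trace)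
    (by intros; simp [Matrix.add_mul, Finset.sum_add_distrib])
    (by intros; simp [Finset.mul_sum])
    (by intros; simp [Matrix.mul_add, Finset.sum_add_distrib])
    (by intros; simp [Finset.mul_sum])

theorem traceForm_apply (A B : ZMod m → Matrix (Fin n) (Fin n) ℂ) :
    traceForm m n A B = ∑ i, (A i * B i).trace := rfl

theorem traceForm_comm (A B : ZMod m → Matrix (Fin n) (Fin n) ℂ) :
    traceForm m n A B = traceForm m n B A :=
  Finset.sum_congr rfl fun _ _ => Matrix.trace_mul_comm _ _

theorem traceForm_nondegenerate : (traceForm m n).Nondegenerate := by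
  have h : ∀ A, (∀ B, traceForm m n A B = 0) → A = 0 := by
    intro A hA
    refine eq_of_sum_trace_eq (A := A) (B := fun _ => 0) fun x => ?_
    rw [← traceForm_apply, hA]
    simp
  exact ⟨h, fun A hA => h A fun B => by rw [traceForm_comm]; exact hA B⟩

/-- Under the trace form, commutation with `P` from degree `-1` to `0` is adjoint to commutation
from degree `0` to `1`. Its kernel is therefore the orthogonal of the other range, and all
homogeneous spaces have the same dimension. -/
theorem finrank_gradedCentralizer (P : ZMod m → Matrix (Fin n) (Fin n) ℂ) :
    Module.finrank ℂ (gradedCentralizer P 0) = Module.finrank ℂ (gradedCentralizer P (-1)) := by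
  let ad0 : (ZMod m → Matrix (Fin n) (Fin n) ℂ) →ₗ[ℂ] (ZMod m → Matrix (Fin n) (Fin n) ℂ) :=
    { toFun := fun A i => A i * P i - P i * A (i + 1)
      map_add' := by
        intros; ext1 i; simp only [Pi.add_apply, Matrix.add_mul, Matrix.mul_add]; abel
      map_smul' := by
        intros; ext1 i
        simp only [Pi.smul_apply, Matrix.smul_mul, Matrix.mul_smul, RingHom.id_apply, smul_sub] }
  let ad1 : (ZMod m → Matrix (Fin n) (Fin n) ℂ) →ₗ[ℂ] (ZMod m → Matrix (Fin n) (Fin n) ℂ) :=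
    { toFun := fun A i => P i * A i - A (i - 1) * P (i - 1)
      map_add' := by
        intros; ext1 i; simp only [Pi.add_apply, Matrix.add_mul, Matrix.mul_add]; abel
      map_smul' := by
        intros; ext1 i
        simp only [Pi.smul_apply, Matrix.smul_mul, Matrix.mul_smul, RingHom.id_apply, smul_sub] }
  let b0 : (ZMod m → Matrix (Fin n) (Fin n) ℂ) →ₗ[ℂ]
      Matrix (ZMod m × Fin n) (ZMod m × Fin n) ℂ :=
    { toFun := blk 0, map_add' := blk_add 0, map_smul' := blk_smul 0 }
  let b1 : (ZMod m → Matrix (Fin n) (Fin n) ℂ) →ₗ[ℂ]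
      Matrix (ZMod m × Fin n) (ZMod m × Fin n) ℂ :=
    { toFun := fun A => blk (-1) fun i => A (i - 1)
      map_add' := fun A B => blk_add (-1) (fun i => A (i - 1)) fun i => B (i - 1)
      map_smul' := fun c A => blk_smul (-1) c fun i => A (i - 1) }
  have hb0 : Function.Injective b0 := blk_injective 0
  have hb1 : Function.Injective b1 := by
    intro A B h
    have h1 := blk_injective (-1) (show blk (-1) (fun i => A (i - 1)) =
      blk (-1) (fun i => B (i - 1)) from h)
    ext1 i
    simpa using congrFun h1 (i + 1)
  have h0 : gradedCentralizer P 0 = ad0.ker.map b0 := by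
    ext B
    constructor
    · rintro ⟨⟨A, rfl⟩, hA⟩
      refine ⟨A, ?_, rfl⟩
      rw [blk_mul, blk_mul, zero_add, add_zero] at hA
      have := blk_injective _ hA
      rw [SetLike.mem_coe, LinearMap.mem_ker]
      ext1 i
      have := congrFun this i
      simp only [add_zero] at this
      exact sub_eq_zero.2 this
    · rintro ⟨A, hA, rfl⟩
      refine ⟨⟨A, rfl⟩, ?_⟩
      change blk 0 A * blk 1 P = blk 1 P * blk 0 A
      rw [blk_mul, blk_mul, zero_add, add_zero]
      congr 1
      ext1 i
      have := sub_eq_zero.1 (congrFun (LinearMap.mem_ker.1 hA) i)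
      simpa using this
  have h1 : gradedCentralizer P (-1) = ad1.ker.map b1 := by
    ext B
    constructor
    · rintro ⟨⟨A, rfl⟩, hA⟩
      refine ⟨fun i => A (i + 1), ?_, ?_⟩
      · rw [blk_mul, blk_mul, neg_add_cancel, add_neg_cancel] at hA
        have := blk_injective _ hA
        rw [SetLike.mem_coe, LinearMap.mem_ker]
        ext1 i
        have := congrFun this i
        refine sub_eq_zero.2 ?_
        simpa [← sub_eq_add_neg] using this.symm
      · change blk (-1) (fun i => A (i - 1 + 1)) = _
        simp
    · rintro ⟨A, hA, rfl⟩
      refine ⟨⟨fun i => A (i - 1), rfl⟩, ?_⟩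
      change blk (-1) (fun i => A (i - 1)) * blk 1 P = blk 1 P * blk (-1) (fun i => A (i - 1))
      rw [blk_mul, blk_mul, neg_add_cancel, add_neg_cancel]
      congr 1
      ext1 i
      have := sub_eq_zero.1 (congrFun (LinearMap.mem_ker.1 hA) i)
      simpa [← sub_eq_add_neg] using this.symm
  have horth : ad1.ker = (traceForm m n).orthogonal ad0.range := by
    have hadj : ∀ A Z, traceForm m n (ad0 A) Z = traceForm m n (ad1 Z) A := by
      intro A Z
      have e0 : ∀ i, (ad0 A i * Z i).trace =
          (P i * Z i * A i).trace - (Z i * P i * A (i + 1)).trace := by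
        intro i
        change ((A i * P i - P i * A (i + 1)) * Z i).trace = _
        rw [Matrix.sub_mul, Matrix.trace_sub, Matrix.mul_assoc, Matrix.trace_mul_comm (A i),
          Matrix.trace_mul_comm (P i * A (i + 1)), ← Matrix.mul_assoc (Z i)]
      have e1 : ∀ i, (ad1 Z i * A i).trace =
          (P i * Z i * A i).trace - (Z (i - 1) * P (i - 1) * A i).trace := by
        intro i
        change ((P i * Z i - Z (i - 1) * P (i - 1)) * A i).trace = _
        rw [Matrix.sub_mul, Matrix.trace_sub]
      simp only [traceForm_apply, e0, e1, Finset.sum_sub_distrib]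
      congr 1
      rw [← sum_shift]
      simp only [sub_add_cancel]
    ext Z
    rw [LinearMap.mem_ker, LinearMap.BilinForm.mem_orthogonal_iff]
    constructor
    · rintro hZ _ ⟨A, rfl⟩
      change traceForm m n (ad0 A) Z = 0
      rw [hadj, hZ, map_zero, LinearMap.zero_apply]
    · intro h
      refine traceForm_nondegenerate.1 _ fun A => ?_
      rw [← hadj]
      exact h _ ⟨A, rfl⟩
  rw [h0, h1, ← (Submodule.equivMapOfInjective b0 hb0 _).finrank_eq,
    ← (Submodule.equivMapOfInjective b1 hb1 _).finrank_eq, horth,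
    LinearMap.BilinForm.finrank_orthogonal traceForm_nondegenerate]
  have := ad0.finrank_range_add_finrank_ker
  omega

end GradedCentralizer

/-! ### Points with invertible `P` are dense -/

section InvertibleDense

variable {m n : ℕ} [NeZero m] {d : ZMod m → ℕ}

theorem blk_pow (P : ZMod m → Matrix (Fin n) (Fin n) ℂ) (k : ℕ) :
    ∃ A, blk 1 P ^ k = blk (k : ZMod m) A := by
  induction k with
  | zero => exact ⟨1, by rw [pow_zero, Nat.cast_zero, blk_one]⟩
  | succ k ih =>
    obtain ⟨A, hA⟩ := ih
    exact ⟨_, by rw [pow_succ, hA, blk_mul, Nat.cast_succ]⟩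

theorem blk_aeval_pow (P : ZMod m → Matrix (Fin n) (Fin n) ℂ) (f : Polynomial ℂ) :
    ∃ A, Polynomial.aeval (blk 1 P ^ m) f = blk 0 A := by
  induction f using Polynomial.induction_on' with
  | add p q hp hq =>
    obtain ⟨A, hA⟩ := hp
    obtain ⟨B, hB⟩ := hq
    exact ⟨A + B, by rw [map_add, hA, hB, blk_add]⟩
  | monomial k c =>
    obtain ⟨A, hA⟩ := blk_pow P (m * k)
    refine ⟨c • A, ?_⟩
    rw [Polynomial.aeval_monomial, ← Algebra.smul_def, ← pow_mul, hA, blk_smul]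
    simp

theorem blk_zero_mul_bigV {q : Quad m n d} {M : ZMod m → Matrix (Fin n) (Fin n) ℂ}
    (h : ∀ i, M i * q.v i = 0) : blk 0 M * q.bigV = 0 := by
  ext ⟨i, a⟩ ⟨j, b⟩
  simp only [Matrix.mul_apply, Fintype.sum_prod_type, blk_apply, Quad.bigV, Matrix.of_apply,
    add_zero, Matrix.zero_apply, ite_mul, zero_mul, mul_ite, mul_zero]
  rw [Finset.sum_eq_single i]
  · simp only [if_true]
    by_cases hij : i = j
    · subst hij
      have := congrFun (congrFun (h i) a) b
      simpa [Matrix.mul_apply] using this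
    · simp [hij]
  · intro c _ hc; simp [hc]
  · simp

theorem bigW_mul_blk_zero {q : Quad m n d} {M : ZMod m → Matrix (Fin n) (Fin n) ℂ}
    (h : ∀ i, q.w i * M i = 0) : q.bigW * blk 0 M = 0 := by
  ext ⟨j, b⟩ ⟨i, a⟩
  simp only [Matrix.mul_apply, Fintype.sum_prod_type, blk_apply, Quad.bigW, Matrix.of_apply,
    add_zero, Matrix.zero_apply, ite_mul, zero_mul, mul_ite, mul_zero]
  rw [Finset.sum_eq_single j]
  · simp only [if_true]
    by_cases hij : i = j
    · subst hij
      have := congrFun (congrFun (h i) b) a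
      simpa [Matrix.mul_apply] using this
    · simp [hij]
  · intro c _ hc; simp [hc]
  · simp

/-- If the differential of `P` along the level set is orthogonal to the endomorphisms of the
generalized kernel of `P` that commute with `P`, then `P` is invertible. -/
theorem det_bigP_ne_zero_of_trace_eq_zero {g : ZMod m → ℂ} (hg : ∑ i, g i ≠ 0)
    {p : QuadSpace m n d} (hp : p.toQuad ∈ levelSet n d g)
    (h : ∀ δ : QuadSpace m n d, momentDeriv p δ = 0 →
      ∀ e Z, p.toQuad.bigP ^ (m * Fintype.card (ZMod m × Fin n)) * e = 0 →
        p.toQuad.bigP * e = e * p.toQuad.bigP → p.toQuad.bigP * Z = Z * p.toQuad.bigP →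
        (Z * δ.toQuad.bigP * e).trace = 0) : p.toQuad.bigP.det ≠ 0 := by
  have hlev : p.toQuad.bigX * p.toQuad.bigP - p.toQuad.bigP * p.toQuad.bigX =
    p.toQuad.bigV * p.toQuad.bigW - Matrix.diagonal fun a : ZMod m × Fin n => g a.1 := hp
  set P := p.toQuad.P with hPdef
  rw [Quad.bigP_eq] at *
  set X := p.toQuad.bigX with hXdef
  set Q := blk 1 P ^ m with hQ
  obtain ⟨f, r, hQe, hee, hf', hr⟩ := exists_fitting_polynomial Q
  set e := Polynomial.aeval Q f with he
  set R := Polynomial.aeval Q r with hR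
  have hcomm : ∀ (B : Matrix (ZMod m × Fin n) (ZMod m × Fin n) ℂ), blk 1 P * B = B * blk 1 P →
      ∀ f : Polynomial ℂ, Polynomial.aeval Q f * B = B * Polynomial.aeval Q f := by
    intro B hB f
    have h1 : Commute B Q := Commute.pow_right hB.symm m
    induction f using Polynomial.induction_on' with
    | add p q hp hq => rw [map_add, add_mul, mul_add, hp, hq]
    | monomial k c =>
      rw [Polynomial.aeval_monomial, ← Algebra.smul_def, Matrix.smul_mul, Matrix.mul_smul,
        (h1.pow_right k).eq]
  have heP : blk 1 P * e = e * blk 1 P := (hcomm _ rfl f).symm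
  have hRP : blk 1 P * R = R * blk 1 P := (hcomm _ rfl r).symm
  have heL : blk 1 P ^ (m * Fintype.card (ZMod m × Fin n)) * e = 0 := by
    rw [pow_mul]; exact hQe
  have hX' : blk 1 P * X - X * blk 1 P =
      Matrix.diagonal (fun x : ZMod m × Fin n => g x.1) - p.toQuad.bigV * p.toQuad.bigW := by
    rw [← neg_sub, hlev, neg_sub]
  obtain ⟨E, hE⟩ := blk_aeval_pow P f
  obtain ⟨R', hR'⟩ := blk_aeval_pow P r
  obtain ⟨T, hT⟩ := blk_pow P (m - 1)
  have hm1 : ((m - 1 : ℕ) : ZMod m) = -1 := by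
    rw [Nat.cast_sub (NeZero.pos m)]; simp
  rw [hm1] at hT
  have hmm : blk 1 P ^ (m - 1) * blk 1 P = Q := by
    rw [← pow_succ, Nat.sub_add_cancel (NeZero.pos m)]
  -- The aim is `1 ∈ A`, that is `e v = 0`. It will follow from a dimension count against the
  -- centralizer in degree `-1`.
  let A : Submodule ℂ (Matrix (ZMod m × Fin n) (ZMod m × Fin n) ℂ) :=
    { carrier := {B | B ∈ gradedCentralizer P 0 ∧ B * e * p.toQuad.bigV = 0 ∧
        p.toQuad.bigW * (B * e) = 0}
      add_mem' := by
        rintro B C ⟨hB, hB1, hB2⟩ ⟨hC, hC1, hC2⟩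
        exact ⟨add_mem hB hC, by rw [add_mul, Matrix.add_mul, hB1, hC1, add_zero],
          by rw [add_mul, Matrix.mul_add, hB2, hC2, add_zero]⟩
      zero_mem' := ⟨zero_mem _, by simp, by simp⟩
      smul_mem' := by
        rintro c B ⟨hB, hB1, hB2⟩
        exact ⟨Submodule.smul_mem _ c hB, by simp [hB1], by simp [hB2]⟩ }
  -- `F` is tailored to hit all of degree `-1`: commutators with `X` cover the part on the
  -- generalized kernel, multiplication by `P^{m-1}` the part where `P` is invertible.
  let F : Matrix (ZMod m × Fin n) (ZMod m × Fin n) ℂ →ₗ[ℂ]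
      Matrix (ZMod m × Fin n) (ZMod m × Fin n) ℂ :=
    { toFun := fun B => (B * e * X - X * (B * e)) + blk 1 P ^ (m - 1) * B * (1 - e)
      map_add' := by intros; noncomm_ring
      map_smul' := by
        intros
        simp only [Matrix.smul_mul, Matrix.mul_smul, RingHom.id_apply, smul_add, smul_sub] }
  have hsub : gradedCentralizer P (-1) ≤ A.map F := by
    rintro Z ⟨⟨Z1, hZ1⟩, hZ⟩
    have hZe : e * Z = Z * e := hcomm Z hZ.symm f
    obtain ⟨Z2, hZ2⟩ : ∃ Z2 : ZMod m → Matrix (Fin n) (Fin n) ℂ,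
        Z * e = blk (-1) fun i => Z2 (i - 1) := by
      refine ⟨fun i => Z1 (i + 1) * E i, ?_⟩
      rw [hZ1, he, hE, blk_mul, add_zero]
      congr 1
      ext1 i
      change Z1 i * E (i + -1) = Z1 (i - 1 + 1) * E (i - 1)
      rw [sub_add_cancel, sub_eq_add_neg]
    obtain ⟨M, hM1, hM2, hM3, hM4⟩ := exists_moment_multiplier (p := p) (Z := Z2) (by
      intro δ hδ
      have h1 := h δ hδ e Z heL heP hZ.symm
      rw [Matrix.trace_mul_comm, ← Matrix.mul_assoc, hZe, hZ2, Quad.bigP_eq, blk_mul,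
        neg_add_cancel, trace_blk_zero] at h1
      rw [← sum_shift, ← h1]
      simp only [← sub_eq_add_neg])
    have hMP : blk 0 M * blk 1 P = blk 1 P * blk 0 M := by
      rw [blk_mul, blk_mul, zero_add, add_zero]
      congr 1
      ext1 i
      rw [add_zero]
      exact (hM1 i).symm
    have hMX : Z * e = blk 0 M * X - X * blk 0 M := by
      rw [hZ2, hXdef, Quad.bigX_eq, blk_mul, blk_mul, zero_add, add_zero, ← blk_sub]
      congr 1
      ext1 i
      rw [hM2, sub_add_cancel, Pi.sub_apply, add_zero, ← sub_eq_add_neg]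
    have hMV := blk_zero_mul_bigV hM4
    have hMW := bigW_mul_blk_zero hM3
    have hMe : e * blk 0 M = blk 0 M * e := hcomm _ hMP.symm f
    have hRZ : R * Z = Z * R := hcomm Z hZ.symm r
    -- `e` is a polynomial in `P^m` whose derivative vanishes there, so `M` does not see the
    -- commutator of `e` with `X`.
    have hcom0 : blk 0 M * (e * X - X * e) = 0 := by
      rw [he, mul_aeval_commutator hX' hMP (by rw [← Matrix.mul_assoc, hMV, Matrix.zero_mul]) f,
        hf', Matrix.mul_zero, Matrix.zero_mul, smul_zero]
    have h1e : (1 - e) * e = 0 := by rw [sub_mul, one_mul, hee, sub_self]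
    have hBe : (blk 0 M * e + blk 1 P * R * Z * (1 - e)) * e = blk 0 M * e := by
      rw [add_mul, Matrix.mul_assoc _ e, hee, Matrix.mul_assoc _ (1 - e), h1e, Matrix.mul_zero,
        add_zero]
    -- On the range of `1 - e` the matrix `R` inverts `P^m`, so `P^{m-1}` sends `P R Z (1 - e)` to
    -- `Z (1 - e)`; the summand `M e` yields `[M, X] e = Z e`.
    refine ⟨blk 0 M * e + blk 1 P * R * Z * (1 - e), ⟨⟨?_, ?_⟩, ?_, ?_⟩, ?_⟩
    · rw [hZ1, he, hE, hR, hR', ← blk_one, ← blk_sub, blk_mul, blk_mul, blk_mul, blk_mul]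
      simp only [add_zero, add_neg_cancel]
      rw [← blk_add]
      exact ⟨_, rfl⟩
    · have e1 : (1 - e) * blk 1 P = blk 1 P * (1 - e) := by
        rw [sub_mul, mul_sub, heP, one_mul, mul_one]
      rw [add_mul, mul_add]
      congr 1
      · rw [Matrix.mul_assoc, ← heP, ← Matrix.mul_assoc, hMP, Matrix.mul_assoc]
      · rw [Matrix.mul_assoc _ (1 - e), e1, ← Matrix.mul_assoc, Matrix.mul_assoc _ Z, hZ,
          Matrix.mul_assoc (blk 1 P) R, ← Matrix.mul_assoc R, ← hRP]
        simp only [Matrix.mul_assoc]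
    · rw [hBe, ← hMe, Matrix.mul_assoc, hMV, Matrix.mul_zero]
    · rw [hBe, ← Matrix.mul_assoc, hMW, Matrix.zero_mul]
    · change ((blk 0 M * e + blk 1 P * R * Z * (1 - e)) * e * X -
        X * ((blk 0 M * e + blk 1 P * R * Z * (1 - e)) * e)) +
        blk 1 P ^ (m - 1) * (blk 0 M * e + blk 1 P * R * Z * (1 - e)) * (1 - e) = Z
      have hB1 : (blk 0 M * e + blk 1 P * R * Z * (1 - e)) * (1 - e) =
          blk 1 P * R * Z * (1 - e) := by
        rw [mul_sub, hBe, mul_one, add_sub_cancel_left]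
      have h2 : blk 0 M * e * X - X * (blk 0 M * e) = Z * e := by
        have : blk 0 M * e * X - X * (blk 0 M * e) =
            blk 0 M * (e * X - X * e) + (blk 0 M * X - X * blk 0 M) * e := by noncomm_ring
        rw [this, hcom0, ← hMX, Matrix.mul_assoc, hee, zero_add]
      rw [hBe, h2, Matrix.mul_assoc (blk 1 P ^ (m - 1)), hB1, ← Matrix.mul_assoc,
        ← Matrix.mul_assoc, ← Matrix.mul_assoc, hmm, hr]
      have h3 : (1 - e) * Z * (1 - e) = Z * (1 - e) := by
        have : (1 - e) * Z = Z * (1 - e) := by rw [sub_mul, mul_sub, hZe, one_mul, mul_one]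
        rw [this, Matrix.mul_assoc, mul_sub (1 - e), h1e, mul_one, sub_zero]
      rw [h3, mul_sub, mul_one]
      abel
  have hA : A ≤ gradedCentralizer P 0 := fun B hB => hB.1
  have hAeq : A = gradedCentralizer P 0 := by
    refine Submodule.eq_of_le_of_finrank_le hA ?_
    rw [finrank_gradedCentralizer]
    exact (Submodule.finrank_mono hsub).trans (Submodule.finrank_map_le F A)
  have hone : (1 : Matrix (ZMod m × Fin n) (ZMod m × Fin n) ℂ) ∈ A := by
    rw [hAeq]
    exact ⟨⟨1, blk_one.symm⟩, by rw [one_mul, mul_one]⟩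
  obtain ⟨-, heV, -⟩ := hone
  rw [one_mul] at heV
  -- the trace of the moment map equation on the generalized kernel
  have htr : (e * Matrix.diagonal fun x : ZMod m × Fin n => g x.1).trace = 0 := by
    have h1 : (e * (X * blk 1 P - blk 1 P * X)).trace = 0 := by
      rw [mul_sub, Matrix.trace_sub, ← Matrix.mul_assoc, ← Matrix.mul_assoc, ← heP,
        Matrix.mul_assoc (blk 1 P), Matrix.trace_mul_comm (blk 1 P), sub_self]
    rw [hlev, mul_sub, ← Matrix.mul_assoc, heV, Matrix.zero_mul, zero_sub, Matrix.trace_neg,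
      neg_eq_zero] at h1
    exact h1
  -- `P` and `P^{m-1} R` are mutually inverse on the range of `1 - e`, so the ranks of `1 - e` on
  -- the `V_i` agree; here in terms of traces.
  have hEtr : ∀ i, (E i).trace = (E 0).trace := by
    have h1 : blk 1 P * (blk 1 P ^ (m - 1) * R) = 1 - e := by
      rw [← Matrix.mul_assoc, ← pow_succ', Nat.sub_add_cancel (NeZero.pos m), hr]
    have h2 : blk 1 P ^ (m - 1) * R * blk 1 P = 1 - e := by
      rw [Matrix.mul_assoc, ← hRP, ← Matrix.mul_assoc, hmm, hr]
    have h3 : blk 1 P ^ (m - 1) * R = blk (-1) fun i => T i * R' (i - 1) := by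
      rw [hT, hR, hR', blk_mul, add_zero]
      simp only [← sub_eq_add_neg]
    rw [h3, he, hE, ← blk_one, ← blk_sub, blk_mul] at h1 h2
    rw [add_neg_cancel] at h1
    rw [neg_add_cancel] at h2
    have h1' := blk_injective _ h1
    have h2' := blk_injective _ h2
    have h4 : ∀ i, (E (i - 1)).trace = (E i).trace := by
      intro i
      have e1 := congrArg Matrix.trace (congrFun h1' (i - 1))
      have e2 := congrArg Matrix.trace (congrFun h2' i)
      simp only [Pi.sub_apply, Matrix.trace_sub, sub_add_cancel, ← sub_eq_add_neg] at e1 e2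
      rw [Matrix.trace_mul_comm, e2] at e1
      simpa using e1.symm
    exact fun i => eq_of_forall_sub_one_eq (f := fun i => (E i).trace) h4 i
  have hc : (E 0).trace = 0 := by
    rw [he, hE, diagonal_eq_blk, blk_mul, add_zero, trace_blk_zero] at htr
    simp only [add_zero, Matrix.mul_smul, Matrix.mul_one, Matrix.trace_smul, hEtr,
      smul_eq_mul, ← Finset.sum_mul] at htr
    exact (mul_eq_zero.1 htr).resolve_left hg
  have he0 : e = 0 := by
    have h1 : e.trace = 0 := by
      rw [he, hE, trace_blk_zero]
      simp [hEtr, hc]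
    have h2 : IsIdempotentElem (Matrix.toLin' e) := by
      rw [IsIdempotentElem, Module.End.mul_eq_comp, ← Matrix.toLin'_mul, hee]
    have h3 := LinearMap.IsIdempotentElem.eq_zero_of_trace_eq_zero h2 (by
      rw [Matrix.trace_toLin'_eq, h1])
    exact Matrix.toLin'.injective (h3.trans (map_zero _).symm)
  rw [he0, sub_zero] at hr
  have h1 := congrArg Matrix.det hr
  rw [Matrix.det_mul, Matrix.det_one, hQ, Matrix.det_pow] at h1
  intro h0
  rw [h0, zero_pow (NeZero.ne m), zero_mul] at h1
  exact zero_ne_one h1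

/-- Every open subset of the level set contains a quadruple with `P` invertible. -/
theorem exists_det_bigP_ne_zero {g : ZMod m → ℂ} (hg : IsRegularParam g) {U : Set (Quad m n d)}
    (hU : IsOpen U) {q : Quad m n d} (hqU : q ∈ U) (hq : q ∈ levelSet n d g) :
    ∃ q' ∈ U, q' ∈ levelSet n d g ∧ q'.bigP.det ≠ 0 := by
  set L := m * Fintype.card (ZMod m × Fin n) with hL
  let S : Set (QuadSpace m n d) := {p | p.toQuad ∈ U ∧ p.toQuad ∈ levelSet n d g}
  -- The sum of the ranks is bounded, so it attains a maximum on the open set. A maximum of the sum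
  -- suffices, since each rank is lower semicontinuous.
  let ρ : QuadSpace m n d → ℕ := fun p => ∑ k ∈ Finset.range (L + 1), (p.toQuad.bigP ^ k).rank
  have hρ : ∀ p, ρ p ≤ (L + 1) * Fintype.card (ZMod m × Fin n) := by
    intro p
    have := Finset.sum_le_card_nsmul (Finset.range (L + 1))
      (fun k => (p.toQuad.bigP ^ k).rank) _ fun k _ => Matrix.rank_le_card_height _
    simpa using this
  have hS : S.Nonempty := ⟨(fun i => q.X i, fun i => q.P i, fun i => q.v i, fun i => q.w i),
    hqU, hq⟩
  obtain ⟨p, hpS, hmax⟩ : ∃ p ∈ S, ∀ p' ∈ S, ρ p' ≤ ρ p := by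
    obtain ⟨b, hb⟩ : ∃ b, ∀ p, ρ p ≤ b := ⟨_, hρ⟩
    obtain ⟨p, hp, hmin⟩ := WellFounded.has_min (measure fun p => b - ρ p).wf S hS
    refine ⟨p, hp, fun p' hp' => ?_⟩
    have h1 := hmin p' hp'
    have h1' : ¬ (b - ρ p' < b - ρ p) := h1
    have h2 := hb p
    have h3 := hb p'
    omega
  refine ⟨p.toQuad, hpS.1, hpS.2, det_bigP_ne_zero_of_trace_eq_zero hg.1 hpS.2 ?_⟩
  intro δ hδ e Z heL heP hZ
  obtain ⟨γ, h0, hγ, hlev⟩ := exists_curve_levelSet hg hpS.2 hδ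
  have hP : ∀ a b, HasDerivAt (fun t => (γ t).toQuad.bigP a b) (δ.toQuad.bigP a b) 0 := by
    intro a b
    have h1 : HasDerivAt (fun t => (γ t).2.1) δ.2.1 0 := by
      have := ((ContinuousLinearMap.fst ℂ _ _).comp (ContinuousLinearMap.snd ℂ _ _)
        : QuadSpace m n d →L[ℂ] (ZMod m → Fin n → Fin n → ℂ)).hasFDerivAt.comp_hasDerivAt (0 : ℂ) hγ
      exact this
    simp only [Quad.bigP, Matrix.of_apply]
    split_ifs with hab
    · exact hasDerivAt_pi.1 (hasDerivAt_pi.1 (hasDerivAt_pi.1 h1 a.1) a.2) b.2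
    · exact hasDerivAt_const _ _
  have hUev : ∀ᶠ t in 𝓝 0, (γ t).toQuad ∈ U := by
    have : ContinuousAt (fun t => (γ t).toQuad) 0 :=
      QuadSpace.continuous_toQuad.continuousAt.comp hγ.continuousAt
    exact this.eventually_mem (by rw [h0]; exact hU.mem_nhds hpS.1)
  have hle : ∀ k, ∀ᶠ t in 𝓝 0, ((γ 0).toQuad.bigP ^ k).rank ≤ ((γ t).toQuad.bigP ^ k).rank :=
    fun k => eventually_rank_le (A := fun t => (γ t).toQuad.bigP ^ k)
      fun a b => (hasDerivAt_matrix_pow hP k a b).continuousAt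
  have hall : ∀ᶠ t in 𝓝 0, ∀ k ∈ Finset.range (L + 1),
      ((γ 0).toQuad.bigP ^ k).rank ≤ ((γ t).toQuad.bigP ^ k).rank :=
    (Finset.eventually_all _).2 fun k _ => hle k
  have hr : ∀ k ≤ L, ∀ᶠ t in 𝓝 0,
      ((γ t).toQuad.bigP ^ k).rank ≤ ((γ 0).toQuad.bigP ^ k).rank := by
    intro k hk
    filter_upwards [hall, hUev, hlev] with t h1 h2 h3
    have h4 := hmax (γ t) ⟨h2, h3⟩
    have h5 := (Finset.sum_eq_sum_iff_of_le h1).1 (le_antisymm (Finset.sum_le_sum h1)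
      (by rw [h0]; exact h4)) k (Finset.mem_range.2 (Nat.lt_succ_of_le hk))
    exact h5.ge
  rw [← h0] at heL heP hZ
  exact trace_mul_eq_zero_of_rank_pow_le (P := fun t => (γ t).toQuad.bigP) hP hr heL heP hZ

end InvertibleDense

/-! ### Spectral splitting and Sylvester's equation -/

section BlockDecomposition

variable {ι κ : Type*} [Fintype ι] [DecidableEq ι] [Fintype κ] [DecidableEq κ]

theorem aeval_mul_eq_of_mul_eq {A : Matrix ι ι ℂ} {Y : Matrix ι κ ℂ} {B : Matrix κ κ ℂ}
    (h : A * Y = Y * B) (p : Polynomial ℂ) :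
    Polynomial.aeval A p * Y = Y * Polynomial.aeval B p := by
  have hk : ∀ k : ℕ, A ^ k * Y = Y * B ^ k := by
    intro k
    induction k with
    | zero => simp
    | succ k ih =>
      rw [pow_succ, pow_succ, Matrix.mul_assoc, h, ← Matrix.mul_assoc, ih, Matrix.mul_assoc]
  induction p using Polynomial.induction_on' with
  | add p q hp hq => rw [map_add, map_add, Matrix.add_mul, Matrix.mul_add, hp, hq]
  | monomial k c =>
    rw [Polynomial.aeval_monomial, Polynomial.aeval_monomial, ← Algebra.smul_def,
      ← Algebra.smul_def, Matrix.smul_mul, Matrix.mul_smul, hk]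

/-- With `χ` the characteristic polynomial of `A`, one has `0 = χ(A) Y = Y χ(B)`, and `χ(B)` is
invertible by coprimality. -/
theorem eq_zero_of_mul_eq_mul {A : Matrix ι ι ℂ} {B : Matrix κ κ ℂ}
    (hAB : IsCoprime A.charpoly B.charpoly) {Y : Matrix ι κ ℂ} (h : A * Y = Y * B) : Y = 0 := by
  have h1 := aeval_mul_eq_of_mul_eq h A.charpoly
  rw [Matrix.aeval_self_charpoly, Matrix.zero_mul] at h1
  have h2 := (isCoprime_charpoly_iff A.charpoly B).1 hAB.symm
  have h3 := congrArg (· * (Polynomial.aeval B A.charpoly)⁻¹) h1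
  simpa [Matrix.mul_assoc, Matrix.mul_nonsing_inv _ (isUnit_iff_ne_zero.2 h2)] using h3.symm

/-- A matrix with at least two eigenvalues is similar to a block diagonal matrix whose blocks have
coprime characteristic polynomials. -/
theorem exists_block_decomposition (A : Matrix ι ι ℂ)
    (h : ∀ c : ℂ, (A - c • (1 : Matrix ι ι ℂ)) ^ Fintype.card ι ≠ 0) :
    ∃ (a b : ℕ) (B : Matrix ι (Fin a ⊕ Fin b) ℂ) (B' : Matrix (Fin a ⊕ Fin b) ι ℂ)
      (A₁ : Matrix (Fin a) (Fin a) ℂ) (A₂ : Matrix (Fin b) (Fin b) ℂ),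
      a < Fintype.card ι ∧ b < Fintype.card ι ∧ B * B' = 1 ∧ B' * B = 1 ∧
      A * B = B * Matrix.fromBlocks A₁ 0 0 A₂ ∧ IsCoprime A₁.charpoly A₂.charpoly := by
  have hdeg : A.charpoly.degree ≠ 0 := by
    intro h0
    rw [Matrix.charpoly_degree_eq_dim, Nat.cast_eq_zero] at h0
    have := Fintype.card_eq_zero_iff.1 h0
    refine h 0 (Subsingleton.elim _ _)
  obtain ⟨μ, hμ⟩ := IsAlgClosed.exists_root A.charpoly hdeg
  obtain ⟨p₂, hp, hdvd⟩ := Polynomial.exists_eq_pow_rootMultiplicity_mul_and_not_dvd A.charpoly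
    (Matrix.charpoly_monic A).ne_zero μ
  set r := A.charpoly.rootMultiplicity μ with hr
  set p₁ := (Polynomial.X - Polynomial.C μ) ^ r with hp₁
  have hcop : IsCoprime p₁ p₂ :=
    ((Polynomial.irreducible_X_sub_C μ).coprime_iff_not_dvd.2 hdvd).pow_left
  set f := Matrix.toLin' A with hf
  have haeval : ∀ (p : Polynomial ℂ) u, Polynomial.aeval f p u = (Polynomial.aeval A p).mulVec u := by
    intro p u
    have := Polynomial.aeval_algHom_apply (Matrix.toLinAlgEquiv' (R := ℂ) (n := ι)).toAlgHom A p
    exact LinearMap.congr_fun this u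
  set W₁ := LinearMap.ker (Polynomial.aeval f p₁) with hW₁
  set W₂ := LinearMap.ker (Polynomial.aeval f p₂) with hW₂
  have hcompl : IsCompl W₁ W₂ := by
    refine ⟨Polynomial.disjoint_ker_aeval_of_isCoprime f hcop, codisjoint_iff.2 ?_⟩
    rw [hW₁, hW₂, Polynomial.sup_ker_aeval_eq_ker_aeval_mul_of_coprime f hcop, ← hp,
      LinearMap.ker_eq_top]
    refine LinearMap.ext fun u => ?_
    rw [haeval, Matrix.aeval_self_charpoly, Matrix.zero_mulVec, LinearMap.zero_apply]
  have hinv : ∀ (p : Polynomial ℂ) u, u ∈ LinearMap.ker (Polynomial.aeval f p) →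
      f u ∈ LinearMap.ker (Polynomial.aeval f p) := by
    intro p u hu
    rw [LinearMap.mem_ker] at hu ⊢
    have : Polynomial.aeval f p * f = f * Polynomial.aeval f p := by
      have := congrArg (Polynomial.aeval f) (mul_comm p Polynomial.X)
      rwa [map_mul, map_mul, Polynomial.aeval_X] at this
    have := LinearMap.congr_fun this u
    rw [Module.End.mul_apply, Module.End.mul_apply, hu, map_zero] at this
    exact this
  let b₁ := Module.finBasis ℂ W₁
  let b₂ := Module.finBasis ℂ W₂
  let bb := (b₁.prod b₂).map (Submodule.prodEquivOfIsCompl W₁ W₂ hcompl)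
  have hbl : ∀ j, bb (Sum.inl j) = b₁ j := by intro j; simp [bb]
  have hbr : ∀ j, bb (Sum.inr j) = b₂ j := by intro j; simp [bb]
  set B := (Pi.basisFun ℂ ι).toMatrix bb with hB
  set B' := bb.toMatrix (Pi.basisFun ℂ ι) with hB'
  have hBB' : B * B' = 1 := Module.Basis.toMatrix_mul_toMatrix_flip _ _
  have hB'B : B' * B = 1 := Module.Basis.toMatrix_mul_toMatrix_flip _ _
  set A₁ := LinearMap.toMatrix b₁ b₁ (f.restrict (hinv p₁)) with hA₁
  set A₂ := LinearMap.toMatrix b₂ b₂ (f.restrict (hinv p₂)) with hA₂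
  have hBap : ∀ i s, B i s = bb s i := fun i s => by
    rw [hB, Module.Basis.toMatrix_apply, Pi.basisFun_repr]
  have hexp : ∀ (p : Polynomial ℂ) (k : ℕ)
      (b : Module.Basis (Fin k) ℂ (LinearMap.ker (Polynomial.aeval f p))) s i,
      f (b s) i = ∑ x, (b x : ι → ℂ) i * LinearMap.toMatrix b b (f.restrict (hinv p)) x s := by
    intro p k b s i
    have h2 := congrArg Subtype.val (b.sum_repr ((f.restrict (hinv p)) (b s)))
    rw [LinearMap.coe_restrict_apply, Submodule.coe_sum] at h2
    rw [← h2, Finset.sum_apply]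
    refine Finset.sum_congr rfl fun x _ => ?_
    rw [LinearMap.toMatrix_apply, Submodule.coe_smul, Pi.smul_apply, smul_eq_mul, mul_comm]
  have hAB : A * B = B * Matrix.fromBlocks A₁ 0 0 A₂ := by
    ext i s
    rw [Matrix.mul_apply, Matrix.mul_apply]
    have h1 : ∑ j, A i j * B j s = f (bb s) i := by
      simp [hf, hBap, Matrix.mulVec, dotProduct]
    rw [h1, Fintype.sum_sum_type]
    rcases s with s | s
    · rw [hbl]
      simp only [Matrix.fromBlocks_apply₁₁, Matrix.fromBlocks_apply₂₁, Matrix.zero_apply, mul_zero,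
        Finset.sum_const_zero, add_zero, hBap, hbl]
      exact hexp _ _ _ _ _
    · rw [hbr]
      simp only [Matrix.fromBlocks_apply₁₂, Matrix.fromBlocks_apply₂₂, Matrix.zero_apply, mul_zero,
        Finset.sum_const_zero, zero_add, hBap, hbr]
      exact hexp _ _ _ _ _
  have hmul : ∀ u₁ u₂, B.mulVec (Sum.elim u₁ u₂) =
      ∑ j, u₁ j • (b₁ j : ι → ℂ) + ∑ j, u₂ j • (b₂ j : ι → ℂ) := by
    intro u₁ u₂
    ext i
    rw [Matrix.mulVec, dotProduct, Fintype.sum_sum_type, Pi.add_apply, Finset.sum_apply,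
      Finset.sum_apply]
    congr 1
    · exact Finset.sum_congr rfl fun x _ => by
        rw [hBap, hbl, Sum.elim_inl, mul_comm]; rfl
    · exact Finset.sum_congr rfl fun x _ => by
        rw [hBap, hbr, Sum.elim_inr, mul_comm]; rfl
  have hsum : Module.finrank ℂ W₁ + Module.finrank ℂ W₂ = Fintype.card ι := by
    rw [Submodule.finrank_add_eq_of_isCompl hcompl, Module.finrank_fintype_fun_eq_card]
  have hroot : ∀ z, p₁.eval z = 0 → p₂.eval z = 0 → False := by
    intro z h1 h2
    obtain ⟨x, y, hxy⟩ := hcop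
    have := congrArg (Polynomial.eval z) hxy
    simp [h1, h2] at this
  have hmem : ∀ (p : Polynomial ℂ) (z : ℂ) (u : ι → ℂ), u ≠ 0 → A.mulVec u = z • u →
      u ∈ LinearMap.ker (Polynomial.aeval f p) → p.eval z = 0 := by
    intro p z u hu hz hm
    rw [LinearMap.mem_ker, haeval, aeval_mulVec_of_eigenvector hz] at hm
    exact (smul_eq_zero.1 hm).resolve_right hu
  have hBinj : ∀ u, u ≠ 0 → B.mulVec u ≠ 0 := by
    intro u hu h0
    have := congrArg B'.mulVec h0
    rw [Matrix.mulVec_mulVec, hB'B, Matrix.one_mulVec, Matrix.mulVec_zero] at this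
    exact hu this
  refine ⟨_, _, B, B', A₁, A₂, ?_, ?_, hBB', hB'B, hAB, ?_⟩
  · rw [← hsum]
    have : Module.finrank ℂ W₂ ≠ 0 := by
      intro h0
      rw [Submodule.finrank_eq_zero] at h0
      rw [h0] at hcompl
      have h1 : W₁ = ⊤ := eq_top_of_isCompl_bot hcompl
      have hle : r ≤ Fintype.card ι := by
        have h2 := Polynomial.natDegree_le_of_dvd (Dvd.intro _ hp.symm)
          (Matrix.charpoly_monic A).ne_zero
        rwa [Matrix.charpoly_natDegree_eq_dim, hp₁, Polynomial.natDegree_pow,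
          Polynomial.natDegree_X_sub_C, mul_one] at h2
      refine h μ ?_
      have h2 : Polynomial.aeval A p₁ = 0 := by
        refine Matrix.toLin'.injective (LinearMap.ext fun u => ?_)
        have : u ∈ W₁ := by rw [h1]; trivial
        rw [hW₁, LinearMap.mem_ker, haeval] at this
        simpa using this
      rw [hp₁, map_pow, map_sub, Polynomial.aeval_X, Polynomial.aeval_C,
        Algebra.algebraMap_eq_smul_one] at h2
      exact pow_eq_zero_of_le hle h2
    omega
  · rw [← hsum]
    have : Module.finrank ℂ W₁ ≠ 0 := by
      intro h0
      rw [Submodule.finrank_eq_zero] at h0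
      rw [h0] at hcompl
      have h1 : W₂ = ⊤ := eq_top_of_bot_isCompl hcompl
      obtain ⟨u, hu, h2⟩ := exists_eigenvector_of_charpoly_eval_eq_zero hμ
      have h3 := hmem p₂ μ u hu h2 (by change u ∈ W₂; rw [h1]; trivial)
      exact hdvd (Polynomial.dvd_iff_isRoot.2 h3)
    omega
  · rw [Polynomial.isCoprime_iff_aeval_ne_zero_of_isAlgClosed ℂ ℂ]
    intro z
    by_contra! hc
    rw [Polynomial.coe_aeval_eq_eval] at hc
    obtain ⟨u₁, hu₁, h1⟩ := exists_eigenvector_of_charpoly_eval_eq_zero hc.1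
    obtain ⟨u₂, hu₂, h2⟩ := exists_eigenvector_of_charpoly_eval_eq_zero hc.2
    refine hroot z (hmem p₁ z (B.mulVec (Sum.elim u₁ 0)) (hBinj _ ?_) ?_ ?_)
      (hmem p₂ z (B.mulVec (Sum.elim 0 u₂)) (hBinj _ ?_) ?_ ?_)
    · exact fun h0 => hu₁ (funext fun i => congrFun h0 (Sum.inl i))
    · rw [Matrix.mulVec_mulVec, hAB, ← Matrix.mulVec_mulVec, Matrix.fromBlocks_mulVec,
        ← Matrix.mulVec_smul]
      congr 1
      ext (i | i) <;> simp [h1]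
    · rw [hmul]
      simp only [Pi.zero_apply, zero_smul, Finset.sum_const_zero, add_zero]
      exact Submodule.sum_mem _ fun j _ => Submodule.smul_mem _ _ (b₁ j).2
    · exact fun h0 => hu₂ (funext fun i => congrFun h0 (Sum.inr i))
    · rw [Matrix.mulVec_mulVec, hAB, ← Matrix.mulVec_mulVec, Matrix.fromBlocks_mulVec,
        ← Matrix.mulVec_smul]
      congr 1
      ext (i | i) <;> simp [h2]
    · rw [hmul]
      simp only [Pi.zero_apply, zero_smul, Finset.sum_const_zero, zero_add]
      exact Submodule.sum_mem _ fun j _ => Submodule.smul_mem _ _ (b₂ j).2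

/-- Sylvester's equation `A Y - Y B = C` has a solution depending continuously on the data where the
characteristic polynomials of `A` and `B` are coprime. -/
theorem exists_sylvester_solution (ι κ : Type*) [Fintype ι] [DecidableEq ι] [Fintype κ]
    [DecidableEq κ] :
    ∃ σ : Matrix ι ι ℂ → Matrix κ κ ℂ → Matrix ι κ ℂ → Matrix ι κ ℂ,
      (∀ A B C, IsCoprime A.charpoly B.charpoly → A * σ A B C - σ A B C * B = C) ∧
      ∀ A B C, IsCoprime A.charpoly B.charpoly →
        ContinuousAt (fun x : Matrix ι ι ℂ × Matrix κ κ ℂ × Matrix ι κ ℂ => σ x.1 x.2.1 x.2.2)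
          (A, B, C) := by
  let K : Matrix ι ι ℂ → Matrix κ κ ℂ → Matrix (κ × ι) (κ × ι) ℂ := fun A B =>
    Matrix.kroneckerMap (· * ·) 1 A - Matrix.kroneckerMap (· * ·) B.transpose 1
  have hK : ∀ A B Y, (K A B).mulVec (Matrix.vec Y) = Matrix.vec (A * Y - Y * B) := by
    intro A B Y
    rw [Matrix.sub_mulVec, Matrix.kronecker_mulVec_vec, Matrix.kronecker_mulVec_vec]
    simp [Matrix.vec_sub]
  have hdet : ∀ A B, IsCoprime A.charpoly B.charpoly → (K A B).det ≠ 0 := by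
    intro A B hAB h0
    obtain ⟨x, hx, h1⟩ := Matrix.exists_mulVec_eq_zero_iff.2 h0
    let Y : Matrix ι κ ℂ := Matrix.of fun i j => x (j, i)
    have hY : Matrix.vec Y = x := rfl
    rw [← hY, hK] at h1
    have h2 : A * Y - Y * B = 0 := by
      ext i j
      exact congrFun h1 (j, i)
    have h3 := eq_zero_of_mul_eq_mul hAB (sub_eq_zero.1 h2)
    rw [h3] at hY
    exact hx (hY.symm.trans (by ext; rfl))
  -- `K A B` is the matrix of `Y ↦ A Y - Y B`. Cramer's rule makes continuity plain wherever its
  -- determinant is nonzero.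
  refine ⟨fun A B C => Matrix.of fun i j =>
    ((K A B).det⁻¹ • (K A B).adjugate.mulVec (Matrix.vec C)) (j, i), ?_, ?_⟩
  · intro A B C hAB
    have h1 : Matrix.vec (Matrix.of fun i j =>
        ((K A B).det⁻¹ • (K A B).adjugate.mulVec (Matrix.vec C)) (j, i)) =
        (K A B).det⁻¹ • (K A B).adjugate.mulVec (Matrix.vec C) := rfl
    have h2 := hK A B (Matrix.of fun i j =>
        ((K A B).det⁻¹ • (K A B).adjugate.mulVec (Matrix.vec C)) (j, i))
    rw [h1, Matrix.mulVec_smul, Matrix.mulVec_mulVec, Matrix.mul_adjugate, Matrix.smul_mulVec,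
      Matrix.one_mulVec, smul_smul, inv_mul_cancel₀ (hdet A B hAB), one_smul] at h2
    ext i j
    exact (congrFun h2 (j, i)).symm
  · intro A B C hAB
    have hc : Continuous fun x : Matrix ι ι ℂ × Matrix κ κ ℂ × Matrix ι κ ℂ => K x.1 x.2.1 := by
      refine continuous_matrix fun i j => ?_
      simp only [K, Matrix.sub_apply, Matrix.kroneckerMap_apply, Matrix.transpose_apply]
      have h1 : Continuous fun x : Matrix ι ι ℂ × Matrix κ κ ℂ × Matrix ι κ ℂ => x.1 i.2 j.2 :=
        continuous_fst.matrix_elem _ _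
      have h2 : Continuous fun x : Matrix ι ι ℂ × Matrix κ κ ℂ × Matrix ι κ ℂ => x.2.1 j.1 i.1 :=
        (continuous_fst.comp continuous_snd).matrix_elem _ _
      exact (continuous_const.mul h1).sub (h2.mul continuous_const)
    have hv : Continuous fun x : Matrix ι ι ℂ × Matrix κ κ ℂ × Matrix ι κ ℂ =>
        (K x.1 x.2.1).adjugate.mulVec (Matrix.vec x.2.2) :=
      hc.matrix_adjugate.matrix_mulVec (continuous_pi fun i =>
        (continuous_snd.comp continuous_snd).matrix_elem _ _)
    have hi : ContinuousAt (fun x : Matrix ι ι ℂ × Matrix κ κ ℂ × Matrix ι κ ℂ =>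
        (K x.1 x.2.1).det⁻¹) (A, B, C) := hc.matrix_det.continuousAt.inv₀ (hdet A B hAB)
    refine continuousAt_pi.2 fun i => continuousAt_pi.2 fun j => ?_
    exact hi.mul ((continuous_apply (j, i)).comp hv).continuousAt

end BlockDecomposition

/-! ### The one-vertex equation: gluing blocks -/

/-- Data `(X, P, v, w)` over the quiver with one vertex. -/
abbrev CMData (ι F : Type*) : Type _ :=
  Matrix ι ι ℂ × Matrix ι ι ℂ × Matrix ι F ℂ × Matrix F ι ℂ

/-- The solutions of `[X, P] = v w - γ`. -/
def cmLevel (ι F : Type*) [Fintype ι] [DecidableEq ι] [Fintype F] (γ : ℂ) : Set (CMData ι F) :=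
  {q | q.1 * q.2.1 - q.2.1 * q.1 = q.2.2.1 * q.2.2.2 - γ • (1 : Matrix ι ι ℂ)}

section Gluing

variable {ι κ F : Type*} [Fintype ι] [DecidableEq ι] [Fintype κ] [DecidableEq κ] [Fintype F]

theorem card_le_card_of_mul_eq_one {M : Matrix ι κ ℂ} {N : Matrix κ ι ℂ} (h : M * N = 1) :
    Fintype.card ι ≤ Fintype.card κ := by
  rw [← Matrix.rank_one (R := ℂ) (n := ι), ← h]
  exact (Matrix.rank_mul_le_left M N).trans (Matrix.rank_le_card_width M)

theorem charpoly_conj {B : Matrix ι κ ℂ} {B' : Matrix κ ι ℂ} (h1 : B * B' = 1) (h2 : B' * B = 1)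
    (A : Matrix κ κ ℂ) : (B * A * B').charpoly = A.charpoly := by
  have hcard : Fintype.card ι = Fintype.card κ :=
    le_antisymm (card_le_card_of_mul_eq_one h1) (card_le_card_of_mul_eq_one h2)
  rw [Matrix.charpoly_mul_comm_of_le _ _ hcard.ge, hcard, Nat.sub_self, pow_zero, one_mul,
    ← Matrix.mul_assoc, h2, Matrix.one_mul]

theorem fromBlocks_mem_cmLevel {γ : ℂ} {X₁ P₁ : Matrix ι ι ℂ} {X₂ P₂ : Matrix κ κ ℂ}
    {v₁ : Matrix ι F ℂ} {v₂ : Matrix κ F ℂ} {w₁ : Matrix F ι ℂ} {w₂ : Matrix F κ ℂ}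
    {P₁₂ : Matrix ι κ ℂ} {P₂₁ : Matrix κ ι ℂ} :
    (Matrix.fromBlocks X₁ 0 0 X₂, Matrix.fromBlocks P₁ P₁₂ P₂₁ P₂, Matrix.fromRows v₁ v₂,
      Matrix.fromCols w₁ w₂) ∈ cmLevel (ι ⊕ κ) F γ ↔
    (X₁, P₁, v₁, w₁) ∈ cmLevel ι F γ ∧ (X₂, P₂, v₂, w₂) ∈ cmLevel κ F γ ∧
      X₁ * P₁₂ - P₁₂ * X₂ = v₁ * w₂ ∧ X₂ * P₂₁ - P₂₁ * X₁ = v₂ * w₁ := by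
  simp only [cmLevel, Set.mem_ofPred_eq]
  rw [Matrix.fromRows_mul_fromCols, Matrix.fromBlocks_multiply, Matrix.fromBlocks_multiply,
    ← Matrix.fromBlocks_one, Matrix.fromBlocks_smul, sub_eq_add_neg, sub_eq_add_neg,
    Matrix.fromBlocks_neg, Matrix.fromBlocks_neg, Matrix.fromBlocks_add, Matrix.fromBlocks_add,
    Matrix.fromBlocks_inj]
  simp only [Matrix.zero_mul, Matrix.mul_zero, add_zero, zero_add, smul_zero, neg_zero,
    ← sub_eq_add_neg]
  tauto

theorem conj_mem_cmLevel {γ : ℂ} {B : Matrix ι κ ℂ} {B' : Matrix κ ι ℂ} (h1 : B * B' = 1)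
    (h2 : B' * B = 1) {q : CMData κ F} (hq : q ∈ cmLevel κ F γ) :
    (B * q.1 * B', B * q.2.1 * B', B * q.2.2.1, q.2.2.2 * B') ∈ cmLevel ι F γ := by
  have h3 : ∀ M N : Matrix κ κ ℂ, B * M * B' * (B * N * B') = B * (M * N) * B' := by
    intro M N
    rw [← Matrix.mul_assoc, ← Matrix.mul_assoc, Matrix.mul_assoc (B * M) B' B, h2, Matrix.mul_one,
      Matrix.mul_assoc B M N]
  change B * q.1 * B' * (B * q.2.1 * B') - B * q.2.1 * B' * (B * q.1 * B') =
    B * q.2.2.1 * (q.2.2.2 * B') - γ • (1 : Matrix ι ι ℂ)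
  have hq' : q.1 * q.2.1 - q.2.1 * q.1 = q.2.2.1 * q.2.2.2 - γ • (1 : Matrix κ κ ℂ) := hq
  rw [h3, h3, ← Matrix.sub_mul, ← Matrix.mul_sub, hq', Matrix.mul_sub, Matrix.sub_mul,
    Matrix.mul_smul, Matrix.mul_one, Matrix.smul_mul, h1]
  simp only [Matrix.mul_assoc]

/-- Glue data over `ι` and `κ` with off-diagonal blocks of `P`, and change the basis. -/
def glue {ρ : Type*} (B : Matrix ρ (ι ⊕ κ) ℂ) (B' : Matrix (ι ⊕ κ) ρ ℂ)
    (x : CMData ι F × CMData κ F × Matrix ι κ ℂ × Matrix κ ι ℂ) : CMData ρ F :=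
  (B * Matrix.fromBlocks x.1.1 0 0 x.2.1.1 * B',
    B * Matrix.fromBlocks x.1.2.1 x.2.2.1 x.2.2.2 x.2.1.2.1 * B',
    B * Matrix.fromRows x.1.2.2.1 x.2.1.2.2.1, Matrix.fromCols x.1.2.2.2 x.2.1.2.2.2 * B')

theorem continuous_glue {ρ : Type*} (B : Matrix ρ (ι ⊕ κ) ℂ) (B' : Matrix (ι ⊕ κ) ρ ℂ) :
    Continuous (glue (F := F) B B') := by
  have hr : Continuous fun x : CMData ι F × CMData κ F × Matrix ι κ ℂ × Matrix κ ι ℂ =>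
      Matrix.fromRows x.1.2.2.1 x.2.1.2.2.1 := by
    refine continuous_matrix fun i j => ?_
    rcases i with i | i
    · exact Continuous.matrix_elem (A := fun x : CMData ι F × CMData κ F × Matrix ι κ ℂ ×
        Matrix κ ι ℂ => x.1.2.2.1) (by fun_prop) i j
    · exact Continuous.matrix_elem (A := fun x : CMData ι F × CMData κ F × Matrix ι κ ℂ ×
        Matrix κ ι ℂ => x.2.1.2.2.1) (by fun_prop) i j
  have hc : Continuous fun x : CMData ι F × CMData κ F × Matrix ι κ ℂ × Matrix κ ι ℂ =>
      Matrix.fromCols x.1.2.2.2 x.2.1.2.2.2 := by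
    refine continuous_matrix fun i j => ?_
    rcases j with j | j
    · exact Continuous.matrix_elem (A := fun x : CMData ι F × CMData κ F × Matrix ι κ ℂ ×
        Matrix κ ι ℂ => x.1.2.2.2) (by fun_prop) i j
    · exact Continuous.matrix_elem (A := fun x : CMData ι F × CMData κ F × Matrix ι κ ℂ ×
        Matrix κ ι ℂ => x.2.1.2.2.2) (by fun_prop) i j
  refine Continuous.prodMk ?_ (Continuous.prodMk ?_ (Continuous.prodMk ?_ ?_))
  · exact (continuous_const.matrix_mul (Continuous.matrix_fromBlocks (by fun_prop)
      continuous_const continuous_const (by fun_prop))).matrix_mul continuous_const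
  · exact (continuous_const.matrix_mul (Continuous.matrix_fromBlocks (by fun_prop)
      (by fun_prop) (by fun_prop) (by fun_prop))).matrix_mul continuous_const
  · exact continuous_const.matrix_mul hr
  · exact hc.matrix_mul continuous_const

theorem glue_mem_cmLevel {ρ : Type*} [Fintype ρ] [DecidableEq ρ] {γ : ℂ}
    {B : Matrix ρ (ι ⊕ κ) ℂ} {B' : Matrix (ι ⊕ κ) ρ ℂ} (h1 : B * B' = 1) (h2 : B' * B = 1)
    {q₁ : CMData ι F} {q₂ : CMData κ F} {Y : Matrix ι κ ℂ} {Z : Matrix κ ι ℂ}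
    (hq₁ : q₁ ∈ cmLevel ι F γ) (hq₂ : q₂ ∈ cmLevel κ F γ)
    (hY : q₁.1 * Y - Y * q₂.1 = q₁.2.2.1 * q₂.2.2.2)
    (hZ : q₂.1 * Z - Z * q₁.1 = q₂.2.2.1 * q₁.2.2.2) :
    glue B B' (q₁, q₂, Y, Z) ∈ cmLevel ρ F γ := by
  obtain ⟨X₁, P₁, v₁, w₁⟩ := q₁
  obtain ⟨X₂, P₂, v₂, w₂⟩ := q₂
  have h3 := (fromBlocks_mem_cmLevel (X₁ := X₁) (P₁ := P₁) (v₁ := v₁) (w₁ := w₁) (X₂ := X₂)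
    (P₂ := P₂) (v₂ := v₂) (w₂ := w₂) (P₁₂ := Y) (P₂₁ := Z)).2 ⟨hq₁, hq₂, hY, hZ⟩
  have h4 := conj_mem_cmLevel h1 h2 h3
  exact h4

/-- In a basis that splits `X` into blocks with coprime characteristic polynomials, the diagonal
blocks of the equation are smaller instances of it. The off-diagonal blocks are Sylvester equations
that determine those of `P`. So both blocks are perturbed by induction, and the rest follows
continuously. -/
theorem exists_separable_of_two_eigenvalues {γ : ℂ}
    (ih : ∀ k < Fintype.card ι, ∀ U : Set (CMData (Fin k) F), IsOpen U → ∀ q ∈ U,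
      q ∈ cmLevel (Fin k) F γ → ∃ q' ∈ U, q' ∈ cmLevel (Fin k) F γ ∧ q'.1.charpoly.Separable)
    {U : Set (CMData ι F)} (hU : IsOpen U) {q : CMData ι F} (hqU : q ∈ U)
    (hq : q ∈ cmLevel ι F γ)
    (h : ∀ c : ℂ, (q.1 - c • (1 : Matrix ι ι ℂ)) ^ Fintype.card ι ≠ 0) :
    ∃ q' ∈ U, q' ∈ cmLevel ι F γ ∧ q'.1.charpoly.Separable := by
  obtain ⟨a, b, B, B', A₁, A₂, ha, hb, hBB', hB'B, hAB, hcop⟩ := exists_block_decomposition q.1 h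
  obtain ⟨σ, hσ, hσc⟩ := exists_sylvester_solution (Fin a) (Fin b)
  obtain ⟨τ, hτ, hτc⟩ := exists_sylvester_solution (Fin b) (Fin a)
  have hB1 : B' * q.1 * B = Matrix.fromBlocks A₁ 0 0 A₂ := by
    rw [Matrix.mul_assoc, hAB, ← Matrix.mul_assoc, hB'B, Matrix.one_mul]
  obtain ⟨P₁, P₁₂, P₂₁, P₂, hP⟩ : ∃ P₁ P₁₂ P₂₁ P₂,
      B' * q.2.1 * B = Matrix.fromBlocks P₁ P₁₂ P₂₁ P₂ :=
    ⟨_, _, _, _, (Matrix.fromBlocks_toBlocks _).symm⟩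
  obtain ⟨v₁, v₂, hv⟩ : ∃ v₁ v₂, B' * q.2.2.1 = Matrix.fromRows v₁ v₂ :=
    ⟨_, _, (Matrix.fromRows_toRows _).symm⟩
  obtain ⟨w₁, w₂, hw⟩ : ∃ w₁ w₂, q.2.2.2 * B = Matrix.fromCols w₁ w₂ :=
    ⟨_, _, (Matrix.fromCols_toCols _).symm⟩
  have hlev := conj_mem_cmLevel hB'B hBB' hq
  rw [hB1, hP, hv, hw, fromBlocks_mem_cmLevel] at hlev
  obtain ⟨hl1, hl2, hl3, hl4⟩ := hlev
  let Φ : CMData (Fin a) F × CMData (Fin b) F → CMData ι F := fun x =>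
    glue B B' (x.1, x.2, σ x.1.1 x.2.1 (x.1.2.2.1 * x.2.2.2.2),
      τ x.2.1 x.1.1 (x.2.2.2.1 * x.1.2.2.2))
  set q₁ : CMData (Fin a) F := (A₁, P₁, v₁, w₁) with hq₁
  set q₂ : CMData (Fin b) F := (A₂, P₂, v₂, w₂) with hq₂
  have hΦc : ContinuousAt Φ (q₁, q₂) := by
    refine (continuous_glue B B').continuousAt.comp (continuousAt_fst.prodMk (continuousAt_snd.prodMk
      (ContinuousAt.prodMk ?_ ?_)))
    · have h1 : Continuous fun x : CMData (Fin a) F × CMData (Fin b) F =>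
          (x.1.1, x.2.1, x.1.2.2.1 * x.2.2.2.2) :=
        Continuous.prodMk (by fun_prop) (Continuous.prodMk (by fun_prop)
          (Continuous.matrix_mul (by fun_prop) (by fun_prop)))
      exact ContinuousAt.comp_of_eq (g := fun x : Matrix (Fin a) (Fin a) ℂ × Matrix (Fin b) (Fin b) ℂ ×
          Matrix (Fin a) (Fin b) ℂ => σ x.1 x.2.1 x.2.2) (hσc q₁.1 q₂.1 (q₁.2.2.1 * q₂.2.2.2) hcop)
        (h1.continuousAt (x := (q₁, q₂))) rfl
    · have h1 : Continuous fun x : CMData (Fin a) F × CMData (Fin b) F =>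
          (x.2.1, x.1.1, x.2.2.2.1 * x.1.2.2.2) :=
        Continuous.prodMk (by fun_prop) (Continuous.prodMk (by fun_prop)
          (Continuous.matrix_mul (by fun_prop) (by fun_prop)))
      exact ContinuousAt.comp_of_eq (g := fun x : Matrix (Fin b) (Fin b) ℂ × Matrix (Fin a) (Fin a) ℂ ×
          Matrix (Fin b) (Fin a) ℂ => τ x.1 x.2.1 x.2.2) (hτc q₂.1 q₁.1 (q₂.2.2.1 * q₁.2.2.2) hcop.symm)
        (h1.continuousAt (x := (q₁, q₂))) rfl
  -- Uniqueness in Sylvester's equation ensures that gluing the unperturbed blocks returns `q`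
  -- itself.
  have hσ0 : σ A₁ A₂ (v₁ * w₂) = P₁₂ := by
    refine sub_eq_zero.1 (eq_zero_of_mul_eq_mul hcop (sub_eq_zero.1 ?_))
    have h1 := hσ A₁ A₂ (v₁ * w₂) hcop
    rw [Matrix.mul_sub, Matrix.sub_mul, sub_sub_sub_comm, h1, hl3, sub_self]
  have hτ0 : τ A₂ A₁ (v₂ * w₁) = P₂₁ := by
    refine sub_eq_zero.1 (eq_zero_of_mul_eq_mul hcop.symm (sub_eq_zero.1 ?_))
    have h1 := hτ A₂ A₁ (v₂ * w₁) hcop.symm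
    rw [Matrix.mul_sub, Matrix.sub_mul, sub_sub_sub_comm, h1, hl4, sub_self]
  have hΦq : Φ (q₁, q₂) = q := by
    have hcc : ∀ A : Matrix ι ι ℂ, B * (B' * A * B) * B' = A := by
      intro A
      rw [← Matrix.mul_assoc, ← Matrix.mul_assoc, hBB', Matrix.one_mul, Matrix.mul_assoc, hBB',
        Matrix.mul_one]
    change (B * Matrix.fromBlocks A₁ 0 0 A₂ * B',
      B * Matrix.fromBlocks P₁ (σ A₁ A₂ (v₁ * w₂)) (τ A₂ A₁ (v₂ * w₁)) P₂ * B',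
      B * Matrix.fromRows v₁ v₂, Matrix.fromCols w₁ w₂ * B') = q
    rw [hσ0, hτ0, ← hB1, ← hP, ← hv, ← hw, hcc, hcc, ← Matrix.mul_assoc, hBB', Matrix.one_mul,
      Matrix.mul_assoc, hBB', Matrix.mul_one]
  have hnhds : {x | Φ x ∈ U ∧ IsCoprime x.1.1.charpoly x.2.1.charpoly} ∈ 𝓝 (q₁, q₂) := by
    refine Filter.inter_mem (hΦc.preimage_mem_nhds (by rw [hΦq]; exact hU.mem_nhds hqU)) ?_
    have hc : Continuous fun x : CMData (Fin a) F × CMData (Fin b) F => (x.1.1, x.2.1) := by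
      fun_prop
    exact (isOpen_isCoprime_charpoly.preimage hc).mem_nhds hcop
  rw [nhds_prod_eq, Filter.mem_prod_iff] at hnhds
  obtain ⟨t₁, ht₁, t₂, ht₂, hsub⟩ := hnhds
  obtain ⟨U₁, hU₁, hU₁o, hU₁m⟩ := mem_nhds_iff.1 ht₁
  obtain ⟨U₂, hU₂, hU₂o, hU₂m⟩ := mem_nhds_iff.1 ht₂
  obtain ⟨r₁, hr₁, hr₁l, hr₁s⟩ := ih a ha U₁ hU₁o q₁ hU₁m hl1
  obtain ⟨r₂, hr₂, hr₂l, hr₂s⟩ := ih b hb U₂ hU₂o q₂ hU₂m hl2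
  obtain ⟨hmem, hcop'⟩ := hsub (Set.mk_mem_prod (hU₁ hr₁) (hU₂ hr₂))
  refine ⟨Φ (r₁, r₂), hmem, glue_mem_cmLevel hBB' hB'B hr₁l hr₂l (hσ _ _ _ hcop')
    (hτ _ _ _ hcop'.symm), ?_⟩
  change (B * Matrix.fromBlocks r₁.1 0 0 r₂.1 * B').charpoly.Separable
  rw [charpoly_conj hBB' hB'B, Matrix.charpoly_fromBlocks_zero₂₁]
  exact hr₁s.mul hr₂s hcop'

end Gluing

theorem coeff_eq_zero_of_eventually {c₀ c₁ c₂ c₃ c₄ : ℂ}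
    (h : ∀ᶠ t in 𝓝 (0 : ℂ), c₀ + t * c₁ + t ^ 2 * c₂ + t ^ 3 * c₃ + t ^ 4 * c₄ = 0) :
    c₁ = 0 ∧ c₂ = 0 := by
  let p : Polynomial ℂ := Polynomial.C c₀ + Polynomial.X * Polynomial.C c₁ +
    Polynomial.X ^ 2 * Polynomial.C c₂ + Polynomial.X ^ 3 * Polynomial.C c₃ +
    Polynomial.X ^ 4 * Polynomial.C c₄
  have hp : p = 0 := by
    refine Polynomial.eq_zero_of_infinite_isRoot p ?_
    refine Set.Infinite.mono (s := {t : ℂ | c₀ + t * c₁ + t ^ 2 * c₂ + t ^ 3 * c₃ + t ^ 4 * c₄ = 0})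
      ?_ (infinite_of_mem_nhds 0 h)
    intro t ht
    rw [Set.mem_ofPred_eq] at ht
    simp only [Set.mem_ofPred_eq, p, Polynomial.IsRoot, Polynomial.eval_add, Polynomial.eval_mul,
      Polynomial.eval_pow, Polynomial.eval_X, Polynomial.eval_C]
    exact ht
  have h1 := congrArg (fun p => Polynomial.coeff p 1) hp
  have h2 := congrArg (fun p => Polynomial.coeff p 2) hp
  simp [p, Polynomial.coeff_X_pow, Polynomial.coeff_C] at h1 h2
  exact ⟨h1, h2⟩

/-! ### The one-vertex equation: simple spectra are dense -/

section SingleEigenvalue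

variable {ι F : Type*} [Fintype ι] [DecidableEq ι] [Fintype F] [DecidableEq F]

/-- The traceless part of a matrix. -/
noncomputable def tracelessPart (A : Matrix ι ι ℂ) : Matrix ι ι ℂ :=
  A - (A.trace / (Fintype.card ι : ℂ)) • (1 : Matrix ι ι ℂ)

theorem trace_tracelessPart (hk : Fintype.card ι ≠ 0) (A : Matrix ι ι ℂ) :
    (tracelessPart A).trace = 0 := by
  have : (Fintype.card ι : ℂ) ≠ 0 := Nat.cast_ne_zero.2 hk
  rw [tracelessPart, Matrix.trace_sub, Matrix.trace_smul, Matrix.trace_one, smul_eq_mul,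
    div_mul_cancel₀ _ this, sub_self]

theorem tracelessPart_add_smul (A B : Matrix ι ι ℂ) (t : ℂ) :
    tracelessPart (A + t • B) = tracelessPart A + t • tracelessPart B := by
  simp only [tracelessPart, Matrix.trace_add, Matrix.trace_smul, smul_eq_mul, add_div,
    mul_div_assoc]
  module

theorem tracelessPart_mul_tracelessPart_trace (hk : Fintype.card ι ≠ 0) (A B : Matrix ι ι ℂ) :
    (tracelessPart A * tracelessPart B).trace = (tracelessPart A * B).trace := by
  conv_lhs => rw [tracelessPart.eq_def B]
  rw [mul_sub, Matrix.trace_sub, Matrix.mul_smul, mul_one, Matrix.trace_smul,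
    trace_tracelessPart hk, smul_zero, sub_zero]

theorem trace_tracelessPart_pow (hk : Fintype.card ι ≠ 0) {A : Matrix ι ι ℂ}
    (h : ∃ c : ℂ, (A - c • (1 : Matrix ι ι ℂ)) ^ Fintype.card ι = 0) {j : ℕ} (hj : j ≠ 0) :
    (tracelessPart A ^ j).trace = 0 := by
  obtain ⟨c, hc⟩ := h
  have hk' : (Fintype.card ι : ℂ) ≠ 0 := Nat.cast_ne_zero.2 hk
  have hnil : IsNilpotent (A - c • (1 : Matrix ι ι ℂ)) := ⟨_, hc⟩
  have h1 := (Matrix.isNilpotent_trace_of_isNilpotent hnil).eq_zero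
  rw [Matrix.trace_sub, Matrix.trace_smul, Matrix.trace_one, smul_eq_mul, sub_eq_zero] at h1
  have h2 : tracelessPart A = A - c • (1 : Matrix ι ι ℂ) := by
    rw [tracelessPart, h1, mul_div_cancel_right₀ _ hk']
  rw [h2]
  exact (Matrix.isNilpotent_trace_of_isNilpotent (hnil.pow_of_pos hj)).eq_zero

theorem trace_pow_two_add_smul (x y : Matrix ι ι ℂ) (t : ℂ) :
    ((x + t • y) ^ 2).trace = (x * x).trace + t * (2 * (x * y).trace) + t ^ 2 * (y * y).trace := by
  rw [pow_two, add_mul, mul_add, mul_add]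
  simp only [Matrix.smul_mul, Matrix.mul_smul, Matrix.trace_add, Matrix.trace_smul, smul_eq_mul]
  rw [Matrix.trace_mul_comm y x]
  ring

theorem trace_pow_three_add_smul (x y : Matrix ι ι ℂ) (t : ℂ) :
    ((x + t • y) ^ 3).trace = (x * x * x).trace + t * (3 * (x * x * y).trace) +
      t ^ 2 * (3 * (x * y * y).trace) + t ^ 3 * (y * y * y).trace := by
  have h1 : (x * y * x).trace = (x * x * y).trace := by
    rw [Matrix.trace_mul_comm, ← Matrix.mul_assoc]
  have h2 : (y * x * x).trace = (x * x * y).trace := by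
    rw [Matrix.mul_assoc, Matrix.trace_mul_comm]
  have h3 : (y * x * y).trace = (x * y * y).trace := by
    rw [Matrix.trace_mul_comm, ← Matrix.mul_assoc, Matrix.trace_mul_comm, ← Matrix.mul_assoc]
  have h4 : (y * y * x).trace = (x * y * y).trace := by
    rw [Matrix.trace_mul_comm, ← Matrix.mul_assoc]
  simp only [pow_succ, pow_zero, one_mul, add_mul, mul_add, Matrix.smul_mul, Matrix.mul_smul,
    Matrix.trace_add, Matrix.trace_smul, smul_eq_mul]
  rw [h1, h2, h3, h4]
  ring

theorem trace_pow_four_add_smul (x y : Matrix ι ι ℂ) :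
    ∃ c₀ c₁ c₃ c₄ : ℂ, ∀ t : ℂ, ((x + t • y) ^ 4).trace = c₀ + t * c₁ +
      t ^ 2 * (4 * (x * x * (y * y)).trace + 2 * (x * y * (x * y)).trace) +
      t ^ 3 * c₃ + t ^ 4 * c₄ := by
  have h1 : (x * y * (y * x)).trace = (x * x * (y * y)).trace := by
    rw [← Matrix.mul_assoc, Matrix.trace_mul_comm]; simp only [Matrix.mul_assoc]
  have h2 : (y * x * (x * y)).trace = (x * x * (y * y)).trace := by
    rw [Matrix.mul_assoc, Matrix.trace_mul_comm]; simp only [Matrix.mul_assoc]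
  have h3 : (y * x * (y * x)).trace = (x * y * (x * y)).trace := by
    rw [Matrix.mul_assoc, Matrix.trace_mul_comm]; simp only [Matrix.mul_assoc]
  have h4 : (y * y * (x * x)).trace = (x * x * (y * y)).trace := Matrix.trace_mul_comm _ _
  refine ⟨(x * x * (x * x)).trace, 2 * (x * x * (x * y)).trace + 2 * (x * x * (y * x)).trace,
    2 * (y * y * (x * y)).trace + 2 * (y * y * (y * x)).trace, (y * y * (y * y)).trace,
    fun t => ?_⟩
  have h5 : (x + t • y) ^ 4 = ((x * x) + t • (x * y + y * x) + t ^ 2 • (y * y)) *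
      ((x * x) + t • (x * y + y * x) + t ^ 2 • (y * y)) := by
    have h6 : (x + t • y) * (x + t • y) = (x * x) + t • (x * y + y * x) + t ^ 2 • (y * y) := by
      simp only [add_mul, mul_add, Matrix.smul_mul, Matrix.mul_smul]
      module
    rw [← h6]
    noncomm_ring
  have h7 : (x * y * (x * x)).trace = (x * x * (x * y)).trace := Matrix.trace_mul_comm _ _
  have h8 : (y * x * (x * x)).trace = (x * x * (y * x)).trace := Matrix.trace_mul_comm _ _
  have h9 : (x * y * (y * y)).trace = (y * y * (x * y)).trace := Matrix.trace_mul_comm _ _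
  have h10 : (y * x * (y * y)).trace = (y * y * (y * x)).trace := Matrix.trace_mul_comm _ _
  rw [h5]
  simp only [add_mul, mul_add, smul_add, Matrix.smul_mul, Matrix.mul_smul, Matrix.trace_add,
    Matrix.trace_smul, smul_eq_mul]
  rw [h1, h2, h3, h4, h7, h8, h9, h10]
  ring

/-- Rank one matrices of square zero span the traceless matrices, whose orthogonal is the scalars.
The test vectors are `e_j, e_i` and `e_i + e_j, e_i - e_j`. -/
theorem exists_eq_smul_one_of_trace_mul_eq_zero {G : Matrix F F ℂ}
    (h : ∀ a b : F → ℂ, b ⬝ᵥ a = 0 → (Matrix.vecMulVec a b * G).trace = 0) :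
    ∃ c : ℂ, G = c • (1 : Matrix F F ℂ) := by
  have key : ∀ a b : F → ℂ, (Matrix.vecMulVec a b * G).trace = b ⬝ᵥ G.mulVec a := by
    intro a b
    rw [Matrix.trace_mul_comm, Matrix.mul_vecMulVec, Matrix.trace_vecMulVec, dotProduct_comm]
  have hoff : ∀ i j, i ≠ j → G i j = 0 := by
    intro i j hij
    have h1 := h (Pi.single j 1) (Pi.single i 1) (by simp [hij.symm])
    rw [key] at h1
    simpa using h1
  have hdiag : ∀ i j, G i i = G j j := by
    intro i j
    rcases eq_or_ne i j with rfl | hij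
    · rfl
    have h1 := h (Pi.single i 1 + Pi.single j 1) (Pi.single i 1 - Pi.single j 1) (by
      simp [dotProduct_add, hij, hij.symm])
    rw [key] at h1
    simp [sub_dotProduct, Matrix.mulVec_add, hoff i j hij, hoff j i hij.symm] at h1
    exact sub_eq_zero.1 h1
  rcases isEmpty_or_nonempty F with hF | ⟨⟨i₀⟩⟩
  · exact ⟨0, Subsingleton.elim _ _⟩
  · refine ⟨G i₀ i₀, ?_⟩
    ext i j
    rcases eq_or_ne i j with rfl | hij
    · simp [hdiag i i₀]
    · simp [hoff i j hij, hij]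

/-- The first component of the data moves along a line in a curve inside the level set. -/
theorem eventually_trace_pow_eq_zero {γ : ℂ} (hk : Fintype.card ι ≠ 0) {U : Set (CMData ι F)}
    (hU : IsOpen U)
    (hnil : ∀ q ∈ U, q ∈ cmLevel ι F γ →
      ∃ c : ℂ, (q.1 - c • (1 : Matrix ι ι ℂ)) ^ Fintype.card ι = 0)
    {q : ℂ → CMData ι F} (hq : Continuous q) (h0 : q 0 ∈ U) (hlev : ∀ t, q t ∈ cmLevel ι F γ)
    {X Y : Matrix ι ι ℂ} (hX : ∀ t, (q t).1 = X + t • Y) {j : ℕ} (hj : j ≠ 0) :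
    ∀ᶠ t in 𝓝 (0 : ℂ), ((tracelessPart X + t • tracelessPart Y) ^ j).trace = 0 := by
  filter_upwards [hq.continuousAt.eventually_mem (hU.mem_nhds h0)] with t ht
  rw [← tracelessPart_add_smul, ← hX]
  exact trace_tracelessPart_pow hk (hnil _ ht (hlev t)) hj

/-- Adding a matrix that commutes with `P` to `X`. -/
theorem add_smul_mem_cmLevel {γ : ℂ} {X P : Matrix ι ι ℂ} {v : Matrix ι F ℂ} {w : Matrix F ι ℂ}
    (h : (X, P, v, w) ∈ cmLevel ι F γ) {Y : Matrix ι ι ℂ} (hY : Y * P = P * Y) (t : ℂ) :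
    (X + t • Y, P, v, w) ∈ cmLevel ι F γ := by
  have h' : X * P - P * X = v * w - γ • (1 : Matrix ι ι ℂ) := h
  change (X + t • Y) * P - P * (X + t • Y) = v * w - γ • (1 : Matrix ι ι ℂ)
  rw [add_mul, mul_add, Matrix.smul_mul, Matrix.mul_smul, hY, add_sub_add_right_eq_sub, h']

/-- The flow of `tr (v A w P)` for `A ^ 2 = 0`. -/
theorem shear_mem_cmLevel {γ : ℂ} {X P : Matrix ι ι ℂ} {v : Matrix ι F ℂ} {w : Matrix F ι ℂ}
    (h : (X, P, v, w) ∈ cmLevel ι F γ) {A : Matrix F F ℂ} (hA : A * A = 0) (t : ℂ) :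
    (X + t • (v * A * w), P, v - t • (P * v * A), w + t • (A * w * P)) ∈ cmLevel ι F γ := by
  have h' : X * P - P * X = v * w - γ • (1 : Matrix ι ι ℂ) := h
  change (X + t • (v * A * w)) * P - P * (X + t • (v * A * w)) =
    (v - t • (P * v * A)) * (w + t • (A * w * P)) - γ • (1 : Matrix ι ι ℂ)
  have h1 : P * v * A * (A * w * P) = 0 := by
    rw [Matrix.mul_assoc A, ← Matrix.mul_assoc, Matrix.mul_assoc (P * v), hA, Matrix.mul_zero,
      Matrix.zero_mul]
  have h2 : v * (A * w * P) = v * A * w * P := by simp only [Matrix.mul_assoc]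
  have h3 : P * v * A * w = P * (v * A * w) := by simp only [Matrix.mul_assoc]
  rw [add_mul, mul_add, Matrix.sub_mul, Matrix.mul_add, Matrix.mul_add]
  simp only [Matrix.smul_mul, Matrix.mul_smul, h1, h2, h3, smul_zero, add_zero]
  have h4 : X * P = P * X + (v * w - γ • (1 : Matrix ι ι ℂ)) := by rw [← h']; abel
  rw [h4]
  abel

/-- If near some data all `X` in the level set have only one eigenvalue, then `X` is a scalar and
`v`, `w` are inverse to each other up to `γ`. -/
theorem tracelessPart_eq_zero_of_single_eigenvalue {γ : ℂ} (hγ : γ ≠ 0)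
    (hk : 2 ≤ Fintype.card ι) {U : Set (CMData ι F)} (hU : IsOpen U)
    (hnil : ∀ q ∈ U, q ∈ cmLevel ι F γ →
      ∃ c : ℂ, (q.1 - c • (1 : Matrix ι ι ℂ)) ^ Fintype.card ι = 0)
    {X P : Matrix ι ι ℂ} {v : Matrix ι F ℂ} {w : Matrix F ι ℂ} (hqU : (X, P, v, w) ∈ U)
    (hq : (X, P, v, w) ∈ cmLevel ι F γ) :
    tracelessPart X = 0 ∧ Fintype.card F = Fintype.card ι ∧ w * v = γ • (1 : Matrix F F ℂ) := by
  have hk0 : Fintype.card ι ≠ 0 := by omega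
  have hkC : (Fintype.card ι : ℂ) ≠ 0 := Nat.cast_ne_zero.2 hk0
  set x := tracelessPart X with hx
  set p := tracelessPart P with hp
  have hlev : X * P - P * X = v * w - γ • (1 : Matrix ι ι ℂ) := hq
  have hflow : ∀ Y : Matrix ι ι ℂ, Y * P = P * Y → ∀ j : ℕ, j ≠ 0 →
      ∀ᶠ t in 𝓝 (0 : ℂ), ((x + t • tracelessPart Y) ^ j).trace = 0 := by
    intro Y hY j hj
    refine eventually_trace_pow_eq_zero hk0 hU hnil
      (q := fun t => (X + t • Y, P, v, w)) (Continuous.prodMk (by fun_prop) continuous_const)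
      (by simpa using hqU) (fun t => add_smul_mem_cmLevel hq hY t) (fun t => rfl) hj
  have hshear : ∀ A : Matrix F F ℂ, A * A = 0 → ∀ j : ℕ, j ≠ 0 →
      ∀ᶠ t in 𝓝 (0 : ℂ), ((x + t • tracelessPart (v * A * w)) ^ j).trace = 0 := by
    intro A hA j hj
    refine eventually_trace_pow_eq_zero hk0 hU hnil
      (q := fun t => (X + t • (v * A * w), P, v - t • (P * v * A), w + t • (A * w * P)))
      (by fun_prop) (by simpa using hqU) (fun t => shear_mem_cmLevel hq hA t) (fun t => rfl) hj
  have hquad : ∀ y : Matrix ι ι ℂ, (∀ᶠ t in 𝓝 (0 : ℂ), ((x + t • y) ^ 2).trace = 0) →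
      (x * y).trace = 0 ∧ (y * y).trace = 0 := by
    intro y hy
    have h1 := coeff_eq_zero_of_eventually (c₀ := (x * x).trace) (c₁ := 2 * (x * y).trace)
      (c₂ := (y * y).trace) (c₃ := 0) (c₄ := 0) (by
        filter_upwards [hy] with t ht
        rw [trace_pow_two_add_smul] at ht
        linear_combination ht)
    exact ⟨by simpa using h1.1, h1.2⟩
  -- the flows of the traces of powers of `P`
  have hpp : (p * p).trace = 0 := (hquad p (hflow P rfl 2 two_ne_zero)).2
  have hbar : tracelessPart (p * p) = p * p := by
    rw [tracelessPart, hpp, zero_div, zero_smul, sub_zero]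
  have hpP : p * P = P * p := by
    simp only [hp, tracelessPart, sub_mul, mul_sub, Matrix.smul_mul, Matrix.mul_smul, one_mul,
      mul_one]
  -- The linear coefficient of the cubic trace along `X + t p²`; the quadratic coefficient of the
  -- quartic trace along `X + t P` then gives `tr(x p x p) = 0`.
  have hxxpp : (x * x * (p * p)).trace = 0 := by
    have h1 := hflow (p * p) (by rw [mul_assoc, hpP, ← mul_assoc, hpP, mul_assoc]) 3 three_ne_zero
    rw [hbar] at h1
    have h2 := coeff_eq_zero_of_eventually (c₀ := (x * x * x).trace)
      (c₁ := 3 * (x * x * (p * p)).trace) (c₂ := 3 * (x * (p * p) * (p * p)).trace)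
      (c₃ := (p * p * (p * p) * (p * p)).trace) (c₄ := 0) (by
        filter_upwards [h1] with t ht
        rw [trace_pow_three_add_smul] at ht
        linear_combination ht)
    simpa using h2.1
  have hxpxp : (x * p * (x * p)).trace = 0 := by
    obtain ⟨c₀, c₁, c₃, c₄, h4⟩ := trace_pow_four_add_smul x p
    have h2 := coeff_eq_zero_of_eventually (c₀ := c₀) (c₁ := c₁) (c₃ := c₃) (c₄ := c₄) (by
        filter_upwards [hflow P rfl 4 four_ne_zero] with t ht
        rw [h4] at ht
        exact ht)
    have h3 := h2.2
    rw [hxxpp] at h3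
    simpa using h3
  have hvw : v * w = γ • (1 : Matrix ι ι ℂ) + (x * p - p * x) := by
    have h1 : x * p - p * x = X * P - P * X := by
      simp only [hx, hp, tracelessPart, sub_mul, mul_sub, Matrix.smul_mul, Matrix.mul_smul, one_mul,
        mul_one]
      module
    rw [h1, hlev]
    abel
  have htr1 : (w * v).trace = γ * Fintype.card ι := by
    rw [Matrix.trace_mul_comm, hvw, Matrix.trace_add, Matrix.trace_sub, Matrix.trace_mul_comm p,
      sub_self, add_zero, Matrix.trace_smul, Matrix.trace_one, smul_eq_mul]
  -- `v w = γ + [x, p]`, and the square of `[x, p]` has trace `2 tr(x p x p) - 2 tr(x² p²) = 0`.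
  have htr2 : (w * v * (w * v)).trace = γ ^ 2 * Fintype.card ι := by
    have h1 : (w * v * (w * v)).trace = (v * w * (v * w)).trace := by
      rw [Matrix.mul_assoc, Matrix.trace_mul_comm]; simp only [Matrix.mul_assoc]
    have h2 : (x * p * (p * x)).trace = 0 := by
      rw [← hxxpp, ← Matrix.mul_assoc, Matrix.trace_mul_comm]; simp only [Matrix.mul_assoc]
    have h3 : (p * x * (x * p)).trace = 0 := by
      rw [← hxxpp, Matrix.mul_assoc, Matrix.trace_mul_comm]; simp only [Matrix.mul_assoc]
    have h4 : (p * x * (p * x)).trace = 0 := by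
      rw [← hxpxp, Matrix.mul_assoc, Matrix.trace_mul_comm]; simp only [Matrix.mul_assoc]
    rw [h1, hvw]
    simp only [add_mul, mul_add, sub_mul, mul_sub, Matrix.smul_mul, Matrix.mul_smul, one_mul,
      mul_one, Matrix.trace_add, Matrix.trace_sub, Matrix.trace_smul, smul_eq_mul, h2, h3, h4,
      hxpxp, Matrix.trace_one, Matrix.trace_mul_comm p x]
    ring
  -- the shears
  have hvec : ∀ a b : F → ℂ, b ⬝ᵥ a = 0 → Matrix.vecMulVec a b * Matrix.vecMulVec a b = 0 := by
    intro a b hab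
    rw [Matrix.vecMulVec_mul_vecMulVec, hab, zero_smul, Matrix.vecMulVec_zero]
  -- `(v A w)² = β v A w` has trace `β²`, so the square of the traceless part has trace `β² (1 -
  -- 1/k)`, with `k ≥ 2` the size.
  have hG : ∀ a b : F → ℂ, b ⬝ᵥ a = 0 → (Matrix.vecMulVec a b * (w * v)).trace = 0 := by
    intro a b hab
    set A := Matrix.vecMulVec a b with hA
    set β := (A * (w * v)).trace with hβ
    have h1 := (hquad _ (hshear A (hvec a b hab) 2 two_ne_zero)).2
    have h2 : (v * A * w).trace = β := by
      rw [hβ, Matrix.trace_mul_comm, ← Matrix.mul_assoc, Matrix.trace_mul_comm]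
    have h3 : A * (w * v) * A = β • A := by
      have h4 : β = b ⬝ᵥ (w * v).mulVec a := by
        rw [hβ, hA, Matrix.trace_mul_comm, Matrix.mul_vecMulVec, Matrix.trace_vecMulVec,
          dotProduct_comm]
      rw [hA, Matrix.mul_assoc, Matrix.mul_vecMulVec, Matrix.vecMulVec_mul_vecMulVec, h4]
      ext i j
      simp [Matrix.vecMulVec_apply]
      ring
    rw [tracelessPart_mul_tracelessPart_trace hk0, tracelessPart, sub_mul, Matrix.trace_sub,
      Matrix.smul_mul, one_mul, Matrix.trace_smul, h2, smul_eq_mul] at h1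
    have h5 : (v * A * w * (v * A * w)).trace = β * β := by
      have h6 : v * A * w * (v * A * w) = v * (A * (w * v) * A) * w := by
        simp only [Matrix.mul_assoc]
      rw [h6, h3, Matrix.mul_smul, Matrix.smul_mul, Matrix.trace_smul, h2, smul_eq_mul]
    rw [h5] at h1
    have h7 : β * β * ((Fintype.card ι : ℂ) - 1) = 0 := by
      field_simp at h1
      linear_combination h1
    have h8 : (Fintype.card ι : ℂ) - 1 ≠ 0 := by
      rw [sub_ne_zero]
      exact_mod_cast (by omega : Fintype.card ι ≠ 1)
    simpa using (mul_eq_zero.1 h7).resolve_right h8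
  obtain ⟨g₀, hg₀⟩ := exists_eq_smul_one_of_trace_mul_eq_zero hG
  rw [hg₀] at htr1 htr2
  rw [Matrix.trace_smul, Matrix.trace_one, smul_eq_mul] at htr1
  rw [Matrix.smul_mul, one_mul, Matrix.trace_smul, Matrix.trace_smul, Matrix.trace_one,
    smul_eq_mul, smul_eq_mul, htr1] at htr2
  -- The traces of `w v` and of its square are `g₀ |F| = γ k` and `g₀² |F| = γ² k`; together they
  -- give `g₀ = γ` and `|F| = k`.
  have hg : g₀ = γ := by
    have : (g₀ - γ) * (γ * Fintype.card ι) = 0 := by linear_combination htr2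
    exact sub_eq_zero.1 ((mul_eq_zero.1 this).resolve_right (mul_ne_zero hγ hkC))
  rw [hg] at htr1 hg₀
  have hcard : Fintype.card F = Fintype.card ι := by
    exact_mod_cast mul_left_cancel₀ hγ htr1
  refine ⟨?_, hcard, hg₀⟩
  have hvw1 : v * w = γ • (1 : Matrix ι ι ℂ) := by
    have h1 : w * (γ⁻¹ • v) = 1 := by
      rw [Matrix.mul_smul, hg₀, smul_smul, inv_mul_cancel₀ hγ, one_smul]
    have h2 := (Matrix.mul_eq_one_comm_of_card_eq _ _ _ hcard).1 h1
    rw [Matrix.smul_mul] at h2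
    rw [← h2, smul_smul, mul_inv_cancel₀ hγ, one_smul]
  -- The linear coefficient along the same shears makes `w x v` scalar. As `v` and `w` are inverse
  -- up to `γ`, the traceless `x` is scalar, hence zero.
  obtain ⟨c, hc⟩ := exists_eq_smul_one_of_trace_mul_eq_zero (G := w * x * v) (by
    intro a b hab
    have h1 := (hquad _ (hshear _ (hvec a b hab) 2 two_ne_zero)).1
    rw [hx, tracelessPart_mul_tracelessPart_trace hk0, ← hx] at h1
    rw [← h1, ← Matrix.mul_assoc, Matrix.trace_mul_comm]
    simp only [← Matrix.mul_assoc]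
    rw [Matrix.mul_assoc, Matrix.trace_mul_comm]
    simp only [Matrix.mul_assoc]
    rw [Matrix.trace_mul_comm]
    simp only [Matrix.mul_assoc])
  have h1 : (γ * γ) • x = (c * γ) • (1 : Matrix ι ι ℂ) := by
    have h2 : v * (w * x * v) * w = (v * w) * x * (v * w) := by simp only [Matrix.mul_assoc]
    rw [hc, hvw1] at h2
    simp only [Matrix.smul_mul, Matrix.mul_smul, Matrix.mul_one, Matrix.one_mul, smul_smul,
      hvw1] at h2
    exact h2.symm
  have h2 := congrArg Matrix.trace h1
  rw [Matrix.trace_smul, hx, trace_tracelessPart hk0, smul_zero, Matrix.trace_smul,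
    Matrix.trace_one, smul_eq_mul, eq_comm, mul_eq_zero] at h2
  rw [h2.resolve_right hkC, zero_smul, smul_eq_zero] at h1
  exact h1.resolve_left (mul_ne_zero hγ hγ)

/-- Otherwise `X` would be scalar both before and after a small shear, so `v A w` would be scalar.
Conjugating back by `w v = γ` would make the matrix unit `A` scalar, although `|F| ≥ 2`. -/
theorem exists_two_eigenvalues {γ : ℂ} (hγ : γ ≠ 0) (hk : 2 ≤ Fintype.card ι)
    {U : Set (CMData ι F)} (hU : IsOpen U) {q : CMData ι F} (hqU : q ∈ U)
    (hq : q ∈ cmLevel ι F γ) : ∃ q' ∈ U, q' ∈ cmLevel ι F γ ∧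
      ∀ c : ℂ, (q'.1 - c • (1 : Matrix ι ι ℂ)) ^ Fintype.card ι ≠ 0 := by
  by_contra! hnil
  obtain ⟨X, P, v, w⟩ := q
  obtain ⟨hX, hcard, hwv⟩ := tracelessPart_eq_zero_of_single_eigenvalue hγ hk hU hnil hqU hq
  obtain ⟨i, j, hij⟩ := Fintype.exists_pair_of_one_lt_card (α := F) (by omega)
  let A : Matrix F F ℂ := Matrix.vecMulVec (Pi.single i 1) (Pi.single j 1)
  have hA : A * A = 0 := by
    simp [A, Matrix.vecMulVec_mul_vecMulVec, hij.symm]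
  have hcont : Continuous fun t : ℂ =>
    ((X + t • (v * A * w), P, v - t • (P * v * A), w + t • (A * w * P)) : CMData ι F) := by fun_prop
  have hev : ∀ᶠ t in 𝓝 (0 : ℂ),
      ((X + t • (v * A * w), P, v - t • (P * v * A), w + t • (A * w * P)) : CMData ι F) ∈ U :=
    hcont.continuousAt.eventually_mem (hU.mem_nhds (by simpa using hqU))
  obtain ⟨t, ht, ht0⟩ := ((hev.filter_mono nhdsWithin_le_nhds).and
    (self_mem_nhdsWithin : {(0 : ℂ)}ᶜ ∈ 𝓝[≠] 0)).exists
  have h1 := (tracelessPart_eq_zero_of_single_eigenvalue hγ hk hU hnil ht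
    (shear_mem_cmLevel hq hA t)).1
  rw [tracelessPart_add_smul, hX, zero_add, smul_eq_zero] at h1
  have h2 := h1.resolve_left ht0
  rw [tracelessPart, sub_eq_zero] at h2
  have h3 : w * (v * A * w) * v = (w * v) * A * (w * v) := by simp only [Matrix.mul_assoc]
  rw [h2, hwv, Matrix.mul_smul, Matrix.smul_mul, Matrix.mul_one, hwv] at h3
  have h4 := congrFun (congrFun h3 i) j
  simp [A, hij, hγ, Matrix.vecMulVec_apply] at h4

/-- If `γ ≠ 0`, then the solutions of `[X, P] = v w - γ` for which `X` has a simple spectrum are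
dense. -/
theorem exists_separable_charpoly {γ : ℂ} (hγ : γ ≠ 0) (k : ℕ) :
    ∀ U : Set (CMData (Fin k) F), IsOpen U → ∀ q ∈ U, q ∈ cmLevel (Fin k) F γ →
      ∃ q' ∈ U, q' ∈ cmLevel (Fin k) F γ ∧ q'.1.charpoly.Separable := by
  induction k using Nat.strong_induction_on with
  | _ k ih =>
    intro U hU q hqU hq
    rcases Nat.lt_or_ge k 2 with hk | hk
    · refine ⟨q, hqU, hq, ?_⟩
      have hdeg : q.1.charpoly.natDegree = k := by
        rw [Matrix.charpoly_natDegree_eq_dim, Fintype.card_fin]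
      interval_cases k
      · rw [(Matrix.charpoly_monic _).natDegree_eq_zero.1 hdeg]
        exact Polynomial.separable_one
      · rw [(Matrix.charpoly_monic _).eq_X_add_C hdeg]
        exact Polynomial.separable_X_add_C _
    · obtain ⟨q', hq'U, hq', h⟩ := exists_two_eigenvalues hγ (by simpa using hk) hU hqU hq
      exact exists_separable_of_two_eigenvalues
        (fun l hl => ih l (by simpa using hl)) hU hq'U hq' h

end SingleEigenvalue

/-! ### Reduction of the cycle to one vertex, and density -/

section Unroll

variable {m n : ℕ} [NeZero m] {d : ZMod m → ℕ}

theorem sum_filter_sub_one_val_lt {M : Type*} [AddCommGroup M] (D : ZMod m → M) {i : ZMod m}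
    (hi : i ≠ 0) : ∑ r ∈ Finset.univ.filter (fun r : ZMod m => (i - 1).val < r.val), D r =
      D i + ∑ r ∈ Finset.univ.filter (fun r : ZMod m => i.val < r.val), D r := by
  have h1 : (i - 1).val + 1 = i.val := by
    rcases val_add_one_cases (i - 1) with h | ⟨h, -⟩
    · rw [← h, sub_add_cancel]
    · rw [sub_add_cancel, ZMod.val_eq_zero] at h
      exact absurd h hi
  have h2 : Finset.univ.filter (fun r : ZMod m => (i - 1).val < r.val) =
      insert i (Finset.univ.filter (fun r : ZMod m => i.val < r.val)) := by
    ext r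
    simp only [Finset.mem_filter, Finset.mem_univ, true_and, Finset.mem_insert]
    rw [← Nat.add_one_le_iff, h1, le_iff_eq_or_lt, (ZMod.val_injective m).eq_iff, eq_comm]
  rw [h2, Finset.sum_insert (by simp)]

theorem neg_one_val_add_one : (-1 : ZMod m).val + 1 = m := by
  rcases val_add_one_cases (-1 : ZMod m) with h | ⟨-, h⟩
  · rw [neg_add_cancel, ZMod.val_zero] at h
    omega
  · exact h

/-- The `i`-th component of the moment map equation, without the commutator. -/
def momentTerm (g : ZMod m → ℂ) (v : (i : ZMod m) → Matrix (Fin n) (Fin (d i)) ℂ)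
    (w : (i : ZMod m) → Matrix (Fin (d i)) (Fin n) ℂ) (i : ZMod m) : Matrix (Fin n) (Fin n) ℂ :=
  v i * w i - g i • (1 : Matrix (Fin n) (Fin n) ℂ)

/-- The column blocks of `v : ⨁ ℂ^(d i) → V`. -/
def colBlock (v : Matrix (Fin n) (Σ i, Fin (d i)) ℂ) (i : ZMod m) :
    Matrix (Fin n) (Fin (d i)) ℂ := v.submatrix id fun a => ⟨i, a⟩

/-- The row blocks of `w : V → ⨁ ℂ^(d i)`. -/
def rowBlock (w : Matrix (Σ i, Fin (d i)) (Fin n) ℂ) (i : ZMod m) :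
    Matrix (Fin (d i)) (Fin n) ℂ := w.submatrix (fun a => ⟨i, a⟩) id

/-- The quadruple with `P_{m-1} = c.1`, the other `P_i` being `1`, and `X_{m-1} = -c.2.1`. -/
def unroll (g : ZMod m → ℂ) (c : CMData (Fin n) (Σ i, Fin (d i))) : Quad m n d where
  P i := if i = -1 then c.1 else 1
  X i := if i = -1 then -c.2.1 else -(c.1 * c.2.1) +
    ∑ r ∈ Finset.univ.filter (fun r : ZMod m => i.val < r.val),
      momentTerm g (colBlock c.2.2.1) (rowBlock c.2.2.2) r
  v := colBlock c.2.2.1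
  w := rowBlock c.2.2.2

theorem sum_momentTerm (g : ZMod m → ℂ) (v : Matrix (Fin n) (Σ i, Fin (d i)) ℂ)
    (w : Matrix (Σ i, Fin (d i)) (Fin n) ℂ) :
    ∑ r, momentTerm g (colBlock v) (rowBlock w) r =
      v * w - (∑ i, g i) • (1 : Matrix (Fin n) (Fin n) ℂ) := by
  simp only [momentTerm]
  rw [Finset.sum_sub_distrib, ← Finset.sum_smul]
  congr 1
  ext a b
  rw [Matrix.sum_apply, Matrix.mul_apply, Fintype.sum_sigma]
  rfl

/-- With all other `P_i` equal to `1`, the equations at `i ≠ 0` determine the `X_i` successively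
from `X_{-1}`. The equation at `0` becomes the sum of all of them, which is `[X_{-1}, P_{-1}] = v w
- |g|`, that is, the one-vertex equation for the pair `(P_{-1}, -X_{-1})`. -/
theorem unroll_mem_levelSet {g : ZMod m → ℂ} {c : CMData (Fin n) (Σ i, Fin (d i))}
    (hc : c ∈ cmLevel (Fin n) (Σ i, Fin (d i)) (∑ i, g i)) : unroll g c ∈ levelSet n d g := by
  rw [mem_levelSet_iff]
  have hPX : ∀ i, (unroll g c).P i * (unroll g c).X i = -(c.1 * c.2.1) +
      ∑ r ∈ Finset.univ.filter (fun r : ZMod m => i.val < r.val),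
        momentTerm g (unroll g c).v (unroll g c).w r := by
    intro i
    by_cases hi : i = -1
    · have h0 : Finset.univ.filter (fun r : ZMod m => i.val < r.val) = ∅ := by
        ext r
        have h1 := neg_one_val_add_one (m := m)
        have h2 := ZMod.val_lt r
        simp only [Finset.mem_filter, Finset.mem_univ, true_and, Finset.notMem_empty, iff_false, hi]
        omega
      rw [h0, Finset.sum_empty, add_zero]
      simp [unroll, hi]
    · simp only [unroll, if_neg hi, one_mul]
  have hc' : c.1 * c.2.1 - c.2.1 * c.1 = c.2.2.1 * c.2.2.2 - (∑ i, g i) • 1 := hc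
  have hsum : ∑ r, momentTerm g (unroll g c).v (unroll g c).w r =
      c.1 * c.2.1 - c.2.1 * c.1 := by
    rw [hc']; exact sum_momentTerm g _ _
  intro i
  rw [hPX]
  change _ = momentTerm g (unroll g c).v (unroll g c).w i
  by_cases hi : i = 0
  · have h0 : Finset.univ.filter (fun r : ZMod m => i.val < r.val) = Finset.univ.erase i := by
      ext r
      simp [hi, Nat.pos_iff_ne_zero]
    have h1 : (unroll g c).X (i - 1) * (unroll g c).P (i - 1) = -(c.2.1 * c.1) := by
      simp [unroll, hi]
    rw [h1, h0, ← sub_sub, sub_eq_iff_eq_add, Finset.add_sum_erase _ _ (Finset.mem_univ i), hsum]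
    abel
  · have hi' : i - 1 ≠ -1 := by
      rw [sub_eq_add_neg]
      simpa using hi
    have h1 : (unroll g c).X (i - 1) * (unroll g c).P (i - 1) =
        (unroll g c).P (i - 1) * (unroll g c).X (i - 1) := by
      simp only [unroll, if_neg hi', one_mul, mul_one]
    rw [h1, hPX, sum_filter_sub_one_val_lt _ hi]
    abel

/-- `P_i X_i` minus the tail sum of the moment terms is conserved along the cycle from `0` to `m -
1`, where the tail is empty. -/
theorem unroll_surjective {g : ZMod m → ℂ} {q : Quad m n d} (hq : q ∈ levelSet n d g)
    (hP : ∀ i, i ≠ -1 → q.P i = 1) :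
    ∃ c ∈ cmLevel (Fin n) (Σ i, Fin (d i)) (∑ i, g i), unroll g c = q := by
  rw [mem_levelSet_iff] at hq
  let c : CMData (Fin n) (Σ i, Fin (d i)) := (q.P (-1), -q.X (-1), Matrix.of fun a x => q.v x.1 a x.2,
    Matrix.of fun x a => q.w x.1 x.2 a)
  let D := momentTerm g q.v q.w
  have hD : ∀ i, q.X (i - 1) * q.P (i - 1) = q.P i * q.X i + D i := by
    intro i
    rw [← sub_eq_iff_eq_add', hq i]; rfl
  let H : ZMod m → Matrix (Fin n) (Fin n) ℂ := fun i => q.P i * q.X i -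
    ∑ r ∈ Finset.univ.filter (fun r : ZMod m => i.val < r.val), D r
  have hH : ∀ i, i ≠ 0 → H (i - 1) = H i := by
    intro i hi
    have hi' : i - 1 ≠ -1 := by
      rw [sub_eq_add_neg]
      simpa using hi
    have h1 := hD i
    have h2 : q.X (i - 1) * q.P (i - 1) = q.P (i - 1) * q.X (i - 1) := by
      rw [hP _ hi', one_mul, mul_one]
    simp only [H]
    rw [sum_filter_sub_one_val_lt _ hi, ← h2, h1]
    abel
  have hH0 : ∀ k : ℕ, k < m → H k = H 0 := by
    intro k
    induction k with
    | zero => intro _; rw [Nat.cast_zero]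
    | succ k ih =>
      intro hk
      have h1 := hH ((k + 1 : ℕ) : ZMod m) (by
        intro h0
        rw [ZMod.natCast_eq_zero_iff] at h0
        exact absurd (Nat.le_of_dvd (Nat.succ_pos k) h0) (not_le.2 hk))
      rw [Nat.cast_succ, add_sub_cancel_right, ← Nat.cast_succ] at h1
      rw [← h1, ih (by omega)]
  have hHc : ∀ i, H i = H 0 := fun i => by
    have := hH0 i.val (ZMod.val_lt i)
    rwa [ZMod.natCast_zmod_val] at this
  have hm1 : H (-1) = q.P (-1) * q.X (-1) := by
    have h0 : Finset.univ.filter (fun r : ZMod m => (-1 : ZMod m).val < r.val) = ∅ := by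
      ext r
      have h1 := neg_one_val_add_one (m := m)
      have h2 := ZMod.val_lt r
      simp only [Finset.mem_filter, Finset.mem_univ, true_and, Finset.notMem_empty, iff_false]
      omega
    simp only [H, h0, Finset.sum_empty, sub_zero]
  have hPX : ∀ i, q.P i * q.X i = q.P (-1) * q.X (-1) +
      ∑ r ∈ Finset.univ.filter (fun r : ZMod m => i.val < r.val), D r := by
    intro i
    rw [← hm1, hHc, ← hHc i]
    simp only [H, sub_add_cancel]
  refine ⟨c, ?_, ?_⟩
  · change q.P (-1) * -q.X (-1) - -q.X (-1) * q.P (-1) = _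
    have h0 : Finset.univ.filter (fun r : ZMod m => (0 : ZMod m).val < r.val) =
        Finset.univ.erase 0 := by
      ext r
      simp [Nat.pos_iff_ne_zero]
    have h1 := hD 0
    rw [hPX, h0, zero_sub, add_assoc, Finset.sum_erase_add _ _ (Finset.mem_univ _)] at h1
    have h2 := sum_momentTerm g c.2.2.1 c.2.2.2
    refine Eq.trans ?_ h2
    rw [neg_mul, mul_neg, sub_neg_eq_add, h1, neg_add_cancel_left]
    rfl
  · ext1
    · funext i
      by_cases hi : i = -1
      · simp [unroll, hi, c]
      · have h1 := hPX i
        rw [hP i hi, one_mul] at h1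
        simp only [unroll, if_neg hi, c]
        rw [h1, mul_neg, neg_neg]
        rfl
    · funext i
      by_cases hi : i = -1
      · simp [unroll, hi, c]
      · simp [unroll, hi, hP i hi]
    · rfl
    · rfl

theorem continuous_unroll (g : ZMod m → ℂ) :
    Continuous (unroll g : CMData (Fin n) (Σ i, Fin (d i)) → Quad m n d) := by
  have hv : ∀ i, Continuous fun c : CMData (Fin n) (Σ i, Fin (d i)) =>
      colBlock c.2.2.1 i := fun i =>
    Continuous.matrix_submatrix (A := fun c : CMData (Fin n) (Σ i, Fin (d i)) => c.2.2.1)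
      (by fun_prop) _ _
  have hw : ∀ i, Continuous fun c : CMData (Fin n) (Σ i, Fin (d i)) =>
      rowBlock c.2.2.2 i := fun i =>
    Continuous.matrix_submatrix (A := fun c : CMData (Fin n) (Σ i, Fin (d i)) => c.2.2.2)
      (by fun_prop) _ _
  refine continuous_induced_rng.2 (Continuous.prodMk ?_ (Continuous.prodMk ?_ (Continuous.prodMk
    (continuous_pi hv) (continuous_pi hw))))
  · refine continuous_pi fun i => ?_
    by_cases hi : i = -1
    · simp only [unroll, if_pos hi]
      fun_prop
    · simp only [unroll, if_neg hi, momentTerm]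
      refine Continuous.add (by fun_prop) (continuous_finsetSum _ fun r _ => ?_)
      exact ((hv r).matrix_mul (hw r)).sub continuous_const
  · refine continuous_pi fun i => ?_
    by_cases hi : i = -1
    · simp only [unroll, if_pos hi]
      fun_prop
    · simp only [unroll, if_neg hi]
      exact continuous_const

theorem monodromy_unroll (g : ZMod m → ℂ) (c : CMData (Fin n) (Σ i, Fin (d i))) :
    monodromy (unroll g c).P = c.1 := by
  have h1 : ∀ k : ℕ, k < m → pathP (unroll g c).P k = 1 := by
    intro k
    induction k with
    | zero => intro _; rfl
    | succ k ih =>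
      intro hk
      rw [pathP, ih (by omega), one_mul]
      refine if_neg fun h => ?_
      have h2 := neg_one_val_add_one (m := m)
      rw [← h, ZMod.val_natCast_of_lt (by omega)] at h2
      omega
  obtain ⟨k, hk⟩ := Nat.exists_eq_succ_of_ne_zero (NeZero.ne m)
  have h2 : ((k : ℕ) : ZMod m) = -1 := by
    rw [eq_neg_iff_add_eq_zero, ← Nat.cast_succ, ← hk, ZMod.natCast_self]
  have h3 : monodromy (unroll g c).P = pathP (unroll g c).P (k + 1) := by
    rw [monodromy]; exact congrArg _ hk
  rw [h3, pathP, h1 k (by omega), one_mul, h2]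
  exact if_pos rfl

theorem continuous_act (M : ZMod m → GL (Fin n) ℂ) :
    Continuous (Quad.act M : Quad m n d → Quad m n d) := by
  have h := Quad.continuous_toTuple (m := m) (n := n) (d := d)
  have hX : ∀ i, Continuous fun q : Quad m n d => q.X i := fun i =>
    (continuous_apply i).comp (continuous_fst.comp h)
  have hP : ∀ i, Continuous fun q : Quad m n d => q.P i := fun i =>
    (continuous_apply i).comp Quad.continuous_P
  have hv : ∀ i, Continuous fun q : Quad m n d => q.v i := fun i =>
    (continuous_apply i).comp (continuous_fst.comp (continuous_snd.comp (continuous_snd.comp h)))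
  have hw : ∀ i, Continuous fun q : Quad m n d => q.w i := fun i =>
    (continuous_apply i).comp (continuous_snd.comp (continuous_snd.comp (continuous_snd.comp h)))
  refine continuous_induced_rng.2 (Continuous.prodMk ?_ (Continuous.prodMk ?_ (Continuous.prodMk
    ?_ ?_))) <;> refine continuous_pi fun i => ?_
  · exact (continuous_const.matrix_mul (hX i)).matrix_mul continuous_const
  · exact (continuous_const.matrix_mul (hP i)).matrix_mul continuous_const
  · exact continuous_const.matrix_mul (hv i)
  · exact (hw i).matrix_mul continuous_const

theorem det_P_ne_zero_of_det_bigP_ne_zero {q : Quad m n d} (h : q.bigP.det ≠ 0) (i : ZMod m) :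
    (q.P i).det ≠ 0 := by
  intro h0
  obtain ⟨u, hu, hPu⟩ := Matrix.exists_mulVec_eq_zero_iff.2 h0
  refine h (Matrix.exists_mulVec_eq_zero_iff.1
    ⟨fun a => if a.1 = i + 1 then u a.2 else 0, ?_, ?_⟩)
  · intro h1
    refine hu (funext fun a => ?_)
    simpa using congrFun h1 (i + 1, a)
  · ext ⟨j, a⟩
    rw [Matrix.mulVec, dotProduct, Fintype.sum_prod_type]
    rw [Finset.sum_eq_single (i + 1)]
    · by_cases hj : i = j
      · subst hj
        simpa [Quad.bigP, Matrix.mulVec, dotProduct] using congrFun hPu a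
      · simp [Quad.bigP, hj]
    · intro k _ hk
      simp [hk]
    · simp

/-- The partial products `P_0 ⋯ P_{i-1}` are the gauge transformation that turns every `P_i` with `i
≠ -1` into `1` and collects the monodromy at the last arrow. -/
theorem exists_gauge_unroll {g : ZMod m → ℂ} {q : Quad m n d} (hq : q ∈ levelSet n d g)
    (h : q.bigP.det ≠ 0) : ∃ M : ZMod m → GL (Fin n) ℂ,
      ∃ c ∈ cmLevel (Fin n) (Σ i, Fin (d i)) (∑ i, g i), (unroll g c).act M = q ∧ c.1.det ≠ 0 := by
  have hdet : ∀ k, (pathP q.P k).det ≠ 0 := by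
    intro k
    rw [det_pathP, Finset.prod_ne_zero_iff]
    exact fun j _ => det_P_ne_zero_of_det_bigP_ne_zero h _
  let M : ZMod m → GL (Fin n) ℂ := fun i =>
    Matrix.GeneralLinearGroup.mkOfDetNeZero (pathP q.P i.val) (hdet i.val)
  have hP : ∀ i, i ≠ -1 → (q.act M).P i = 1 := by
    intro i hi
    have h1 : (M i).val * q.P i = (M (i + 1)).val := by
      change pathP q.P i.val * q.P i = pathP q.P (i + 1).val
      rcases val_add_one_cases i with h1 | ⟨h1, -⟩
      · rw [h1, pathP, ZMod.natCast_zmod_val]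
      · rw [ZMod.val_eq_zero] at h1
        exact absurd (eq_neg_of_add_eq_zero_left h1) hi
    simp only [Quad.act, h1]
    exact Units.mul_inv _
  obtain ⟨c, hc, hcq⟩ := unroll_surjective (act_mem_levelSet hq M) hP
  refine ⟨M⁻¹, c, hc, ?_, ?_⟩
  · rw [hcq, ← Quad.act_mul, inv_mul_cancel, Quad.act_one]
  · rw [← monodromy_unroll g c, hcq, monodromy_act, Matrix.det_mul_comm, ← mul_assoc,
      ← Units.val_mul, inv_mul_cancel, Units.val_one, one_mul]
    exact hdet m

/-- Once `P` is invertible, `unroll` and the gauge action pull the open set back to the one-vertex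
problem. There the monodromy is the first matrix, and `exists_separable_charpoly` applies within the
open set where it stays invertible. -/
theorem dense_diagLocus (d : ZMod m → ℕ) {g : ZMod m → ℂ} (hg : IsRegularParam g) :
    Dense (diagLocus n d g) := by
  rw [dense_iff_inter_open]
  rintro O hO ⟨x, hx⟩
  obtain ⟨⟨q, hq⟩, rfl⟩ := Quotient.exists_rep x
  have hmk : Continuous (CMSpace.mk : levelSet n d g → CMSpace n d g) := continuous_quotient_mk'
  obtain ⟨U, hU, hUO⟩ := isOpen_induced_iff.1 (hO.preimage hmk)
  have hmem : ∀ p (hp : p ∈ levelSet n d g), p ∈ U ↔ CMSpace.mk ⟨p, hp⟩ ∈ O := by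
    intro p hp
    exact Set.ext_iff.1 hUO ⟨p, hp⟩
  obtain ⟨q₁, hq₁U, hq₁, hdet⟩ := exists_det_bigP_ne_zero hg hU ((hmem q hq).2 hx) hq
  obtain ⟨M, c, hc, hcq, hcdet⟩ := exists_gauge_unroll hq₁ hdet
  let W : Set (CMData (Fin n) (Σ i, Fin (d i))) := {c | (unroll g c).act M ∈ U ∧ c.1.det ≠ 0}
  have hW : IsOpen W :=
    (hU.preimage ((continuous_act M).comp (continuous_unroll g))).inter
      (isOpen_ne.preimage (Continuous.matrix_det continuous_fst))
  obtain ⟨c', ⟨hc'U, hc'det⟩, hc', hsep⟩ := exists_separable_charpoly hg.1 n W hW c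
    ⟨by rw [hcq]; exact hq₁U, hcdet⟩ hc
  have hlev := act_mem_levelSet (unroll_mem_levelSet hc') M
  refine ⟨CMSpace.mk ⟨_, hlev⟩, (hmem _ hlev).1 hc'U, (mk_mem_diagLocus_iff _).2 ?_⟩
  rw [monodromy_act, regularMonodromy_conj, monodromy_unroll]
  exact ⟨hc'det, hsep⟩

end Unroll

end CyclicCM

theorem theorem1p2 (m n : ℕ) [NeZero m] (g : ZMod m → ℂ) (hg : ∑ i, g i ≠ 0) :
    -- the spinless space
    ((∃ s : CMSpace n (spinlessFraming m) g → RatFunc ℂ,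
        ∀ q : levelSet n (spinlessFraming m) g, s (CMSpace.mk q) = q.1.sklyanin g) ∧
      IsOpen (diagLocus n (spinlessFraming m) g) ∧
      (IsRegularParam g → Dense (diagLocus n (spinlessFraming m) g)) ∧
      (∀ y ∈ coordDomain m n, spinlessQuad g y ∈ levelSet n (spinlessFraming m) g) ∧
      (∀ x : CMSpace n (spinlessFraming m) g, x ∈ diagLocus n (spinlessFraming m) g ↔
        ∃ y ∈ coordDomain m n, ∃ q : levelSet n (spinlessFraming m) g,
          q.1 = spinlessQuad g y ∧ CMSpace.mk q = x) ∧
      (∃ f : Fin n → (Fin n → ℂ) → ℂ,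
        (∀ k, ∀ y ∈ coordDomain m n, theta g k y = y.2 k / (m : ℂ) + f k y.1) ∧
        (∀ k, ∀ l ∈ regularSpectrum m n, DifferentiableAt ℂ (f k) l) ∧
        (∀ j k, ∀ l ∈ regularSpectrum m n,
          fderiv ℂ (f j) l (Pi.single k 1) = fderiv ℂ (f k) l (Pi.single j 1))) ∧
      (∀ y ∈ coordDomain m n,
        (∀ k, DifferentiableAt ℂ (theta g k) y) ∧
        (∀ j k, poisson m (fun y' : Coord n => y'.1 j) (theta g k) y = if j = k then 1 else 0) ∧
        (∀ j k, poisson m (theta g j) (theta g k) y = 0))) ∧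
    -- the spin space
    (∀ d : ℕ,
      (∃ s : CMSpace n (spinFraming m d) g → RatFunc ℂ,
        ∀ q : levelSet n (spinFraming m d) g, s (CMSpace.mk q) = q.1.sklyanin g) ∧
      IsOpen (diagLocus n (spinFraming m d) g) ∧
      (IsRegularParam g → Dense (diagLocus n (spinFraming m d) g)) ∧
      (∀ y ∈ spinDomain n d g, spinQuad g y ∈ levelSet n (spinFraming m d) g) ∧
      (∀ x : CMSpace n (spinFraming m d) g, x ∈ diagLocus n (spinFraming m d) g ↔
        ∃ y ∈ spinDomain n d g, ∃ q : levelSet n (spinFraming m d) g,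
          q.1 = spinQuad g y ∧ CMSpace.mk q = x) ∧
      (∀ y ∈ spinDomain n d g,
        (∀ k, DifferentiableAt ℂ (spinTheta g k) y) ∧
        (∀ j k, SpinPoissonEq g (fun y' => y'.1 j) (spinTheta g k) y (if j = k then 1 else 0)) ∧
        (∀ j k, SpinPoissonEq g (spinTheta g j) (spinTheta g k) y 0))) := by
  refine ⟨⟨exists_sklyanin_lift g, isOpen_diagLocus _ g, dense_diagLocus _,
    fun y hy => spinlessQuad_mem_levelSet hy, mem_diagLocus_spinless_iff hg,
    ⟨thetaPot g, fun k y hy => theta_eq hg k hy, fun k l hl => differentiableAt_thetaPot g k hl,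
      fun j k l hl => fderiv_thetaPot_symm g j k hl⟩,
    fun y hy => ⟨fun k => (hasFDerivAt_theta hg k hy).differentiableAt,
      fun j k => poisson_lambda_theta hg j k hy, fun j k => poisson_theta_theta hg j k hy⟩⟩,
    fun d => ⟨exists_sklyanin_lift g, isOpen_diagLocus _ g, dense_diagLocus _,
      fun y hy => spinQuad_mem_levelSet hy, mem_diagLocus_spin_iff g,
      fun y hy => ⟨fun k => differentiableAt_spinTheta hg k hy.1,
        fun j k => spinPoissonEq_lambda_theta hg hy j k,
        fun j k => spinPoissonEq_theta_theta hg hy j k⟩⟩⟩
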